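/- Notation. $|A|$ is the Euclidean (Frobenius) norm of $A\in\mathbb{R}^{d\times m}$ and $l_{A,b}(x)=Ax+b$. A regular domain is a nonempty, open, bounded, connected set $\Omega\subset\mathbb{R}^m$ with $|\partial\Omega|=0$. A map $u$ on $\Omega$ is piecewise affine if there are at most countably many pairwise disjoint regular domains $\Omega_i\subset\Omega$ with $|\Omega\setminus\bigcup_i\Omega_i|=0$ such that $u$ agrees with an affine map on each $\Omega_i$. All measures below are Borel measures on $\mathbb{R}^{d\times m}$; "barycenter $A$" means $\int|X|\,d\nu(X)<\infty$ and $\int X\,d\nu(X)=A$; "supported in $K$" means $\nu(K^c)=0$. Laminates of finite order are the smallest class of probability measures that contains all Dirac masses and is closed under elementary splitting, i.e. under replacing $\lambda\delta_C+(1-\lambda)\tilde\nu$ by $\lambda(\lambda'\delta_B+(1-\lambda')\delta_{B'})+(1-\lambda)\tilde\nu$, where $\lambda\in[0,1]$, $\tilde\nu$ is a probability measure, $\lambda'\in(0,1)$, $C=\lambda'B+(1-\lambda')B'$ and $\operatorname{rank}(B'-B)=1$. A staircase laminate supported in $K$ with barycenter $B$ is a probability measure $\nu^\infty$ with barycenter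 $B$ for which there are matrices $A_n\notin K$ ($n\ge0$), $A_0=B$, probability measures $\mu_n$ supported in $K$ and $\gamma_n\in(0,1)$ ($n\ge1$) such that $(1-\gamma_n)\mu_n+\gamma_n\delta_{A_n}$ is a laminate of finite order with barycenter $A_{n-1}$ for each $n\ge1$, $|A_n|$ is nondecreasing and tends to $\infty$, $\beta_n=\prod_{k=1}^n\gamma_k\to0$, and $\nu^\infty(E)=\lim_{N\to\infty}\big(\sum_{n=1}^N\beta_{n-1}(1-\gamma_n)\mu_n(E)+\beta_N\delta_{A_N}(E)\big)$ for every Borel set $E$. An extended staircase laminate supported in $K$ with barycenter $A$ is a measure $\nu=\sum_{j=1}^{J'}\lambda_j\delta_{B_j}+\sum_{j=J'+1}^{J}\lambda_j\tilde\nu_j$ with $0\le J'\le J$ and $\lambda_j\ge0$, where $\sum_{j=1}^J\lambda_j\delta_{B_j}$ is a laminate of finite order with barycenter $A$, $B_j\in K$ for $j\le J'$, and $\tilde\nu_j$ is a staircase laminate supported in $K$ with barycenter $B_j$ for $j>J'$. Theorem. Let $K\subset\mathbb{R}^{d\times m}$, $1<p\le r<\infty$, $0\le\rho\le r$ and $M>1$.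 Suppose that for every $A\in\mathbb{R}^{d\times m}$ there is an extended staircase laminate $\nu_A$ supported in $K$ with barycenter $A$ such that $$M^{-p}(1+|A|^\rho)t^{-p}\le\nu_A(\{X:|X|>t\})\le M^p(1+|A|^r)t^{-p}\qquad\text{for all }t>1+|A|.$$ Then for every regular domain $\Omega\subset\mathbb{R}^m$, every $A\in\mathbb{R}^{d\times m}$, $b\in\mathbb{R}^d$, $\delta>0$ and $\alpha\in[0,1)$ there is a piecewise affine map $u\in W^{1,1}(\Omega;\mathbb{R}^d)\cap C^\alpha(\overline\Omega;\mathbb{R}^d)$ with $u=l_{A,b}$ on $\partial\Omega$ such that $\nabla u\in K$ a.e. in $\Omega$, $\|u-l_{A,b}\|_{C^\alpha(\overline\Omega)}<\delta$, and $$\tfrac12M^{-p}(1+|A|^\rho)t^{-p}\le\frac{|\{x\in\Omega:|\nabla u(x)|>t\}|}{|\Omega|}\le2M^p(1+|A|^r)t^{-p}\qquad\text{for all }t>1+|A|.$$ -/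

import Mathlib

open MeasureTheory Filter Topology
open scoped NNReal ENNReal ContDiff

/- `‖A‖` is the Euclidean (Frobenius) norm of a matrix, `‖A‖² = ∑ A i j ^ 2`. -/
open scoped Matrix.Norms.Frobenius

noncomputable section

namespace StaircaseLaminates

/-! ### Borel structure on matrix space -/

instance instMeasurableSpaceMatrix (d m : ℕ) : MeasurableSpace (Matrix (Fin d) (Fin m) ℝ) :=
  borel _

instance instBorelSpaceMatrix (d m : ℕ) : BorelSpace (Matrix (Fin d) (Fin m) ℝ) :=
  ⟨rfl⟩

/-! ### Laminates of finite order -/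

/-- `μ` is obtained from `ν` by elementary splitting: a part `l δ_A` of `ν` is replaced by
`l (l' δ_B + (1 - l') δ_{B'})`, where `A = l' B + (1 - l') B'` and `rank (B' - B) = 1`. -/
def ElementarySplitting {d m : ℕ} (ν μ : Measure (Matrix (Fin d) (Fin m) ℝ)) : Prop :=
  ∃ (l l' : ℝ) (A B B' : Matrix (Fin d) (Fin m) ℝ) (ν' : Measure (Matrix (Fin d) (Fin m) ℝ)),
    0 ≤ l ∧ l ≤ 1 ∧ 0 < l' ∧ l' < 1 ∧ IsProbabilityMeasure ν' ∧
    A = l' • B + (1 - l') • B' ∧ (B' - B).rank = 1 ∧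
    ν = ENNReal.ofReal l • Measure.dirac A + ENNReal.ofReal (1 - l) • ν' ∧
    μ = ENNReal.ofReal l •
          (ENNReal.ofReal l' • Measure.dirac B + ENNReal.ofReal (1 - l') • Measure.dirac B') +
        ENNReal.ofReal (1 - l) • ν'

/-- Laminates of finite order: the smallest set of measures that contains all Dirac masses and is
invariant under elementary splitting. -/
inductive IsFiniteLaminate {d m : ℕ} : Measure (Matrix (Fin d) (Fin m) ℝ) → Prop
  | dirac (A : Matrix (Fin d) (Fin m) ℝ) : IsFiniteLaminate (Measure.dirac A)
  | split (ν μ : Measure (Matrix (Fin d) (Fin m) ℝ)) :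
      IsFiniteLaminate ν → ElementarySplitting ν μ → IsFiniteLaminate μ

/-- `A` is the center of mass of `ν`, entry by entry; the first moment is required to be finite. -/
def HasBarycenter {d m : ℕ} (ν : Measure (Matrix (Fin d) (Fin m) ℝ))
    (A : Matrix (Fin d) (Fin m) ℝ) : Prop :=
  ∀ i j, Integrable (fun X : Matrix (Fin d) (Fin m) ℝ => X i j) ν ∧ ∫ X, X i j ∂ν = A i j

/-! ### Staircase laminates -/

/-- `β_N = γ_0 ⋯ γ_{N-1}`, the mass that is still to be split after `N` steps. -/
def stairMass (γ : ℕ → ℝ) (N : ℕ) : ℝ := ∏ k ∈ Finset.range N, γ k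

/-- The measure `ν^N = ∑_{n < N} β_n (1 - γ_n) μ_n + β_N δ_{A_N}` reached after `N` steps. -/
def stairMeasure {d m : ℕ} (A : ℕ → Matrix (Fin d) (Fin m) ℝ)
    (μ : ℕ → Measure (Matrix (Fin d) (Fin m) ℝ)) (γ : ℕ → ℝ) (N : ℕ) :
    Measure (Matrix (Fin d) (Fin m) ℝ) :=
  ∑ n ∈ Finset.range N, ENNReal.ofReal (stairMass γ n * (1 - γ n)) • μ n +
    ENNReal.ofReal (stairMass γ N) • Measure.dirac (A N)

/-- `ν` is a staircase laminate supported in `K` with barycenter `A`. Step `n = 0, 1, …` replaces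
`δ_{A_n}` by the laminate of finite order `(1 - γ_n) μ_n + γ_n δ_{A_{n+1}}` with barycenter `A_n`,
where `μ_n` is a probability measure on `K`, and `ν` is the setwise limit of the `ν^N`. -/
def IsStaircaseLaminate {d m : ℕ} (K : Set (Matrix (Fin d) (Fin m) ℝ))
    (A : Matrix (Fin d) (Fin m) ℝ) (ν : Measure (Matrix (Fin d) (Fin m) ℝ)) : Prop :=
  ∃ (a : ℕ → Matrix (Fin d) (Fin m) ℝ) (μ : ℕ → Measure (Matrix (Fin d) (Fin m) ℝ)) (γ : ℕ → ℝ),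
    a 0 = A ∧ (∀ n, a n ∉ K) ∧
    (∀ n, IsProbabilityMeasure (μ n) ∧ μ n Kᶜ = 0) ∧
    (∀ n, 0 < γ n ∧ γ n < 1) ∧
    (∀ n,
      IsFiniteLaminate (ENNReal.ofReal (1 - γ n) • μ n +
        ENNReal.ofReal (γ n) • Measure.dirac (a (n + 1))) ∧
      HasBarycenter (ENNReal.ofReal (1 - γ n) • μ n +
        ENNReal.ofReal (γ n) • Measure.dirac (a (n + 1))) (a n)) ∧
    Monotone (fun n => ‖a n‖) ∧ Tendsto (fun n => ‖a n‖) atTop atTop ∧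
    Tendsto (stairMass γ) atTop (𝓝 0) ∧
    (∀ E, MeasurableSet E → Tendsto (fun N => stairMeasure a μ γ N E) atTop (𝓝 (ν E))) ∧
    HasBarycenter ν A

/-- Extended staircase laminates in `K` with barycenter `A`:
`ν = ∑_{j < J'} l_j δ_{B_j} + ∑_{J' ≤ j < J} l_j ν_j`, where `∑_{j < J} l_j δ_{B_j}` is a laminate
of finite order with barycenter `A`, `B_j ∈ K` for `j < J'`, and `ν_j` is a staircase laminate
supported in `K` with barycenter `B_j` for `J' ≤ j < J`. -/
def IsExtendedStaircase {d m : ℕ} (K : Set (Matrix (Fin d) (Fin m) ℝ))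
    (A : Matrix (Fin d) (Fin m) ℝ) (ν : Measure (Matrix (Fin d) (Fin m) ℝ)) : Prop :=
  ∃ (J' J : ℕ) (l : ℕ → ℝ) (B : ℕ → Matrix (Fin d) (Fin m) ℝ)
    (σ : ℕ → Measure (Matrix (Fin d) (Fin m) ℝ)),
    J' ≤ J ∧ (∀ j < J, 0 ≤ l j) ∧
    IsFiniteLaminate (∑ j ∈ Finset.range J, ENNReal.ofReal (l j) • Measure.dirac (B j)) ∧
    HasBarycenter (∑ j ∈ Finset.range J, ENNReal.ofReal (l j) • Measure.dirac (B j)) A ∧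
    (∀ j < J', B j ∈ K) ∧
    (∀ j, J' ≤ j → j < J → IsStaircaseLaminate K (B j) (σ j)) ∧
    ν = ∑ j ∈ Finset.range J', ENNReal.ofReal (l j) • Measure.dirac (B j) +
      ∑ j ∈ Finset.Ico J' J, ENNReal.ofReal (l j) • σ j

/-! ### Domains and maps -/

/-- Regular domains: open, bounded, connected (and nonempty), with Lebesgue-null boundary. -/
structure IsRegularDomain {m : ℕ} (Ω : Set (EuclideanSpace ℝ (Fin m))) : Prop where
  isOpen : IsOpen Ω
  isBounded : Bornology.IsBounded Ω
  isConnected : IsConnected Ω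
  volume_frontier : volume (frontier Ω) = 0

/-- The affine map `x ↦ A x + b`. -/
def affineMap {d m : ℕ} (A : Matrix (Fin d) (Fin m) ℝ) (b : EuclideanSpace ℝ (Fin d))
    (x : EuclideanSpace ℝ (Fin m)) : EuclideanSpace ℝ (Fin d) :=
  Matrix.toEuclideanLin A x + b

/-- `u` agrees with an affine map on each set of an at most countable family of pairwise disjoint
regular domains in `Ω` that covers `Ω` up to a null set. -/
def IsPiecewiseAffine {d m : ℕ} (Ω : Set (EuclideanSpace ℝ (Fin m)))
    (u : EuclideanSpace ℝ (Fin m) → EuclideanSpace ℝ (Fin d)) : Prop :=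
  ∃ S : Set (Set (EuclideanSpace ℝ (Fin m))),
    S.Countable ∧ S.PairwiseDisjoint id ∧
    (∀ V ∈ S, IsRegularDomain V ∧ V ⊆ Ω ∧ ∃ A b, Set.EqOn u (affineMap A b) V) ∧
    volume (Ω \ ⋃₀ S) = 0

/-- `u ∈ W^{1,1}(Ω)` with weak gradient `G`, where `G x i j` stands for `∂_j u_i (x)`. -/
structure HasWeakGradient {d m : ℕ} (Ω : Set (EuclideanSpace ℝ (Fin m)))
    (u : EuclideanSpace ℝ (Fin m) → EuclideanSpace ℝ (Fin d))
    (G : EuclideanSpace ℝ (Fin m) → Matrix (Fin d) (Fin m) ℝ) : Prop where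
  integrableOn : ∀ i, IntegrableOn (fun x => u x i) Ω
  integrableOn_grad : ∀ i j, IntegrableOn (fun x => G x i j) Ω
  integral_eq : ∀ φ : EuclideanSpace ℝ (Fin m) → ℝ,
    ContDiff ℝ ∞ φ → HasCompactSupport φ → tsupport φ ⊆ Ω → ∀ i j,
      ∫ x in Ω, u x i * fderiv ℝ φ x (EuclideanSpace.single j 1) = -∫ x in Ω, G x i j * φ x

/-- The norm of `C^α` on the closure of `Ω`: supremum norm plus `α`-Hölder seminorm. -/
def holderNormOn {d m : ℕ} (α : ℝ≥0) (Ω : Set (EuclideanSpace ℝ (Fin m)))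
    (f : EuclideanSpace ℝ (Fin m) → EuclideanSpace ℝ (Fin d)) : ℝ≥0∞ :=
  (⨆ x ∈ closure Ω, ‖f x‖ₑ) + eHolderNorm α ((closure Ω).domRestrict f)

/-- `f ∈ C^α` on the closure of `Ω`; for `α = 0` this is the space of continuous functions. -/
def MemHolderOn {d m : ℕ} (α : ℝ≥0) (Ω : Set (EuclideanSpace ℝ (Fin m)))
    (f : EuclideanSpace ℝ (Fin m) → EuclideanSpace ℝ (Fin d)) : Prop :=
  ContinuousOn f (closure Ω) ∧ holderNormOn α Ω f < ⊤

end StaircaseLaminates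

end

/-! Only the law of the gradient matters: which fraction of the volume carries which matrix. A
discrete law is realizable for A if, on every regular domain and for every δ, it is exactly the law
of the gradient of a piecewise affine map that equals an affine map with gradient A on the boundary
and is δ-close to it in C^α. Because the laws are exact and all domains are allowed, such
constructions compose like Markov kernels: replacing every piece with gradient s by a realization of
κ(s) realizes `p.bind κ` (`Realizable.bind`). Each perturbation vanishes off its piece, so gluing
costs only a factor 2 in the Hölder norm, and finite first moments give W^{1,1}. One model domain
suffices: a Vitali exhaustion by small copies carries the law to any other domain, and scaling by r
≤ 1 shrinks the Hölder bound by r^{1-α} (`IsRealization.realizable`).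

The building block is the rank-one splitting C = lB + (1-l)B' with B - B' = a ⊗ n. The perturbation
is φa, where φ is the positive part of the minimum of two affine functions with gradients (1-l)n and
-ln and of further ones with small gradients ±s e_i, which make the support bounded. Integrating by
parts against φ shows that the two main pieces have volumes in the exact ratio l : (1-l), and that
the other pieces, whose gradients are close to C, have small total volume (`volume_minPiece_split`).
Hence the law is reached up to a relative loss and a small set of errors (`Approx`). Errors are
measured by a weight c on matrices; as c is locally bounded, errors near C can be given small total
weight.

Induction over elementary splittings handles laminates of finite order. A staircase is a Markov
chain in which only the active pieces move. Its limit exists in C^α and W^{1,1} as soon as the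
volume and the first moment of the active part tend to 0 (`IsChain.realizable_limit`). These are β_n
and β_n|A_n|; the second tends to 0 because every step and the limit measure keep the barycenter
(`tendsto_stairMass_mul_norm`). Extended staircases follow by composition.

It remains to remove the errors, whose gradients need not lie in K. Every matrix X has its own
laminate ν_X, so an error piece with gradient X is simply restarted with ν_X. The weight c(X) is
chosen to dominate the constant in the tail bound of ν_X, and the total weight of the errors after n
≥ 1 rounds is at most 2^{-n}. All later rounds together therefore add at most t^{-p} to the tail of
the first one, while the first round already keeps half of ν_A. This gives the constants 2 and 1/2,
and p > 1 makes the first moment of the limit law finite (`exists_realizable_of_tail_le`). -/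

noncomputable section

namespace StaircaseLaminates

/-! ### Weak derivatives on the whole space -/

/-- `h` is integrable and is the weak derivative of `f` in direction `v` on the whole space. -/
structure HasWeakDeriv {m : ℕ} (v : EuclideanSpace ℝ (Fin m)) (f h : EuclideanSpace ℝ (Fin m) → ℝ) :
    Prop where
  integrable : Integrable h
  integral_eq : ∀ φ : EuclideanSpace ℝ (Fin m) → ℝ, ContDiff ℝ ∞ φ → HasCompactSupport φ →
    ∫ x, f x * fderiv ℝ φ x v = -∫ x, h x * φ x

section WeakDeriv

variable {m : ℕ} {v : EuclideanSpace ℝ (Fin m)} {f g h k : EuclideanSpace ℝ (Fin m) → ℝ}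

theorem continuous_fderiv_apply {φ : EuclideanSpace ℝ (Fin m) → ℝ} (hφ : ContDiff ℝ ∞ φ)
    (v : EuclideanSpace ℝ (Fin m)) : Continuous fun x => fderiv ℝ φ x v :=
  (hφ.continuous_fderiv (by simp)).clm_apply continuous_const

theorem hasCompactSupport_fderiv_apply {φ : EuclideanSpace ℝ (Fin m) → ℝ}
    (hφ : HasCompactSupport φ) (v : EuclideanSpace ℝ (Fin m)) :
    HasCompactSupport fun x => fderiv ℝ φ x v :=
  (hφ.fderiv ℝ).comp_left (g := fun L : EuclideanSpace ℝ (Fin m) →L[ℝ] ℝ => L v) rfl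

theorem exists_bound_of_hasCompactSupport {ψ : EuclideanSpace ℝ (Fin m) → ℝ} (h1 : Continuous ψ)
    (h2 : HasCompactSupport ψ) : ∃ C : ℝ, 0 ≤ C ∧ ∀ x, ‖ψ x‖ ≤ C := by
  obtain ⟨C, hC⟩ := h2.exists_bound_of_continuous h1
  exact ⟨C, (norm_nonneg _).trans (hC 0), hC⟩

theorem HasWeakDeriv.congr (H : HasWeakDeriv v f h) (hk : h =ᵐ[volume] k) :
    HasWeakDeriv v f k where
  integrable := H.integrable.congr hk
  integral_eq φ h1 h2 := by
    rw [H.integral_eq φ h1 h2]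
    congr 1
    refine integral_congr_ae ?_
    filter_upwards [hk] with x hx
    rw [hx]

theorem HasWeakDeriv.zero : HasWeakDeriv v (fun _ => 0) (fun _ => 0) where
  integrable := integrable_zero _ _ _
  integral_eq φ h1 h2 := by simp

theorem integrable_mul_of_continuous {ψ : EuclideanSpace ℝ (Fin m) → ℝ} (hf : Continuous f)
    (h1 : Continuous ψ) (h2 : HasCompactSupport ψ) : Integrable fun x => f x * ψ x :=
  (hf.mul h1).integrable_of_hasCompactSupport h2.mul_left

theorem Integrable.mul_of_hasCompactSupport {ψ : EuclideanSpace ℝ (Fin m) → ℝ}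
    (hf : Integrable f) (h1 : Continuous ψ) (h2 : HasCompactSupport ψ) :
    Integrable fun x => f x * ψ x := by
  obtain ⟨C, -, hC⟩ := exists_bound_of_hasCompactSupport h1 h2
  exact hf.mul_bdd h1.aestronglyMeasurable (Eventually.of_forall hC)

theorem HasWeakDeriv.add (H : HasWeakDeriv v f h) (H' : HasWeakDeriv v g k) (hf : Continuous f)
    (hg : Continuous g) : HasWeakDeriv v (fun x => f x + g x) (fun x => h x + k x) where
  integrable := H.integrable.add H'.integrable
  integral_eq φ h1 h2 := by
    have c1 := continuous_fderiv_apply h1 v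
    have c2 := hasCompactSupport_fderiv_apply h2 v
    simp only [add_mul]
    rw [integral_add (integrable_mul_of_continuous hf c1 c2)
      (integrable_mul_of_continuous hg c1 c2),
      integral_add (Integrable.mul_of_hasCompactSupport H.integrable h1.continuous h2)
      (Integrable.mul_of_hasCompactSupport H'.integrable h1.continuous h2),
      H.integral_eq φ h1 h2, H'.integral_eq φ h1 h2]
    ring

theorem tsum_lintegral_mul_ne_top {ι : Type*} {F : ι → EuclideanSpace ℝ (Fin m) → ℝ}
    {ψ : EuclideanSpace ℝ (Fin m) → ℝ} (hF : ∑' i, ∫⁻ x, ‖F i x‖ₑ ≠ ⊤) (h1 : Continuous ψ)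
    (h2 : HasCompactSupport ψ) : ∑' i, ∫⁻ x, ‖F i x * ψ x‖ₑ ≠ ⊤ := by
  obtain ⟨C, hC0, hC⟩ := exists_bound_of_hasCompactSupport h1 h2
  refine ne_top_of_le_ne_top (ENNReal.mul_ne_top hF (ENNReal.ofReal_ne_top (r := C))) ?_
  rw [← ENNReal.tsum_mul_right]
  refine ENNReal.tsum_le_tsum fun i => ?_
  rw [← lintegral_mul_const' _ _ ENNReal.ofReal_ne_top]
  refine lintegral_mono fun x => ?_
  rw [enorm_mul]
  gcongr
  rw [← ofReal_norm]
  exact ENNReal.ofReal_le_ofReal (hC x)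

/-- Absolute summability in L¹ of the functions and of their derivatives allows sum and integral to
be exchanged on both sides. This glues perturbations living on countably many pieces without any
traces or boundary regularity. -/
theorem HasWeakDeriv.tsum {ι : Type*} [Countable ι] {F H : ι → EuclideanSpace ℝ (Fin m) → ℝ}
    (hFH : ∀ i, HasWeakDeriv v (F i) (H i)) (hFc : ∀ i, Continuous (F i))
    (hF : ∑' i, ∫⁻ x, ‖F i x‖ₑ ≠ ⊤) (hH : ∑' i, ∫⁻ x, ‖H i x‖ₑ ≠ ⊤)
    (hk : Integrable k) (hkH : k =ᵐ[volume] fun x => ∑' i, H i x) :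
    HasWeakDeriv v (fun x => ∑' i, F i x) k where
  integrable := hk
  integral_eq φ h1 h2 := by
    have c1 := continuous_fderiv_apply h1 v
    have c2 := hasCompactSupport_fderiv_apply h2 v
    have e1 : ∫ x, (∑' i, F i x) * fderiv ℝ φ x v = ∑' i, ∫ x, F i x * fderiv ℝ φ x v := by
      have := integral_tsum (μ := volume) (f := fun i x => F i x * fderiv ℝ φ x v)
        (fun i => ((hFc i).mul c1).aestronglyMeasurable) (tsum_lintegral_mul_ne_top hF c1 c2)
      rw [← this]
      simp only [tsum_mul_right]
    have e2 : ∫ x, k x * φ x = ∑' i, ∫ x, H i x * φ x := by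
      have := integral_tsum (μ := volume) (f := fun i x => H i x * φ x)
        (fun i => ((hFH i).integrable.aestronglyMeasurable.mul
        h1.continuous.aestronglyMeasurable)) (tsum_lintegral_mul_ne_top hH h1.continuous h2)
      rw [← this]
      refine integral_congr_ae ?_
      filter_upwards [hkH] with x hx
      rw [hx, tsum_mul_right]
    rw [e1, e2, ← tsum_neg]
    exact tsum_congr fun i => (hFH i).integral_eq φ h1 h2

/-- The left side converges because the functions converge uniformly and the derivative of φ is
integrable, the right side because the derivatives converge in L¹ and φ is bounded. -/
theorem HasWeakDeriv.of_tendsto {F H : ℕ → EuclideanSpace ℝ (Fin m) → ℝ}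
    (hFH : ∀ n, HasWeakDeriv v (F n) (H n)) (hFc : ∀ n, Continuous (F n)) (hf : Continuous f)
    {ε : ℕ → ℝ} (hε : Tendsto ε atTop (𝓝 0)) (hFf : ∀ n x, |F n x - f x| ≤ ε n)
    (hh : Integrable h) (hHh : Tendsto (fun n => ∫⁻ x, ‖H n x - h x‖ₑ) atTop (𝓝 0)) :
    HasWeakDeriv v f h where
  integrable := hh
  integral_eq φ h1 h2 := by
    have c1 := continuous_fderiv_apply h1 v
    have c2 := hasCompactSupport_fderiv_apply h2 v
    have t1 : Tendsto (fun n => ∫ x, F n x * fderiv ℝ φ x v) atTop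
        (𝓝 (∫ x, f x * fderiv ℝ φ x v)) := by
      rw [tendsto_iff_norm_sub_tendsto_zero]
      refine squeeze_zero (fun _ => norm_nonneg _)
        (g := fun n => ε n * ∫ x, ‖fderiv ℝ φ x v‖) (fun n => ?_) (by simpa using hε.mul_const _)
      rw [← integral_sub (integrable_mul_of_continuous (hFc n) c1 c2)
        (integrable_mul_of_continuous hf c1 c2), ← integral_const_mul]
      refine norm_integral_le_of_norm_le
        ((c1.integrable_of_hasCompactSupport c2).norm.const_mul _) (Eventually.of_forall fun x => ?_)
      rw [← sub_mul, norm_mul]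
      exact mul_le_mul_of_nonneg_right (hFf n x) (norm_nonneg _)
    obtain ⟨C, hC0, hC⟩ := exists_bound_of_hasCompactSupport h1.continuous h2
    have t2 : Tendsto (fun n => ∫ x, H n x * φ x) atTop (𝓝 (∫ x, h x * φ x)) := by
      refine tendsto_integral_of_L1 _
        (Integrable.mul_of_hasCompactSupport hh h1.continuous h2).aestronglyMeasurable
        (Eventually.of_forall fun n =>
          Integrable.mul_of_hasCompactSupport (hFH n).integrable h1.continuous h2) ?_
      refine tendsto_of_tendsto_of_tendsto_of_le_of_le tendsto_const_nhds
        (h := fun n => (∫⁻ x, ‖H n x - h x‖ₑ) * ENNReal.ofReal C) ?_ (fun _ => zero_le) fun n => ?_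
      · simpa using ENNReal.Tendsto.mul_const hHh (Or.inr (ENNReal.ofReal_ne_top (r := C)))
      · simp only []
        rw [← lintegral_mul_const' _ _ ENNReal.ofReal_ne_top]
        refine lintegral_mono fun x => ?_
        rw [← sub_mul, enorm_mul]
        gcongr
        rw [← ofReal_norm]
        exact ENNReal.ofReal_le_ofReal (hC x)
    refine tendsto_nhds_unique t1 ?_
    simp_rw [fun n => (hFH n).integral_eq φ h1 h2]
    exact t2.neg

/-- The factor r in the values compensates the factor r⁻¹ produced by the chain rule, so the
derivative takes the same values on the scaled copy. This is why the law of the gradient is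
invariant under scaling. -/
theorem HasWeakDeriv.scale (H : HasWeakDeriv v f h) (x₀ : EuclideanSpace ℝ (Fin m)) {r : ℝ}
    (hr : 0 < r) :
    HasWeakDeriv v (fun x => r * f (r⁻¹ • (x - x₀))) (fun x => h (r⁻¹ • (x - x₀))) where
  integrable := (H.integrable.comp_smul (inv_ne_zero hr.ne')).comp_sub_right x₀
  integral_eq φ h1 h2 := by
    have key : ∀ F : EuclideanSpace ℝ (Fin m) → ℝ, ∫ x, F x = r ^ m * ∫ y, F (r • y + x₀) := by
      intro F
      have := Measure.integral_comp_smul (μ := (volume : Measure (EuclideanSpace ℝ (Fin m))))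
        (fun y => F (y + x₀)) r
      rw [this, integral_add_right_eq_self F x₀, finrank_euclideanSpace_fin, abs_of_pos (by positivity),
        smul_eq_mul]
      field_simp
    have e : ∀ y : EuclideanSpace ℝ (Fin m), r⁻¹ • (r • y + x₀ - x₀) = y := by
      intro y
      rw [add_sub_cancel_right, smul_smul, inv_mul_cancel₀ hr.ne', one_smul]
    have hd : Differentiable ℝ φ := h1.differentiable (by simp)
    have hφ' : ∀ y, fderiv ℝ (fun y => φ (r • y + x₀)) y v = r * fderiv ℝ φ (r • y + x₀) v := by
      intro y
      have d1 : HasFDerivAt (fun y : EuclideanSpace ℝ (Fin m) => r • y + x₀)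
          (r • ContinuousLinearMap.id ℝ (EuclideanSpace ℝ (Fin m))) y :=
        ((hasFDerivAt_id y).const_smul r).add_const x₀
      have d2 := (hd (r • y + x₀)).hasFDerivAt.comp y d1
      rw [show (fun y => φ (r • y + x₀)) = φ ∘ fun y => r • y + x₀ from rfl, d2.fderiv]
      simp
    have := H.integral_eq (fun y => φ (r • y + x₀))
      (h1.comp ((contDiff_id.const_smul r).add contDiff_const)) (by
        have h3 := h2.comp_homeomorph
          ((Homeomorph.smulOfNeZero r hr.ne').trans (Homeomorph.addRight x₀))
        exact h3)
    rw [key, key (fun x => h (r⁻¹ • (x - x₀)) * φ x)]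
    simp only [e, hφ'] at this ⊢
    have e2 : ∫ y, r * f y * fderiv ℝ φ (r • y + x₀) v =
        ∫ y, f y * (r * fderiv ℝ φ (r • y + x₀) v) := by
      congr 1; ext y; ring
    rw [e2, this]
    ring

theorem HasWeakDeriv.of_lipschitz {C : ℝ≥0} (hf : LipschitzWith C f)
    (hh : Integrable h) (hfh : ∀ᵐ x, lineDeriv ℝ f x v = h x) : HasWeakDeriv v f h where
  integrable := hh
  integral_eq φ h1 h2 := by
    obtain ⟨D, hD⟩ := h1.lipschitzWith_of_hasCompactSupport h2 (by simp)
    have := LipschitzWith.integral_lineDeriv_mul_eq (μ := volume) hf hD h2 v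
    have e1 : ∫ x, h x * φ x = ∫ x, lineDeriv ℝ f x v * φ x := by
      refine integral_congr_ae ?_
      filter_upwards [hfh] with x hx
      rw [hx]
    rw [e1, this, ← integral_neg]
    congr 1
    ext x
    rw [((h1.differentiable (by simp)) x).lineDeriv_eq_fderiv]
    simp [mul_comm]

end WeakDeriv

/-! ### Hölder bounds -/

/-- Sup norm and `α`-Hölder seminorm of `w` are both at most `δ`. -/
structure HolderBound {X Y : Type*} [PseudoMetricSpace X] [NormedAddCommGroup Y] (α δ : ℝ)
    (w : X → Y) : Prop where
  norm_le : ∀ x, ‖w x‖ ≤ δ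
  norm_sub_le : ∀ x y, ‖w x - w y‖ ≤ δ * dist x y ^ α

/-- A sum of functions that vanish off pairwise disjoint sets. -/
theorem tsum_eq_of_disjoint {ι X Y : Type*} [NormedAddCommGroup Y] {V : ι → Set X}
    (hV : Pairwise fun i j => Disjoint (V i) (V j))
    {f : ι → X → Y} (hf : ∀ i x, x ∉ V i → f i x = 0) {i : ι} {x : X} (hx : x ∈ V i) :
    ∑' j, f j x = f i x :=
  tsum_eq_single i fun j hj => hf j x fun hxj => Set.disjoint_left.1 (hV hj) hxj hx

theorem tsum_eq_zero_of_forall_notMem {ι X Y : Type*} [NormedAddCommGroup Y] {V : ι → Set X} {f : ι → X → Y}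
    (hf : ∀ i x, x ∉ V i → f i x = 0) {x : X} (hx : ∀ i, x ∉ V i) : ∑' j, f j x = 0 := by
  simp [fun i => hf i x (hx i)]

section HolderBound

variable {X Y : Type*} [PseudoMetricSpace X] [NormedAddCommGroup Y] {α δ ε : ℝ} {w w' : X → Y}

theorem HolderBound.continuous (h : HolderBound α δ w) (hα : 0 < α) : Continuous w := by
  rw [continuous_iff_continuousAt]
  intro x
  unfold ContinuousAt
  rw [tendsto_iff_norm_sub_tendsto_zero]
  refine squeeze_zero (fun _ => norm_nonneg _) (fun y => h.norm_sub_le y x) ?_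
  have h1 : Tendsto (fun y => dist y x) (𝓝 x) (𝓝 0) := by
    simpa using (continuous_id.dist (continuous_const (y := x))).tendsto x
  have h2 := (h1.rpow_const (p := α) (Or.inr hα.le)).const_mul δ
  simpa [Real.zero_rpow hα.ne'] using h2

theorem HolderBound.zero (hδ : 0 ≤ δ) : HolderBound α δ (fun _ : X => (0 : Y)) where
  norm_le x := by simpa using hδ
  norm_sub_le x y := by
    simpa using mul_nonneg hδ (Real.rpow_nonneg dist_nonneg α)

theorem HolderBound.mono (h : HolderBound α δ w) (hδ : δ ≤ ε) : HolderBound α ε w where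
  norm_le x := (h.norm_le x).trans hδ
  norm_sub_le x y := (h.norm_sub_le x y).trans
    (mul_le_mul_of_nonneg_right hδ (Real.rpow_nonneg dist_nonneg α))

theorem HolderBound.add (h : HolderBound α δ w) (h' : HolderBound α ε w') :
    HolderBound α (δ + ε) (fun x => w x + w' x) where
  norm_le x := (norm_add_le _ _).trans (add_le_add (h.norm_le x) (h'.norm_le x))
  norm_sub_le x y := by
    rw [add_sub_add_comm, add_mul]
    exact (norm_add_le _ _).trans (add_le_add (h.norm_sub_le x y) (h'.norm_sub_le x y))

/-- Two points in the same set see a single summand. Otherwise the summand at x vanishes at y and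
conversely, so each of the two values is separately at most δ·dist^α; this is the factor 2. No
boundary point between x and y has to be found. -/
theorem HolderBound.tsum_of_disjoint {ι : Type*} {V : ι → Set X} (hδ : 0 ≤ δ)
    (hV : Pairwise fun i j => Disjoint (V i) (V j)) {f : ι → X → Y}
    (hf : ∀ i x, x ∉ V i → f i x = 0) (h : ∀ i, HolderBound α δ (f i)) :
    HolderBound α (2 * δ) (fun x => ∑' i, f i x) := by
  have key : ∀ x, ∃ a : Y, (∑' i, f i x = a) ∧ ‖a‖ ≤ δ ∧
      ∀ y, (∑' i, f i x ≠ ∑' i, f i y) → (∀ i, x ∈ V i → y ∉ V i) → ‖a‖ ≤ δ * dist x y ^ α := by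
    intro x
    by_cases hx : ∃ i, x ∈ V i
    · obtain ⟨i, hi⟩ := hx
      refine ⟨f i x, tsum_eq_of_disjoint hV hf hi, (h i).norm_le x, fun y _ hy => ?_⟩
      have := (h i).norm_sub_le x y
      rwa [hf i y (hy i hi), sub_zero] at this
    · push Not at hx
      refine ⟨0, tsum_eq_zero_of_forall_notMem hf hx, by simpa using hδ, fun y _ _ => ?_⟩
      simpa using mul_nonneg hδ (Real.rpow_nonneg dist_nonneg α)
  refine ⟨fun x => ?_, fun x y => ?_⟩
  · obtain ⟨a, ha, ha', -⟩ := key x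
    rw [ha]
    linarith
  · have h0 : 0 ≤ δ * dist x y ^ α := mul_nonneg hδ (Real.rpow_nonneg dist_nonneg α)
    by_cases hxy : ∑' i, f i x = ∑' i, f i y
    · rw [hxy, sub_self, norm_zero]
      linarith
    by_cases hc : ∃ i, x ∈ V i ∧ y ∈ V i
    · obtain ⟨i, hx, hy⟩ := hc
      rw [tsum_eq_of_disjoint hV hf hx, tsum_eq_of_disjoint hV hf hy]
      linarith [(h i).norm_sub_le x y]
    · push Not at hc
      obtain ⟨a, ha, -, ha'⟩ := key x
      obtain ⟨b, hb, -, hb'⟩ := key y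
      have h1 := ha' y hxy hc
      have h2 := hb' x (Ne.symm hxy) fun i hy hx => hc i hx hy
      rw [dist_comm] at h2
      rw [ha, hb]
      linarith [_root_.norm_sub_le a b]

/-- The increments form a geometric series, and the Hölder seminorm is handled like the sup norm:
for fixed x and y the differences of the two values are again a sequence with geometric increments.
-/
theorem HolderBound.exists_limit [CompleteSpace Y] {w : ℕ → X → Y}
    (h : ∀ n, HolderBound α (δ / 2 ^ (n + 1)) (fun x => w (n + 1) x - w n x)) :
    ∃ w' : X → Y, ∀ n, HolderBound α (δ / 2 ^ n) (fun x => w' x - w n x) := by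
  have e : ∀ n : ℕ, ∀ c : ℝ, c / 2 ^ (n + 1) = c / 2 / 2 ^ n := fun n c => by
    rw [pow_succ, div_div, mul_comm]
  have d1 : ∀ x n, dist (w n x) (w (n + 1) x) ≤ δ / 2 / 2 ^ n := fun x n => by
    rw [dist_comm, dist_eq_norm, ← e]
    exact (h n).norm_le x
  have lim : ∀ x, ∃ a, Tendsto (fun n => w n x) atTop (𝓝 a) := fun x =>
    cauchySeq_tendsto_of_complete (cauchySeq_of_le_geometric_two (d1 x))
  choose w' hw' using lim
  refine ⟨w', fun n => ⟨fun x => ?_, fun x y => ?_⟩⟩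
  · rw [← dist_eq_norm, dist_comm]
    exact dist_le_of_le_geometric_two_of_tendsto (d1 x) (hw' x) n
  · have d2 : ∀ k, dist (w k x - w k y) (w (k + 1) x - w (k + 1) y) ≤
        (δ * dist x y ^ α) / 2 / 2 ^ k := fun k => by
      have := (h k).norm_sub_le x y
      rw [dist_comm, dist_eq_norm, ← e]
      calc _ = ‖w (k + 1) x - w k x - (w (k + 1) y - w k y)‖ := by congr 1; abel
        _ ≤ _ := this
        _ = _ := by ring
    have := dist_le_of_le_geometric_two_of_tendsto d2 ((hw' x).sub (hw' y)) n
    rw [dist_comm, dist_eq_norm] at this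
    calc _ = ‖w' x - w' y - (w n x - w n y)‖ := by congr 1; abel
      _ ≤ _ := this
      _ = _ := by ring

/-- The seminorm scales exactly by r^{1-α}, the sup norm by r, which is at most r^{1-α} since r ≤ 1.
For α < 1 small copies therefore cost arbitrarily little. -/
theorem HolderBound.scale {X : Type*} [NormedAddCommGroup X] [NormedSpace ℝ X] [NormedSpace ℝ Y]
    {w : X → Y} (h : HolderBound α δ w) (hα : 0 < α) (x₀ : X)
    {r : ℝ} (hr : 0 < r) (hr1 : r ≤ 1) :
    HolderBound α (δ * r ^ (1 - α)) (fun x => r • w (r⁻¹ • (x - x₀))) := by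
  have hδ : 0 ≤ δ := (norm_nonneg _).trans (h.norm_le 0)
  refine ⟨fun x => ?_, fun x y => ?_⟩
  · rw [norm_smul, Real.norm_of_nonneg hr.le, mul_comm]
    refine mul_le_mul (h.norm_le _) ?_ hr.le hδ
    conv_lhs => rw [← Real.rpow_one r]
    exact Real.rpow_le_rpow_of_exponent_ge hr hr1 (by linarith)
  · rw [← smul_sub, norm_smul, Real.norm_of_nonneg hr.le]
    refine (mul_le_mul_of_nonneg_left (h.norm_sub_le _ _) hr.le).trans_eq ?_
    rw [dist_smul₀, Real.norm_of_nonneg (inv_nonneg.2 hr.le), dist_sub_right,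
      Real.mul_rpow (inv_nonneg.2 hr.le) dist_nonneg, Real.inv_rpow hr.le, Real.rpow_sub hr,
      Real.rpow_one]
    field_simp

end HolderBound

/-! ### Expectations of probability mass functions -/

/-- The expectation of a nonnegative function. -/
def expect {T : Type*} (p : PMF T) (f : T → ℝ≥0∞) : ℝ≥0∞ := ∑' s, p s * f s

section expect

variable {T T' : Type*}

theorem expect_mono {p : PMF T} {f g : T → ℝ≥0∞} (h : ∀ s, p s ≠ 0 → f s ≤ g s) :
    expect p f ≤ expect p g := by
  refine ENNReal.tsum_le_tsum fun s => ?_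
  by_cases hs : p s = 0
  · simp [hs]
  · gcongr
    exact h s hs

theorem expect_congr {p : PMF T} {f g : T → ℝ≥0∞} (h : ∀ s, p s ≠ 0 → f s = g s) :
    expect p f = expect p g :=
  le_antisymm (expect_mono fun s hs => (h s hs).le) (expect_mono fun s hs => (h s hs).ge)

theorem expect_add (p : PMF T) (f g : T → ℝ≥0∞) :
    expect p (fun s => f s + g s) = expect p f + expect p g := by
  simp only [expect, mul_add]
  exact ENNReal.tsum_add

theorem expect_const (p : PMF T) (c : ℝ≥0∞) : expect p (fun _ => c) = c := by
  simp [expect, ENNReal.tsum_mul_right, p.tsum_coe]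

theorem expect_mul_const (p : PMF T) (f : T → ℝ≥0∞) (c : ℝ≥0∞) :
    expect p (fun s => f s * c) = expect p f * c := by
  simp only [expect, ← mul_assoc]
  exact ENNReal.tsum_mul_right

theorem expect_pure (a : T) (f : T → ℝ≥0∞) : expect (PMF.pure a) f = f a := by
  unfold expect
  rw [tsum_eq_single a]
  · simp
  · intro b hb
    simp [PMF.pure_apply_of_ne _ _ hb]

theorem expect_bind (p : PMF T) (κ : T → PMF T') (f : T' → ℝ≥0∞) :
    expect (p.bind κ) f = expect p fun s => expect (κ s) f := by
  simp only [expect, PMF.bind_apply, ← ENNReal.tsum_mul_right, ← ENNReal.tsum_mul_left]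
  rw [ENNReal.tsum_comm]
  simp only [mul_assoc]

theorem expect_map (p : PMF T) (g : T → T') (f : T' → ℝ≥0∞) :
    expect (p.map g) f = expect p fun s => f (g s) := by
  rw [← PMF.bind_pure_comp, expect_bind]
  simp [expect_pure]

theorem bind_congr {p : PMF T} {κ κ' : T → PMF T'} (h : ∀ s, p s ≠ 0 → κ s = κ' s) :
    p.bind κ = p.bind κ' := by
  ext t
  simp only [PMF.bind_apply]
  refine tsum_congr fun s => ?_
  by_cases hs : p s = 0
  · simp [hs]
  · rw [h s hs]

theorem tsum_iSup_of_monotone {f : ℕ → T → ℝ≥0∞} (hf : Monotone f) :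
    ∑' s, ⨆ n, f n s = ⨆ n, ∑' s, f n s := by
  refine le_antisymm ?_ (iSup_le fun n => ENNReal.tsum_le_tsum fun s => le_iSup (fun n => f n s) n)
  rw [ENNReal.tsum_eq_iSup_sum]
  refine iSup_le fun F => ?_
  rw [ENNReal.finsetSum_iSup_of_monotone fun s i j hij => hf hij s]
  exact iSup_mono fun n => ENNReal.sum_le_tsum F

end expect

/-! ### Labelled piecewise affine maps -/

/-- The space `ℝ^m`. -/
abbrev Space (m : ℕ) := EuclideanSpace ℝ (Fin m)

/-- The space of `d × m` matrices. -/
abbrev Mat (d m : ℕ) := Matrix (Fin d) (Fin m) ℝ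

/-- A gradient together with a tag that records the role of a piece in a construction: tag `1` marks
errors and tag `2` marks pieces that are still to be modified. -/
abbrev Label (d m : ℕ) := Mat d m × ℕ

open Classical in
/-- Piecewise constant field with value `v.2.1 - A` on each `v.1`, `v ∈ S`. -/
def pieceGrad {d m : ℕ} (S : Set (Set (Space m) × Label d m)) (A : Mat d m) (x : Space m) :
    Mat d m :=
  if h : ∃ v ∈ S, x ∈ v.1 then h.choose.2.1 - A else 0

/-- The labels of `S` have distribution `p` with respect to normalized volume on `Ω`. -/
def HasDist {d m : ℕ} (Ω : Set (Space m)) (S : Set (Set (Space m) × Label d m))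
    (p : PMF (Label d m)) : Prop :=
  ∀ t, ∑' v : S, ({t} : Set (Label d m)).indicator (fun _ => volume v.1.1) v.1.2 =
    p t * volume Ω

/-- The first absolute moment. -/
def moment {d m : ℕ} (p : PMF (Label d m)) : ℝ≥0∞ := expect p fun s => ‖s.1‖ₑ

/-- Countable families of disjoint regular domains that cover `Ω` up to a null set. -/
structure IsPartition {d m : ℕ} (Ω : Set (Space m)) (S : Set (Set (Space m) × Label d m)) :
    Prop where
  countable : S.Countable
  disjoint : S.PairwiseDisjoint Prod.fst
  regular : ∀ v ∈ S, IsRegularDomain v.1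
  subset : ∀ v ∈ S, v.1 ⊆ Ω
  cover : volume (Ω \ ⋃ v ∈ S, v.1) = 0

/-- `x ↦ A x + w x` is piecewise affine on `Ω` with gradients given by the labels of `S`, and `w` is
a continuous `W^{1,1}` function that vanishes off `Ω`. -/
structure IsRealization {d m : ℕ} (Ω : Set (Space m)) (A : Mat d m)
    (S : Set (Set (Space m) × Label d m)) (w : Space m → Space d) : Prop
    extends IsPartition Ω S where
  affine : ∀ v ∈ S, ∃ b, ∀ x ∈ v.1, w x = affineMap (v.2.1 - A) b x
  continuous : Continuous w
  eq_zero : ∀ x, x ∉ Ω → w x = 0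
  weak : ∀ i j, HasWeakDeriv (EuclideanSpace.single j 1) (fun x => w x i)
    (fun x => pieceGrad S A x i j)

/-- On every regular domain there are arbitrarily small perturbations of an affine map with gradient
`A` whose gradient labels have distribution `p`. -/
def Realizable {d m : ℕ} (α : ℝ) (A : Mat d m) (p : PMF (Label d m)) : Prop :=
  ∀ Ω : Set (Space m), IsRegularDomain Ω → ∀ δ : ℝ, 0 < δ →
    ∃ S w, IsRealization Ω A S w ∧ HasDist Ω S p ∧ HolderBound α δ w

section Realization

variable {d m : ℕ} {Ω : Set (Space m)} {S : Set (Set (Space m) × Label d m)} {A : Mat d m}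
  {p : PMF (Label d m)} {w : Space m → Space d}

theorem IsRegularDomain.volume_ne_top (h : IsRegularDomain Ω) : volume Ω ≠ ⊤ :=
  h.isBounded.measure_lt_top.ne

theorem IsRegularDomain.volume_ne_zero (h : IsRegularDomain Ω) : volume Ω ≠ 0 :=
  (h.isOpen.measure_pos volume h.isConnected.nonempty).ne'

theorem IsRegularDomain.of_convex (h1 : IsOpen Ω) (h2 : Bornology.IsBounded Ω) (h3 : Convex ℝ Ω)
    (h4 : Ω.Nonempty) : IsRegularDomain Ω :=
  ⟨h1, h2, h3.isConnected h4, h3.addHaar_frontier volume⟩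

theorem norm_entry_le (X : Mat d m) (i : Fin d) (j : Fin m) : ‖X i j‖ ≤ ‖X‖ := by
  have h1 : ‖X‖ = ‖WithLp.toLp 2 (fun i => WithLp.toLp 2 (X i))‖ := rfl
  rw [h1]
  have h2 := PiLp.norm_apply_le (WithLp.toLp 2 (fun i => WithLp.toLp 2 (X i))) i
  have h3 := PiLp.norm_apply_le (WithLp.toLp 2 (X i)) j
  exact h3.trans h2

theorem enorm_entry_le (X : Mat d m) (i : Fin d) (j : Fin m) : ‖X i j‖ₑ ≤ ‖X‖ₑ := by
  rw [← ofReal_norm, ← ofReal_norm]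
  exact ENNReal.ofReal_le_ofReal (norm_entry_le X i j)

theorem enorm_zero_mat : ‖(0 : Mat d m)‖ₑ = 0 := by
  rw [← ofReal_norm, norm_zero, ENNReal.ofReal_zero]

theorem pairwise_disjoint_coe (hd : S.PairwiseDisjoint Prod.fst) :
    Pairwise fun u v : S => Disjoint u.1.1 v.1.1 :=
  fun u v huv => hd u.2 v.2 (Subtype.coe_injective.ne huv)

theorem pieceGrad_eq (hd : S.PairwiseDisjoint Prod.fst) {v : Set (Space m) × Label d m}
    (hv : v ∈ S) {x : Space m} (hx : x ∈ v.1) : pieceGrad S A x = v.2.1 - A := by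
  have h : ∃ v ∈ S, x ∈ v.1 := ⟨v, hv, hx⟩
  have e : h.choose = v := hd.elim_set h.choose_spec.1 hv x h.choose_spec.2 hx
  rw [pieceGrad, dif_pos h, e]

theorem pieceGrad_eq_zero {x : Space m} (hx : ∀ v ∈ S, x ∉ v.1) : pieceGrad S A x = 0 := by
  rw [pieceGrad, dif_neg]
  rintro ⟨v, hv, hxv⟩
  exact hx v hv hxv

theorem measurable_pieceGrad (hc : S.Countable) (hd : S.PairwiseDisjoint Prod.fst)
    (ho : ∀ v ∈ S, IsOpen v.1) : Measurable (pieceGrad S A) := by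
  intro s _
  have : pieceGrad S A ⁻¹' s = (⋃ v ∈ {v ∈ S | v.2.1 - A ∈ s}, v.1) ∪
      ((⋃ v ∈ S, v.1)ᶜ ∩ {_x | (0 : Mat d m) ∈ s}) := by
    ext x
    simp only [Set.mem_preimage, Set.mem_union, Set.mem_iUnion, Set.mem_ofPred_eq, Set.mem_inter_iff,
      Set.mem_compl_iff, exists_prop]
    by_cases hx : ∃ v ∈ S, x ∈ v.1
    · obtain ⟨v, hv, hxv⟩ := hx
      rw [pieceGrad_eq hd hv hxv]
      constructor
      · exact fun h => Or.inl ⟨v, ⟨hv, h⟩, hxv⟩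
      · rintro (⟨u, ⟨hu, hus⟩, hxu⟩ | ⟨h, -⟩)
        · rwa [← pieceGrad_eq hd hv hxv, pieceGrad_eq hd hu hxu]
        · exact absurd ⟨v, hv, hxv⟩ h
    · push Not at hx
      rw [pieceGrad_eq_zero hx]
      constructor
      · refine fun h => Or.inr ⟨?_, h⟩
        rintro ⟨v, hv, hxv⟩
        exact hx v hv hxv
      · rintro (⟨u, ⟨hu, hus⟩, hxu⟩ | ⟨-, h⟩)
        · exact absurd hxu (hx u hu)
        · exact h
  rw [this]
  refine MeasurableSet.union (MeasurableSet.biUnion (hc.mono fun v hv => hv.1) fun v hv =>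
    (ho v hv.1).measurableSet) (MeasurableSet.inter (MeasurableSet.biUnion hc fun v hv =>
    (ho v hv).measurableSet).compl (MeasurableSet.const _))

theorem lintegral_pieceGrad (hc : S.Countable) (hd : S.PairwiseDisjoint Prod.fst)
    (ho : ∀ v ∈ S, IsOpen v.1) :
    ∫⁻ x, ‖pieceGrad S A x‖ₑ = ∑' v : S, volume v.1.1 * ‖v.1.2.1 - A‖ₑ := by
  have := hc.to_subtype
  have h1 : ∀ x, ‖pieceGrad S A x‖ₑ =
      ∑' v : S, v.1.1.indicator (fun _ => ‖v.1.2.1 - A‖ₑ) x := by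
    intro x
    by_cases hx : ∃ v ∈ S, x ∈ v.1
    · obtain ⟨v, hv, hxv⟩ := hx
      rw [pieceGrad_eq hd hv hxv, tsum_eq_single (⟨v, hv⟩ : S)]
      · simp [hxv]
      · intro u hu
        exact Set.indicator_of_notMem
          (fun hxu => Set.disjoint_left.1 (pairwise_disjoint_coe hd hu) hxu hxv) _
    · push Not at hx
      rw [pieceGrad_eq_zero hx]
      exact Eq.trans enorm_zero_mat (ENNReal.tsum_eq_zero.2
        fun v : S => Set.indicator_of_notMem (hx v.1 v.2) _).symm
  simp_rw [h1]
  rw [lintegral_tsum (f := fun (v : S) => v.1.1.indicator fun _ => ‖v.1.2.1 - A‖ₑ)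
    fun v => (measurable_const.indicator (ho v.1 v.2).measurableSet).aemeasurable]
  refine tsum_congr fun v => ?_
  rw [lintegral_indicator_const (ho v.1 v.2).measurableSet, mul_comm]

/-- Grouping the pieces by label turns volume-weighted sums into expectations. All moments, error
volumes and tail volumes are computed from the law in this way. -/
theorem HasDist.tsum_mul (h : HasDist Ω S p) (f : Label d m → ℝ≥0∞) :
    ∑' v : S, volume v.1.1 * f v.1.2 = volume Ω * expect p f := by
  have h1 : ∀ v : S, volume v.1.1 * f v.1.2 =
      ∑' t, ({t} : Set (Label d m)).indicator (fun _ => volume v.1.1) v.1.2 * f t := by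
    intro v
    rw [tsum_eq_single v.1.2]
    · simp
    · intro t ht
      rw [Set.indicator_of_notMem (by simpa using ht.symm), zero_mul]
  simp_rw [h1]
  rw [ENNReal.tsum_comm]
  simp_rw [ENNReal.tsum_mul_right]
  simp_rw [h _]
  unfold expect
  rw [← ENNReal.tsum_mul_left]
  exact tsum_congr fun t => by ring

/-- A piece is open and nonempty, so it has positive volume. Properties of the labels charged by the
law thus hold on every single piece. -/
theorem HasDist.apply_ne_zero (h : HasDist Ω S p) {v : Set (Space m) × Label d m} (hv : v ∈ S)
    (hv' : IsRegularDomain v.1) : p v.2 ≠ 0 := by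
  intro h0
  have h1 := h v.2
  rw [h0, zero_mul, ENNReal.tsum_eq_zero] at h1
  have := h1 ⟨v, hv⟩
  simp only [Set.mem_singleton_iff, Set.indicator_of_mem] at this
  exact hv'.volume_ne_zero this

theorem IsPartition.lintegral_pieceGrad (h : IsPartition Ω S) (hp : HasDist Ω S p) (A : Mat d m) :
    ∫⁻ x, ‖pieceGrad S A x‖ₑ = volume Ω * expect p fun t => ‖t.1 - A‖ₑ := by
  rw [StaircaseLaminates.lintegral_pieceGrad h.countable h.disjoint
    fun v hv => (h.regular v hv).isOpen, ← hp.tsum_mul]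

theorem expect_norm_sub_le (p : PMF (Label d m)) (A : Mat d m) :
    expect p (fun t => ‖t.1 - A‖ₑ) ≤ moment p + ‖A‖ₑ := by
  calc _ ≤ expect p fun t => ‖t.1‖ₑ + ‖A‖ₑ := expect_mono fun s _ => enorm_sub_le
    _ = _ := by rw [expect_add, expect_const]; rfl

theorem IsPartition.integrable_pieceGrad (hΩ : IsRegularDomain Ω) (h : IsPartition Ω S)
    (hp : HasDist Ω S p) (hm : moment p ≠ ⊤) (A : Mat d m) (i : Fin d) (j : Fin m) :
    Integrable fun x => pieceGrad S A x i j := by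
  have hM := measurable_pieceGrad (A := A) h.countable h.disjoint
    fun v hv => (h.regular v hv).isOpen
  have hc : Continuous fun X : Mat d m => X i j := continuous_id.matrix_elem i j
  refine ⟨(hc.measurable.comp hM).aestronglyMeasurable, ?_⟩
  refine lt_of_le_of_lt (lintegral_mono fun x => enorm_entry_le _ i j) ?_
  rw [h.lintegral_pieceGrad hp]
  refine ENNReal.mul_lt_top hΩ.volume_ne_top.lt_top (lt_of_le_of_lt (expect_norm_sub_le p A) ?_)
  exact ENNReal.add_lt_top.2 ⟨hm.lt_top, enorm_lt_top⟩

theorem hasDist_singleton (s : Label d m) :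
    HasDist Ω {(Ω, s)} (PMF.pure s) := by
  intro t
  rw [tsum_fintype, Finset.univ_unique, Finset.sum_singleton]
  by_cases h : s = t
  · subst h
    simp [PMF.pure_apply]
  · simp [PMF.pure_apply, h, Ne.symm h]

theorem isRealization_singleton (hΩ : IsRegularDomain Ω) (s : Label d m) :
    IsRealization Ω s.1 {(Ω, s)} (fun _ => 0) where
  countable := Set.countable_singleton _
  disjoint := Set.pairwiseDisjoint_singleton _ _
  regular v hv := by rw [Set.mem_singleton_iff.1 hv]; exact hΩ
  subset v hv := by rw [Set.mem_singleton_iff.1 hv]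
  cover := by simp
  affine v hv := by
    refine ⟨0, fun x _ => ?_⟩
    rw [Set.mem_singleton_iff.1 hv]
    simp [affineMap]
  continuous := continuous_const
  eq_zero _ _ := rfl
  weak i j := by
    have : (fun x => pieceGrad {(Ω, s)} s.1 x i j) = fun _ => 0 := by
      ext x
      by_cases hx : x ∈ Ω
      · rw [pieceGrad_eq (Set.pairwiseDisjoint_singleton _ _) (Set.mem_singleton _) hx]
        simp
      · rw [pieceGrad_eq_zero]
        · rfl
        · intro v hv
          rwa [Set.mem_singleton_iff.1 hv]
    rw [this]
    exact HasWeakDeriv.zero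

theorem realizable_pure (α : ℝ) (s : Label d m) : Realizable α s.1 (PMF.pure s) :=
  fun _ hΩ _ hδ => ⟨_, _, isRealization_singleton hΩ s, hasDist_singleton s, HolderBound.zero hδ.le⟩

end Realization

/-! ### Refinement of realizations -/

section Refine

variable {d m : ℕ} {Ω : Set (Space m)} {S : Set (Set (Space m) × Label d m)} {A : Mat d m}
  {p : PMF (Label d m)} {κ : Label d m → PMF (Label d m)} {w : Space m → Space d}
  {Sf : Set (Space m) × Label d m → Set (Set (Space m) × Label d m)}
  {wf : Set (Space m) × Label d m → Space m → Space d}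

/-- The refined pieces are nonempty, so none can lie in two disjoint parents; sums over the refined
family then split over the parents. -/
theorem pairwiseDisjoint_refine (hS : IsPartition Ω S) (hf : ∀ v ∈ S, IsPartition v.1 (Sf v)) :
    S.PairwiseDisjoint Sf := by
  intro u hu v hv huv
  rw [Function.onFun, Set.disjoint_left]
  intro a hau hav
  obtain ⟨x, hx⟩ := ((hf u hu).regular a hau).isConnected.nonempty
  exact Set.disjoint_left.1 (hS.disjoint hu hv huv) ((hf u hu).subset a hau hx)
    ((hf v hv).subset a hav hx)

theorem IsPartition.refine (hS : IsPartition Ω S) (hf : ∀ v ∈ S, IsPartition v.1 (Sf v)) :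
    IsPartition Ω (⋃ v ∈ S, Sf v) where
  countable := hS.countable.biUnion fun v hv => (hf v hv).countable
  disjoint := by
    intro a ha b hb hab
    obtain ⟨u, hu, hau⟩ := Set.mem_iUnion₂.1 ha
    obtain ⟨v, hv, hbv⟩ := Set.mem_iUnion₂.1 hb
    by_cases huv : u = v
    · subst huv
      exact (hf u hu).disjoint hau hbv hab
    · exact (hS.disjoint hu hv huv).mono ((hf u hu).subset a hau) ((hf v hv).subset b hbv)
  regular a ha := by
    obtain ⟨u, hu, hau⟩ := Set.mem_iUnion₂.1 ha
    exact (hf u hu).regular a hau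
  subset a ha := by
    obtain ⟨u, hu, hau⟩ := Set.mem_iUnion₂.1 ha
    exact ((hf u hu).subset a hau).trans (hS.subset u hu)
  cover := by
    refine measure_mono_null (t := (Ω \ ⋃ v ∈ S, v.1) ∪ ⋃ v ∈ S, (v.1 \ ⋃ a ∈ Sf v, a.1)) ?_ ?_
    · intro x hx
      by_cases h : ∃ v ∈ S, x ∈ v.1
      · obtain ⟨v, hv, hxv⟩ := h
        refine Or.inr (Set.mem_iUnion₂.2 ⟨v, hv, hxv, fun h' => hx.2 ?_⟩)
        obtain ⟨a, ha, hxa⟩ := Set.mem_iUnion₂.1 h'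
        exact Set.mem_iUnion₂.2 ⟨a, Set.mem_iUnion₂.2 ⟨v, hv, ha⟩, hxa⟩
      · refine Or.inl ⟨hx.1, fun h' => h ?_⟩
        obtain ⟨v, hv, hxv⟩ := Set.mem_iUnion₂.1 h'
        exact ⟨v, hv, hxv⟩
    · exact measure_union_null hS.cover
        ((measure_biUnion_null_iff hS.countable).2 fun v hv => (hf v hv).cover)

theorem HasDist.refine (hS : IsPartition Ω S) (hf : ∀ v ∈ S, IsPartition v.1 (Sf v))
    (hp : HasDist Ω S p) (hκ : ∀ v ∈ S, HasDist v.1 (Sf v) (κ v.2)) :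
    HasDist Ω (⋃ v ∈ S, Sf v) (p.bind κ) := by
  intro t
  rw [ENNReal.tsum_biUnion' (pairwiseDisjoint_refine hS hf)
    (f := fun v => ({t} : Set (Label d m)).indicator (fun _ => volume v.1) v.2)]
  have h1 : ∀ v : S, ∑' x : Sf v, ({t} : Set (Label d m)).indicator (fun _ => volume x.1.1) x.1.2 =
      volume v.1.1 * κ v.1.2 t := fun v => by rw [hκ v.1 v.2 t, mul_comm]
  simp_rw [h1]
  rw [hp.tsum_mul fun s => κ s t, mul_comm]
  rfl

theorem IsPartition.ae_mem (hS : IsPartition Ω S) : ∀ᵐ x, x ∈ Ω → ∃ v ∈ S, x ∈ v.1 := by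
  have := hS.cover
  rw [measure_eq_zero_iff_ae_notMem] at this
  filter_upwards [this] with x hx hxΩ
  by_contra h
  refine hx ⟨hxΩ, fun h' => h ?_⟩
  obtain ⟨v, hv, hxv⟩ := Set.mem_iUnion₂.1 h'
  exact ⟨v, hv, hxv⟩

theorem affineMap_add_affineMap (B C : Mat d m) (b c : Space d) (x : Space m) :
    affineMap B b x + affineMap C c x = affineMap (B + C) (b + c) x := by
  simp only [affineMap, map_add, LinearMap.add_apply]
  abel

/-- By the triangle inequality the two first moments control the mean jump of the gradient. It
bounds the L¹ norms of the gradients of all perturbations that are added in a refinement. -/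
theorem expect_bind_norm_sub_ne_top (hm : moment p ≠ ⊤) (hm' : moment (p.bind κ) ≠ ⊤) :
    expect p (fun s => expect (κ s) fun t => ‖t.1 - s.1‖ₑ) ≠ ⊤ := by
  refine ne_top_of_le_ne_top (ENNReal.add_ne_top.2 ⟨hm', hm⟩) ?_
  calc _ ≤ expect p (fun s => moment (κ s) + ‖s.1‖ₑ) :=
        expect_mono fun s _ => expect_norm_sub_le _ _
    _ = _ := by rw [expect_add, moment, expect_bind]; rfl

/-- Each piece is perturbed independently and every perturbation is extended by zero, so at each
point at most one of them is nonzero. Their values are summable in L¹ because they are bounded by δ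
on pieces of finite total volume, their gradients because both first moments are finite. -/
theorem IsRealization.refine (hΩ : IsRegularDomain Ω) {α δ : ℝ} (hα : 0 < α)
    (hS : IsRealization Ω A S w)
    (hp : HasDist Ω S p) (hm : moment p ≠ ⊤) (hm' : moment (p.bind κ) ≠ ⊤)
    (hf : ∀ v ∈ S, IsRealization v.1 v.2.1 (Sf v) (wf v))
    (hκ : ∀ v ∈ S, HasDist v.1 (Sf v) (κ v.2)) (hδ : 0 ≤ δ)
    (hh : ∀ v ∈ S, HolderBound α δ (wf v)) :
    IsRealization Ω A (⋃ v ∈ S, Sf v) (fun x => w x + ∑' v : S, wf v x) ∧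
      HolderBound α (2 * δ) (fun x => ∑' v : S, wf v x) := by
  have hcount := hS.countable.to_subtype
  have hpart := hS.toIsPartition.refine fun v hv => (hf v hv).toIsPartition
  have hdist := HasDist.refine hS.toIsPartition (fun v hv => (hf v hv).toIsPartition) hp hκ
  have hV := pairwise_disjoint_coe hS.disjoint
  have h0 : ∀ (v : S) x, x ∉ v.1.1 → wf v x = 0 := fun v x hx => (hf v.1 v.2).eq_zero x hx
  have hH : HolderBound α (2 * δ) (fun x => ∑' v : S, wf v x) :=
    HolderBound.tsum_of_disjoint hδ hV h0 fun v => hh v.1 v.2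
  have hsum : ∀ v (hv : v ∈ S) x, x ∈ v.1 → ∑' u : S, wf u x = wf v x := fun v hv x hx =>
    tsum_eq_of_disjoint hV h0 (i := ⟨v, hv⟩) hx
  refine ⟨{ hpart with affine := ?_, continuous := ?_, eq_zero := ?_, weak := ?_ }, hH⟩
  · intro a ha
    obtain ⟨v, hv, hav⟩ := Set.mem_iUnion₂.1 ha
    obtain ⟨b, hb⟩ := hS.affine v hv
    obtain ⟨c, hc⟩ := (hf v hv).affine a hav
    refine ⟨b + c, fun x hx => ?_⟩
    have hxv := (hf v hv).subset a hav hx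
    rw [hsum v hv x hxv, hb x hxv, hc x hx, affineMap_add_affineMap]
    congr 1
    abel
  · exact hS.continuous.add (hH.continuous hα)
  · intro x hx
    rw [hS.eq_zero x hx, tsum_eq_zero_of_forall_notMem h0 fun v hv => hx (hS.subset v.1 v.2 hv),
      add_zero]
  · intro i j
    have hInt : Integrable fun x => pieceGrad (⋃ v ∈ S, Sf v) A x i j :=
      hpart.integrable_pieceGrad hΩ hdist hm' A i j
    have hInt0 : Integrable fun x => pieceGrad S A x i j := (hS.weak i j).integrable
    have hgrad0 : ∀ (v : S) x, x ∉ v.1.1 → pieceGrad (Sf v) v.1.2.1 x i j = 0 := by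
      intro v x hx
      rw [pieceGrad_eq_zero]
      · rfl
      · exact fun u hu hxu => hx ((hf v.1 v.2).subset u hu hxu)
    -- On a piece v the added perturbation has gradient `a.2.1 - v.2.1`, which is the difference of
    -- the new and the old piecewise constant field.
    have hsub : HasWeakDeriv (EuclideanSpace.single j 1) (fun x => ∑' v : S, wf v x i)
        (fun x => pieceGrad (⋃ v ∈ S, Sf v) A x i j - pieceGrad S A x i j) := by
      refine HasWeakDeriv.tsum (fun v => (hf v.1 v.2).weak i j)
        (fun v => (EuclideanSpace.proj (𝕜 := ℝ) i).continuous.comp (hf v.1 v.2).continuous)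
        ?_ ?_ (hInt.sub hInt0) ?_
      · refine ne_top_of_le_ne_top (b := ∑' v : S, volume v.1.1 * ENNReal.ofReal δ) ?_ ?_
        · have := hp.tsum_mul fun _ => ENNReal.ofReal δ
          rw [this, expect_const]
          exact ENNReal.mul_ne_top hΩ.volume_ne_top ENNReal.ofReal_ne_top
        · refine ENNReal.tsum_le_tsum fun v => ?_
          calc ∫⁻ x, ‖wf v x i‖ₑ ≤ ∫⁻ x, v.1.1.indicator (fun _ => ENNReal.ofReal δ) x := by
                refine lintegral_mono fun x => ?_
                by_cases hx : x ∈ v.1.1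
                · rw [Set.indicator_of_mem hx, ← ofReal_norm]
                  exact ENNReal.ofReal_le_ofReal
                    ((PiLp.norm_apply_le (wf v x) i).trans ((hh v.1 v.2).norm_le x))
                · rw [h0 v x hx]
                  simp
            _ = _ := by
                rw [lintegral_indicator_const ((hS.regular v.1 v.2).isOpen.measurableSet),
                  mul_comm]
      · refine ne_top_of_le_ne_top
          (b := ∑' v : S, volume v.1.1 * expect (κ v.1.2) fun t => ‖t.1 - v.1.2.1‖ₑ) ?_ ?_
        · rw [hp.tsum_mul fun s => expect (κ s) fun t => ‖t.1 - s.1‖ₑ]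
          exact ENNReal.mul_ne_top hΩ.volume_ne_top (expect_bind_norm_sub_ne_top hm hm')
        · refine ENNReal.tsum_le_tsum fun v => ?_
          rw [← (hf v.1 v.2).toIsPartition.lintegral_pieceGrad (hκ v.1 v.2)]
          exact lintegral_mono fun x => enorm_entry_le _ i j
      · have hall : ∀ᵐ x, ∀ v : S, x ∈ v.1.1 → ∃ a ∈ Sf v, x ∈ a.1 :=
          ae_all_iff.2 fun v => (hf v.1 v.2).toIsPartition.ae_mem
        filter_upwards [hS.toIsPartition.ae_mem, hall] with x h1 h2
        by_cases hx : x ∈ Ω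
        · obtain ⟨v, hv, hxv⟩ := h1 hx
          obtain ⟨a, ha, hxa⟩ := h2 ⟨v, hv⟩ hxv
          rw [tsum_eq_of_disjoint hV hgrad0 (i := ⟨v, hv⟩) hxv,
            pieceGrad_eq (hf v hv).disjoint ha hxa, pieceGrad_eq hS.disjoint hv hxv,
            pieceGrad_eq hpart.disjoint (Set.mem_iUnion₂.2 ⟨v, hv, ha⟩) hxa]
          simp
        · rw [tsum_eq_zero_of_forall_notMem hgrad0 fun v hv => hx (hS.subset v.1 v.2 hv),
            pieceGrad_eq_zero fun v hv h => hx (hS.subset v hv h),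
            pieceGrad_eq_zero fun v hv h => hx (hpart.subset v hv h)]
          simp
    have hc1 : Continuous fun x => w x i :=
      (EuclideanSpace.proj (𝕜 := ℝ) i).continuous.comp hS.continuous
    have hc2 : Continuous fun x => (∑' v : S, wf v x) i :=
      (EuclideanSpace.proj (𝕜 := ℝ) i).continuous.comp (hH.continuous hα)
    have he : (fun x => ∑' v : S, wf v x i) = fun x => (∑' v : S, wf v x) i := by
      ext x
      by_cases hx : ∃ v : S, x ∈ v.1.1
      · obtain ⟨v, hv⟩ := hx
        rw [hsum v.1 v.2 x hv]
        exact tsum_eq_of_disjoint hV (f := fun (v : S) x => wf v x i)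
          (fun v x hx => by rw [h0 v x hx]; rfl) hv
      · push Not at hx
        rw [tsum_eq_zero_of_forall_notMem h0 hx]
        exact tsum_eq_zero_of_forall_notMem (f := fun (v : S) x => wf v x i)
          (fun v x hx => by rw [h0 v x hx]; rfl) hx
    rw [he] at hsub
    refine ((hS.weak i j).add hsub hc1 hc2).congr (Eventually.of_forall fun x => ?_)
    simp

theorem Realizable.bind {α : ℝ} (hα : 0 < α) (h : Realizable α A p) (hm : moment p ≠ ⊤)
    (hm' : moment (p.bind κ) ≠ ⊤) (hκ : ∀ s, p s ≠ 0 → Realizable α s.1 (κ s)) :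
    Realizable α A (p.bind κ) := by
  intro Ω hΩ δ hδ
  -- One third for the first map and two thirds for the glued perturbations, whose bound doubles.
  obtain ⟨S, w, hS, hp, hw⟩ := h Ω hΩ (δ / 3) (by positivity)
  have hex : ∀ v : Set (Space m) × Label d m, ∃ Sf wf, v ∈ S → IsRealization v.1 v.2.1 Sf wf ∧
      HasDist v.1 Sf (κ v.2) ∧ HolderBound α (δ / 3) wf := by
    intro v
    by_cases hv : v ∈ S
    · obtain ⟨Sf, wf, h⟩ := hκ v.2 (hp.apply_ne_zero hv (hS.regular v hv)) v.1 (hS.regular v hv)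
        (δ / 3) (by positivity)
      exact ⟨Sf, wf, fun _ => h⟩
    · exact ⟨∅, 0, fun h => absurd h hv⟩
  choose Sf wf hf using hex
  obtain ⟨h1, h2⟩ := hS.refine hΩ hα hp hm hm' (fun v hv => (hf v hv).1)
    (fun v hv => (hf v hv).2.1) (by positivity) fun v hv => (hf v hv).2.2
  refine ⟨_, _, h1, HasDist.refine hS.toIsPartition (fun v hv => (hf v hv).1.toIsPartition) hp
    fun v hv => (hf v hv).2.1, ?_⟩
  have := hw.add h2
  exact this.mono (by linarith)

end Refine

/-! ### Scaling and exhaustion by scaled copies -/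

section Scale

variable {d m : ℕ} {Ω P : Set (Space m)} {S : Set (Set (Space m) × Label d m)} {A : Mat d m}
  {p : PMF (Label d m)} {w : Space m → Space d}

/-- The affine homeomorphism `x ↦ r⁻¹ (x - x₀)`. -/
def rescale (x₀ : Space m) (r : ℝ) (hr : r ≠ 0) : Space m ≃ₜ Space m :=
  (Homeomorph.subRight x₀).trans (Homeomorph.smulOfNeZero r⁻¹ (inv_ne_zero hr))

theorem rescale_apply (x₀ : Space m) {r : ℝ} (hr : r ≠ 0) (x : Space m) :
    rescale x₀ r hr x = r⁻¹ • (x - x₀) := rfl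

theorem volume_preimage_rescale (x₀ : Space m) {r : ℝ} (hr : 0 < r) (V : Set (Space m)) :
    volume (rescale x₀ r hr.ne' ⁻¹' V) = ENNReal.ofReal (r ^ m) * volume V := by
  have h1 : rescale x₀ r hr.ne' ⁻¹' V = (fun x => x - x₀) ⁻¹' ((fun y => r⁻¹ • y) ⁻¹' V) := rfl
  simp only [h1, sub_eq_add_neg]
  rw [measure_preimage_add_right, Measure.addHaar_preimage_smul _ (inv_ne_zero hr.ne'),
    finrank_euclideanSpace_fin]
  congr 2
  rw [inv_pow, inv_inv, abs_of_pos (by positivity)]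

theorem preimage_rescale_subset_closedBall (x₀ : Space m) {r R : ℝ} (hr : 0 < r)
    {V : Set (Space m)} (hV : V ⊆ Metric.closedBall 0 R) :
    rescale x₀ r hr.ne' ⁻¹' V ⊆ Metric.closedBall x₀ (r * R) := by
  intro x hx
  have := hV hx
  rw [mem_closedBall_zero_iff, rescale_apply, norm_smul, norm_inv, Real.norm_of_nonneg hr.le,
    inv_mul_le_iff₀ hr] at this
  rwa [mem_closedBall_iff_norm]

theorem IsRegularDomain.preimage_rescale (hP : IsRegularDomain P) (x₀ : Space m) {r : ℝ}
    (hr : 0 < r) : IsRegularDomain (rescale x₀ r hr.ne' ⁻¹' P) where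
  isOpen := hP.isOpen.preimage (rescale x₀ r hr.ne').continuous
  isBounded := by
    obtain ⟨R, hR⟩ := hP.isBounded.subset_closedBall 0
    exact Metric.isBounded_closedBall.subset (preimage_rescale_subset_closedBall x₀ hr hR)
  isConnected := (Homeomorph.isConnected_preimage _).2 hP.isConnected
  volume_frontier := by
    rw [← Homeomorph.preimage_frontier, volume_preimage_rescale x₀ hr, hP.volume_frontier, mul_zero]

theorem IsRealization.rescale (hS : IsRealization P A S w) (x₀ : Space m) {r : ℝ} (hr : 0 < r) :
    IsRealization (rescale x₀ r hr.ne' ⁻¹' P) A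
      ((fun v => (StaircaseLaminates.rescale x₀ r hr.ne' ⁻¹' v.1, v.2)) '' S)
      (fun x => r • w (r⁻¹ • (x - x₀))) := by
  set φ := StaircaseLaminates.rescale x₀ r hr.ne' with hφ
  have hdisj : ((fun v : Set (Space m) × Label d m => (φ ⁻¹' v.1, v.2)) '' S).PairwiseDisjoint
      Prod.fst := by
    rintro _ ⟨u, hu, rfl⟩ _ ⟨v, hv, rfl⟩ huv
    have : u ≠ v := fun h => huv (by rw [h])
    exact (hS.disjoint hu hv this).preimage φ
  have hgrad : ∀ x, pieceGrad ((fun v : Set (Space m) × Label d m => (φ ⁻¹' v.1, v.2)) '' S) A x =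
      pieceGrad S A (r⁻¹ • (x - x₀)) := by
    intro x
    by_cases hx : ∃ v ∈ S, φ x ∈ v.1
    · obtain ⟨v, hv, hxv⟩ := hx
      rw [pieceGrad_eq hdisj (Set.mem_image_of_mem _ hv) hxv]
      exact (pieceGrad_eq hS.disjoint hv hxv).symm
    · push Not at hx
      rw [← rescale_apply x₀ hr.ne' x, pieceGrad_eq_zero, pieceGrad_eq_zero hx]
      rintro _ ⟨v, hv, rfl⟩
      exact hx v hv
  refine ⟨⟨hS.countable.image _, hdisj, ?_, ?_, ?_⟩, ?_, ?_, ?_, ?_⟩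
  · rintro _ ⟨v, hv, rfl⟩
    exact (hS.regular v hv).preimage_rescale x₀ hr
  · rintro _ ⟨v, hv, rfl⟩
    exact Set.preimage_mono (hS.subset v hv)
  · rw [Set.biUnion_image, ← Set.preimage_iUnion₂, ← Set.preimage_sdiff, hφ,
      volume_preimage_rescale x₀ hr, hS.cover, mul_zero]
  · rintro _ ⟨v, hv, rfl⟩
    obtain ⟨b, hb⟩ := hS.affine v hv
    refine ⟨r • b - Matrix.toEuclideanLin (v.2.1 - A) x₀, fun x hx => ?_⟩
    rw [← rescale_apply x₀ hr.ne' x, hb _ hx, rescale_apply]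
    simp only [affineMap, map_smul, map_sub, smul_add, smul_smul, mul_inv_cancel₀ hr.ne', one_smul]
    abel
  · exact (hS.continuous.comp φ.continuous).const_smul r
  · intro x hx
    rw [← rescale_apply x₀ hr.ne' x, hS.eq_zero _ hx, smul_zero]
  · intro i j
    simp_rw [hgrad]
    exact (hS.weak i j).scale x₀ hr

theorem HasDist.rescale (hp : HasDist P S p) (x₀ : Space m) {r : ℝ} (hr : 0 < r) :
    HasDist (rescale x₀ r hr.ne' ⁻¹' P)
      ((fun v => (StaircaseLaminates.rescale x₀ r hr.ne' ⁻¹' v.1, v.2)) '' S) p := by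
  intro t
  have hinj : Set.InjOn (fun v : Set (Space m) × Label d m =>
      (StaircaseLaminates.rescale x₀ r hr.ne' ⁻¹' v.1, v.2)) S := by
    intro u _ v _ huv
    simp only [Prod.mk.injEq] at huv
    exact Prod.ext (Set.preimage_injective.2 (Homeomorph.surjective _) huv.1) huv.2
  rw [tsum_image (fun v => ({t} : Set (Label d m)).indicator (fun _ => volume v.1) v.2) hinj,
    volume_preimage_rescale x₀ hr, ← mul_assoc, mul_comm (p t), mul_assoc, ← hp t, ← ENNReal.tsum_mul_left]
  refine tsum_congr fun v => ?_
  by_cases h : v.1.2 = t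
  · simp [h, volume_preimage_rescale x₀ hr]
  · simp [h]

/-- Vitali's covering theorem needs closed sets comparable with balls, so it is applied to copies of
the closure of P. Passing to the open copies loses only a null set because the boundary of P is
null. -/
theorem exists_rescaled_copies (hΩ : IsRegularDomain Ω) (hP : IsRegularDomain P) {r₀ : ℝ}
    (hr₀ : 0 < r₀) :
    ∃ S : Set (Set (Space m)), S.Countable ∧ S.PairwiseDisjoint id ∧ volume (Ω \ ⋃₀ S) = 0 ∧
      ∀ V ∈ S, V ⊆ Ω ∧ ∃ (x : Space m) (r : ℝ) (hr : 0 < r), r ≤ r₀ ∧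
        V = rescale x r hr.ne' ⁻¹' P := by
  obtain ⟨R₁, hR₁⟩ := hP.isBounded.subset_closedBall 0
  obtain ⟨R, hR, hPR⟩ : ∃ R : ℝ, 0 < R ∧ closure P ⊆ Metric.closedBall 0 R :=
    ⟨max R₁ 1, by positivity, closure_minimal
      (hR₁.trans (Metric.closedBall_subset_closedBall (le_max_left _ _))) Metric.isClosed_closedBall⟩
  let ι := Space m × {r : ℝ // 0 < r}
  let B : ι → Set (Space m) := fun a => rescale a.1 a.2.1 a.2.2.ne' ⁻¹' closure P
  -- The whole surrounding ball has to lie in Ω, so that every selected copy does too.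
  let t : Set ι := {a | a.2.1 ≤ r₀ ∧ Metric.closedBall a.1 (a.2.1 * R) ⊆ Ω}
  have hvol : volume (closure P) ≠ 0 := fun h =>
    hP.volume_ne_zero (measure_mono_null subset_closure h)
  have hvol' : volume (closure P) ≠ ⊤ := hP.isBounded.closure.measure_lt_top.ne
  have hb : volume (Metric.closedBall (0 : Space m) (3 * R)) ≠ ⊤ :=
    Metric.isBounded_closedBall.measure_lt_top.ne
  -- The comparison constant is the ratio of the volumes of the ball of radius 3R and of the closure
  -- of P; it does not depend on centre or scale.
  obtain ⟨u, hut, huc, hud, hu0⟩ := Vitali.exists_disjoint_covering_ae (volume : Measure (Space m)) Ω t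
    (volume (Metric.closedBall (0 : Space m) (3 * R)) / volume (closure P)).toNNReal
    (fun a => a.2.1 * R) (fun a => a.1) B
    (fun a _ => preimage_rescale_subset_closedBall a.1 a.2.2 hPR)
    (fun a _ => by
      have h1 : Metric.closedBall a.1 (3 * (a.2.1 * R)) =
          rescale a.1 a.2.1 a.2.2.ne' ⁻¹' Metric.closedBall 0 (3 * R) := by
        ext x
        rw [Set.mem_preimage, mem_closedBall_iff_norm, mem_closedBall_zero_iff, rescale_apply,
          norm_smul, norm_inv, Real.norm_of_nonneg a.2.2.le, inv_mul_le_iff₀ a.2.2]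
        ring_nf
      rw [h1, volume_preimage_rescale a.1 a.2.2, volume_preimage_rescale a.1 a.2.2,
        ENNReal.coe_toNNReal (ENNReal.div_ne_top hb hvol), mul_comm _ (volume (closure P)), ← mul_assoc,
        ENNReal.div_mul_cancel hvol hvol', mul_comm])
    (fun a _ => by
      refine Set.Nonempty.mono (interior_mono (Set.preimage_mono subset_closure)) ?_
      rw [(hP.preimage_rescale a.1 a.2.2).isOpen.interior_eq]
      exact (hP.preimage_rescale a.1 a.2.2).isConnected.nonempty)
    (fun a _ => isClosed_closure.preimage (rescale a.1 a.2.1 a.2.2.ne').continuous)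
    (fun x hx ε hε => by
      obtain ⟨η, hη, hηΩ⟩ := Metric.nhds_basis_closedBall.mem_iff.1 (hΩ.isOpen.mem_nhds hx)
      have hpos : 0 < min r₀ (min (ε / R) (η / R)) := by positivity
      refine ⟨(x, ⟨min r₀ (min (ε / R) (η / R)), hpos⟩), ⟨min_le_left _ _, ?_⟩, ?_, rfl⟩
      · refine (Metric.closedBall_subset_closedBall ?_).trans hηΩ
        rw [← le_div_iff₀ hR]
        exact (min_le_right _ _).trans (min_le_right _ _)
      · show min r₀ (min (ε / R) (η / R)) * R ≤ ε
        rw [← le_div_iff₀ hR]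
        exact (min_le_right _ _).trans (min_le_left _ _))
  let V : ι → Set (Space m) := fun a => rescale a.1 a.2.1 a.2.2.ne' ⁻¹' P
  have hVB : ∀ a, V a ⊆ B a := fun a => Set.preimage_mono subset_closure
  refine ⟨V '' u, huc.image _, ?_, ?_, ?_⟩
  · rintro _ ⟨a, ha, rfl⟩ _ ⟨b, hb, rfl⟩ hab
    have : a ≠ b := fun h => hab (by rw [h])
    exact (hud ha hb this).mono (hVB a) (hVB b)
  · refine measure_mono_null (t := (Ω \ ⋃ a ∈ u, B a) ∪ ⋃ a ∈ u, (B a \ V a)) ?_ ?_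
    · intro x hx
      by_cases h : ∃ a ∈ u, x ∈ B a
      · obtain ⟨a, ha, hxa⟩ := h
        refine Or.inr (Set.mem_iUnion₂.2 ⟨a, ha, hxa, fun h' => hx.2 ?_⟩)
        exact Set.mem_sUnion.2 ⟨V a, Set.mem_image_of_mem _ ha, h'⟩
      · refine Or.inl ⟨hx.1, fun h' => h ?_⟩
        obtain ⟨a, ha, hxa⟩ := Set.mem_iUnion₂.1 h'
        exact ⟨a, ha, hxa⟩
    · refine measure_union_null hu0 ((measure_biUnion_null_iff huc).2 fun a _ => ?_)
      have : B a \ V a = rescale a.1 a.2.1 a.2.2.ne' ⁻¹' frontier P := by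
        rw [hP.isOpen.frontier_eq]
        rfl
      rw [this, volume_preimage_rescale a.1 a.2.2, hP.volume_frontier, mul_zero]
  · rintro _ ⟨a, ha, rfl⟩
    exact ⟨((hVB a).trans (preimage_rescale_subset_closedBall a.1 a.2.2 hPR)).trans (hut ha).2,
      a.1, a.2.1, a.2.2, (hut ha).1, rfl⟩

theorem IsPartition.tsum_volume (hS : IsPartition Ω S) : ∑' v : S, volume v.1.1 = volume Ω := by
  have := hS.countable.to_subtype
  rw [← measure_biUnion hS.countable hS.disjoint fun v hv => (hS.regular v hv).isOpen.measurableSet]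
  refine le_antisymm (measure_mono (Set.iUnion₂_subset hS.subset)) ?_
  exact measure_mono_ae (by
    filter_upwards [hS.ae_mem] with x hx hxΩ
    obtain ⟨v, hv, hxv⟩ := hx hxΩ
    exact Set.mem_iUnion₂.2 ⟨v, hv, hxv⟩)

theorem IsPartition.isRealization_zero (hS : IsPartition Ω S) (h : ∀ v ∈ S, v.2.1 = A) :
    IsRealization Ω A S (fun _ => 0) where
  toIsPartition := hS
  affine v hv := ⟨0, fun x _ => by simp [h v hv, affineMap]⟩
  continuous := continuous_const
  eq_zero _ _ := rfl
  weak i j := by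
    have : (fun x => pieceGrad S A x i j) = fun _ => 0 := by
      ext x
      by_cases hx : ∃ v ∈ S, x ∈ v.1
      · obtain ⟨v, hv, hxv⟩ := hx
        rw [pieceGrad_eq hS.disjoint hv hxv, h v hv]
        simp
      · push Not at hx
        rw [pieceGrad_eq_zero hx]
        rfl
    rw [this]
    exact HasWeakDeriv.zero

theorem moment_pure (s : Label d m) : moment (PMF.pure s) = ‖s.1‖ₑ := expect_pure _ _

/-- A distribution that is realized on one regular domain is realized on all of them. -/
theorem IsRealization.realizable {α C : ℝ} (hα : 0 < α) (hα' : α < 1) (hP : IsRegularDomain P)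
    (hS : IsRealization P A S w) (hp : HasDist P S p) (hm : moment p ≠ ⊤)
    (hw : HolderBound α C w) : Realizable α A p := by
  intro Ω hΩ δ hδ
  have hC : 0 ≤ C := (norm_nonneg _).trans (hw.norm_le 0)
  -- Since 1 - α > 0, small copies have Hölder bound at most δ/2, which gluing doubles to δ.
  obtain ⟨r₀, hr₀, hr₁, hrδ⟩ : ∃ r₀ : ℝ, 0 < r₀ ∧ r₀ ≤ 1 ∧ C * r₀ ^ (1 - α) ≤ δ / 2 := by
    have h1 : Tendsto (fun r : ℝ => C * r ^ (1 - α)) (𝓝[>] 0) (𝓝 0) := by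
      have h2 : ContinuousAt (fun r : ℝ => r ^ (1 - α)) 0 :=
        Real.continuousAt_rpow_const _ _ (Or.inr (by linarith))
      have h3 := (h2.tendsto.mono_left (nhdsWithin_le_nhds (s := Set.Ioi 0))).const_mul C
      simpa [Real.zero_rpow (by linarith : 1 - α ≠ 0)] using h3
    have h4 : ∀ᶠ r : ℝ in 𝓝[>] 0, C * r ^ (1 - α) < δ / 2 :=
      h1.eventually (gt_mem_nhds (by positivity))
    have h5 : ∀ᶠ r : ℝ in 𝓝[>] 0, r ∈ Set.Ioo (0 : ℝ) 1 := Ioo_mem_nhdsGT one_pos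
    obtain ⟨r, hr1, hr2⟩ := (h4.and h5).exists
    exact ⟨r, hr2.1, hr2.2.le, hr1.le⟩
  obtain ⟨F, hFc, hFd, hF0, hF⟩ := exists_rescaled_copies hΩ hP hr₀
  choose! hFΩ x r hr hr' hFeq using hF
  let S₀ : Set (Set (Space m) × Label d m) := (fun V => (V, (A, 0))) '' F
  have hS₀ : ∀ v ∈ S₀, v.1 ∈ F ∧ v.2 = (A, 0) := by
    rintro _ ⟨V, hV, rfl⟩
    exact ⟨hV, rfl⟩
  have hreg : ∀ V ∈ F, IsRegularDomain V := fun V hV => by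
    have h := hP.preimage_rescale (x V) (hr V hV)
    rwa [← hFeq V hV] at h
  have hpart : IsPartition Ω S₀ := by
    refine ⟨hFc.image _, ?_, fun v hv => hreg _ (hS₀ v hv).1, fun v hv => hFΩ _ (hS₀ v hv).1, ?_⟩
    · rintro _ ⟨U, hU, rfl⟩ _ ⟨V, hV, rfl⟩ huv
      exact hFd hU hV fun h => huv (by rw [h])
    · rwa [Set.biUnion_image, ← Set.sUnion_eq_biUnion]
  have hreal : IsRealization Ω A S₀ (fun _ => 0) :=
    hpart.isRealization_zero fun v hv => by rw [(hS₀ v hv).2]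
  have hdist : HasDist Ω S₀ (PMF.pure (A, 0)) := by
    intro t
    by_cases ht : t = (A, 0)
    · subst ht
      rw [PMF.pure_apply_self, one_mul, ← hpart.tsum_volume]
      refine tsum_congr fun v => ?_
      simp [(hS₀ v.1 v.2).2]
    · rw [PMF.pure_apply_of_ne _ _ ht, zero_mul, ENNReal.tsum_eq_zero]
      intro v
      rw [(hS₀ v.1 v.2).2]
      simp [Ne.symm ht]
  have hex : ∀ v : Set (Space m) × Label d m, ∃ Sf wf, v ∈ S₀ → IsRealization v.1 v.2.1 Sf wf ∧
      HasDist v.1 Sf p ∧ HolderBound α (δ / 2) wf := by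
    intro v
    by_cases hv : v ∈ S₀
    · obtain ⟨hv1, hv2⟩ := hS₀ v hv
      have h1 := hS.rescale (x v.1) (hr v.1 hv1)
      have h2 := hp.rescale (x v.1) (hr v.1 hv1)
      rw [← hFeq v.1 hv1] at h1 h2
      refine ⟨_, _, fun _ => ⟨by rw [hv2]; exact h1, h2, ?_⟩⟩
      refine (hw.scale hα (x v.1) (hr v.1 hv1) ((hr' v.1 hv1).trans hr₁)).mono ?_
      refine le_trans ?_ hrδ
      gcongr
      · exact (hr v.1 hv1).le
      · exact hr' v.1 hv1
    · exact ⟨∅, 0, fun h => absurd h hv⟩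
  choose Sf wf hf using hex
  have hm' : moment ((PMF.pure ((A, 0) : Label d m)).bind fun _ => p) ≠ ⊤ := by
    rwa [PMF.pure_bind]
  obtain ⟨h1, h2⟩ := hreal.refine hΩ hα hdist (by rw [moment_pure]; exact enorm_ne_top) hm'
    (fun v hv => (hf v hv).1) (fun v hv => (hf v hv).2.1) (by positivity)
    fun v hv => (hf v hv).2.2
  have h3 := HasDist.refine hpart (fun v hv => (hf v hv).1.toIsPartition) hdist
    (κ := fun _ => p) fun v hv => (hf v hv).2.1
  rw [PMF.pure_bind] at h3
  refine ⟨_, _, h1, h3, ?_⟩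
  simpa using h2.mono (by linarith : 2 * (δ / 2) ≤ δ)

end Scale

/-! ### Cutting a domain into parts of prescribed volume -/

section Cut

variable {d m : ℕ}

/-- Open boxes with sides parallel to the axes. -/
def openBox (a b : Fin m → ℝ) : Set (Space m) := {x | ∀ i, a i < x i ∧ x i < b i}

theorem volume_openBox (a b : Fin m → ℝ) :
    volume (openBox a b) = ∏ i, ENNReal.ofReal (b i - a i) := by
  have h := (EuclideanSpace.volume_preserving_symm_measurableEquiv_toLp (Fin m)).symm
  rw [← Real.volume_pi_Ioo, ← h.measure_preimage_equiv]
  congr 1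
  ext x
  simp [openBox, Set.mem_pi]

theorem isOpen_openBox (a b : Fin m → ℝ) : IsOpen (openBox a b) := by
  simp only [openBox, Set.ofPred_forall]
  refine isOpen_iInter_of_finite fun i => ?_
  have hc : Continuous fun x : Space m => x i := (EuclideanSpace.proj (𝕜 := ℝ) i).continuous
  exact (isOpen_lt continuous_const hc).inter (isOpen_lt hc continuous_const)

theorem convex_openBox (a b : Fin m → ℝ) : Convex ℝ (openBox a b) := by
  intro x hx y hy s t hs ht hst i
  have := (convex_Ioo (a i) (b i)) (hx i) (hy i) hs ht hst
  simpa using this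

theorem isBounded_openBox (a b : Fin m → ℝ) : Bornology.IsBounded (openBox a b) := by
  rw [isBounded_iff_forall_norm_le]
  refine ⟨∑ i, (|a i| + |b i|), fun x hx => ?_⟩
  calc ‖x‖ = ‖∑ i, x i • EuclideanSpace.single i (1 : ℝ)‖ := by
        congr 1
        ext j
        simp [Finset.sum_apply, Pi.single_apply]
    _ ≤ ∑ i, ‖x i • EuclideanSpace.single i (1 : ℝ)‖ := norm_sum_le _ _
    _ ≤ _ := by
        refine Finset.sum_le_sum fun i _ => ?_
        rw [norm_smul]
        simp only [PiLp.norm_single, norm_one, mul_one, Real.norm_eq_abs]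
        have := hx i
        rw [abs_le]
        constructor <;> linarith [neg_abs_le (a i), le_abs_self (b i), abs_nonneg (a i), abs_nonneg (b i)]

/-- The affine map itself, with tags distributed according to `π`. -/
theorem realizable_tags {α : ℝ} (hα : 0 < α) (hα' : α < 1) (hm : 0 < m) (A : Mat d m)
    (π : PMF ℕ) : Realizable α A (π.map fun n => (A, n)) := by
  let i₀ : Fin m := ⟨0, hm⟩
  -- The unit cube is cut into slabs between consecutive partial sums of π, so that slab n has
  -- volume `π n`.
  let s : ℕ → ℝ := fun n => ∑ k ∈ Finset.range n, (π k).toReal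
  have hs : ∀ n, s (n + 1) = s n + (π n).toReal := fun n => Finset.sum_range_succ _ _
  have hs0 : s 0 = 0 := by simp [s]
  have hsm : Monotone s := monotone_nat_of_le_succ fun n => by
    rw [hs]
    linarith [ENNReal.toReal_nonneg (a := π n)]
  have hs1 : ∀ n, s n ≤ 1 := fun n => by
    have h1 : ∑ k ∈ Finset.range n, π k ≤ 1 := by
      rw [← π.tsum_coe]
      exact ENNReal.sum_le_tsum _
    have h2 : s n = (∑ k ∈ Finset.range n, π k).toReal :=
      (ENNReal.toReal_sum fun k _ => π.apply_ne_top k).symm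
    rw [h2]
    exact ENNReal.toReal_le_of_le_ofReal zero_le_one (by simpa using h1)
  have hsnn : ∀ n, 0 ≤ s n := fun n => hs0 ▸ hsm n.zero_le
  let V : ℕ → Set (Space m) := fun n =>
    openBox (Function.update 0 i₀ (s n)) (Function.update 1 i₀ (s (n + 1)))
  let P : Set (Space m) := openBox 0 1
  have hvolP : volume P = 1 := by simp [P, volume_openBox]
  have hvolV : ∀ n, volume (V n) = π n := fun n => by
    rw [volume_openBox, Finset.prod_eq_single i₀]
    · simp [hs, ENNReal.ofReal_toReal (π.apply_ne_top n)]
    · intro i _ hi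
      simp [Function.update_of_ne hi]
    · simp
  have hVP : ∀ n, V n ⊆ P := fun n x hx i => by
    have := hx i
    by_cases hi : i = i₀
    · subst hi
      simp only [Function.update_self] at this
      exact ⟨lt_of_le_of_lt (hsnn n) this.1, lt_of_lt_of_le this.2 (hs1 _)⟩
    · simpa [Function.update_of_ne hi] using this
  have hVd : Pairwise fun i j => Disjoint (V i) (V j) := by
    have key : ∀ i j, i < j → Disjoint (V i) (V j) := fun i j hij => by
      rw [Set.disjoint_left]
      intro x hx hx'
      have h1 := (hx i₀).2
      have h2 := (hx' i₀).1
      simp only [Function.update_self] at h1 h2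
      have : s (i + 1) ≤ s j := hsm hij
      linarith
    intro i j hij
    rcases lt_or_gt_of_ne hij with h | h
    · exact key i j h
    · exact (key j i h).symm
  have hreg : ∀ n, π n ≠ 0 → IsRegularDomain (V n) := fun n hn => by
    refine IsRegularDomain.of_convex (isOpen_openBox _ _) (isBounded_openBox _ _)
      (convex_openBox _ _) ?_
    rw [← hvolV n] at hn
    exact nonempty_of_measure_ne_zero hn
  have hP : IsRegularDomain P := by
    refine IsRegularDomain.of_convex (isOpen_openBox _ _) (isBounded_openBox _ _)
      (convex_openBox _ _) ?_
    refine nonempty_of_measure_ne_zero (μ := volume) ?_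
    rw [hvolP]
    exact one_ne_zero
  -- Tags of mass zero are left out: their slabs are empty, hence not regular domains.
  let S : Set (Set (Space m) × Label d m) := (fun n => (V n, (A, n))) '' {n | π n ≠ 0}
  have hinj : Set.InjOn (fun n => (V n, ((A, n) : Label d m))) {n | π n ≠ 0} := by
    intro a _ b _ hab
    simp only [Prod.mk.injEq] at hab
    exact hab.2.2
  have hpart : IsPartition P S := by
    refine ⟨(Set.to_countable _).image _, ?_, ?_, ?_, ?_⟩
    · rintro _ ⟨a, ha, rfl⟩ _ ⟨b, hb, rfl⟩ hab
      exact hVd fun h => hab (by rw [h])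
    · rintro _ ⟨n, hn, rfl⟩
      exact hreg n hn
    · rintro _ ⟨n, hn, rfl⟩
      exact hVP n
    · rw [Set.biUnion_image]
      have h1 : volume (⋃ n ∈ {n | π n ≠ 0}, V n) = 1 := by
        rw [measure_biUnion (Set.to_countable _) (fun a _ b _ hab => hVd hab)
          fun n _ => (isOpen_openBox _ _).measurableSet]
        simp_rw [hvolV]
        rw [← π.tsum_coe]
        exact tsum_subtype_eq_of_support_subset (s := {n | π n ≠ 0}) (f := π) fun n hn => hn
      have hmeas : MeasurableSet (⋃ n ∈ {n | π n ≠ 0}, V n) :=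
        MeasurableSet.biUnion (Set.to_countable _) fun n _ => (isOpen_openBox _ _).measurableSet
      rw [measure_sdiff (Set.iUnion₂_subset fun n _ => hVP n) hmeas.nullMeasurableSet
        (by rw [h1]; exact ENNReal.one_ne_top)]
      rw [h1, hvolP, tsub_self]
  have hdist : HasDist P S (π.map fun n => (A, n)) := by
    intro t
    rw [tsum_image (fun v => ({t} : Set (Label d m)).indicator (fun _ => volume v.1) v.2) hinj,
      hvolP, mul_one, PMF.map_apply]
    simp_rw [hvolV]
    rw [tsum_subtype_eq_of_support_subset (s := {n | π n ≠ 0})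
      (f := fun n => ({t} : Set (Label d m)).indicator (fun _ => π n) (A, n))]
    · refine tsum_congr fun n => ?_
      by_cases h : (A, n) = t
      · simp [h]
      · simp [h, Ne.symm h]
    · intro n hn h0
      simp [h0] at hn
  refine (hpart.isRealization_zero (A := A) ?_).realizable hα hα' hP hdist ?_
    (HolderBound.zero zero_le_one)
  · rintro _ ⟨n, _, rfl⟩
    rfl
  · rw [moment, expect_map]
    exact (expect_const π ‖A‖ₑ).trans_ne enorm_ne_top

end Cut

/-! ### Distribution of the labels of a partition -/

theorem IsPartition.exists_hasDist {d m : ℕ} {Ω : Set (Space m)}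
    {S : Set (Set (Space m) × Label d m)} (hΩ : IsRegularDomain Ω) (hS : IsPartition Ω S) :
    ∃ p : PMF (Label d m), HasDist Ω S p := by
  have hsum : ∑' t, (∑' v : S, ({t} : Set (Label d m)).indicator (fun _ => volume v.1.1) v.1.2) =
      volume Ω := by
    rw [ENNReal.tsum_comm, ← hS.tsum_volume]
    refine tsum_congr fun v => ?_
    rw [tsum_eq_single v.1.2]
    · simp
    · intro t ht
      exact Set.indicator_of_notMem (by simpa using ht.symm) _
  refine ⟨⟨fun t => (∑' v : S, ({t} : Set (Label d m)).indicator (fun _ => volume v.1.1) v.1.2) /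
    volume Ω, ?_⟩, fun t => ?_⟩
  · rw [ENNReal.summable.hasSum_iff]
    simp_rw [div_eq_mul_inv]
    rw [ENNReal.tsum_mul_right, hsum]
    exact ENNReal.mul_inv_cancel hΩ.volume_ne_zero hΩ.volume_ne_top
  · exact (ENNReal.div_mul_cancel hΩ.volume_ne_zero hΩ.volume_ne_top).symm

/-! ### Minima of affine functions -/

section MinAffine

variable {d m : ℕ} {F : Type} (c : F → ℝ) (g : F → Space m)

/-- The affine function with gradient `g k` and value `c k` at the origin. -/
def affineFun (k : F) (x : Space m) : ℝ := c k + inner ℝ (g k) x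

/-- The set where all affine functions are positive. -/
def posSet : Set (Space m) := {x | ∀ k, 0 < affineFun c g k x}

/-- The set where `k` is the unique minimizer and the minimum is positive. -/
def minPiece (k : F) : Set (Space m) :=
  {x | 0 < affineFun c g k x ∧ ∀ l, l ≠ k → affineFun c g k x < affineFun c g l x}

/-- The positive part of the minimum. -/
def minFun [Fintype F] [Nonempty F] (x : Space m) : ℝ :=
  max 0 (Finset.univ.inf' Finset.univ_nonempty fun k => affineFun c g k x)

theorem continuous_affineFun (k : F) : Continuous (affineFun c g k) := by
  unfold affineFun
  fun_prop

theorem affineFun_combo (k : F) (x y : Space m) {a b : ℝ} (hab : a + b = 1) :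
    affineFun c g k (a • x + b • y) = a * affineFun c g k x + b * affineFun c g k y := by
  simp only [affineFun, inner_add_right, inner_smul_right]
  linear_combination -(c k) * hab

theorem isOpen_posSet [Fintype F] : IsOpen (posSet c g) := by
  simp only [posSet, Set.ofPred_forall]
  exact isOpen_iInter_of_finite fun k => isOpen_lt continuous_const (continuous_affineFun c g k)

theorem isOpen_minPiece [Fintype F] (k : F) : IsOpen (minPiece c g k) := by
  simp only [minPiece, Set.ofPred_and, Set.ofPred_forall]
  exact (isOpen_lt continuous_const (continuous_affineFun c g k)).inter
    (isOpen_iInter_of_finite fun l => isOpen_iInter_of_finite fun _ =>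
      isOpen_lt (continuous_affineFun c g k) (continuous_affineFun c g l))

theorem convex_posSet : Convex ℝ (posSet c g) := by
  intro x hx y hy a b ha hb hab k
  rw [affineFun_combo c g k x y hab]
  have h1 := hx k
  have h2 := hy k
  rcases ha.eq_or_lt with rfl | ha
  · simp only [zero_add] at hab
    simpa [hab] using h2
  · have := mul_pos ha h1
    have := mul_nonneg hb h2.le
    linarith

theorem convex_minPiece (k : F) : Convex ℝ (minPiece c g k) := by
  intro x hx y hy a b ha hb hab
  have key : ∀ s t : ℝ, 0 < s → 0 < t → 0 < a * s + b * t := by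
    intro s t hs ht
    rcases ha.eq_or_lt with rfl | ha
    · simp only [zero_add] at hab
      simpa [hab] using ht
    · have := mul_pos ha hs
      have := mul_nonneg hb ht.le
      linarith
  refine ⟨?_, fun l hl => ?_⟩
  · rw [affineFun_combo c g k x y hab]
    exact key _ _ hx.1 hy.1
  · rw [affineFun_combo c g k x y hab, affineFun_combo c g l x y hab]
    have := key _ _ (sub_pos.2 (hx.2 l hl)) (sub_pos.2 (hy.2 l hl))
    linarith

theorem minPiece_subset (k : F) : minPiece c g k ⊆ posSet c g := by
  intro x hx l
  by_cases hl : l = k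
  · rw [hl]
    exact hx.1
  · exact hx.1.trans (hx.2 l hl)

theorem disjoint_minPiece : Pairwise fun k l => Disjoint (minPiece c g k) (minPiece c g l) := by
  intro k l hkl
  rw [Set.disjoint_left]
  intro x hx hx'
  exact lt_asymm (hx.2 l hkl.symm) (hx'.2 k hkl)

theorem volume_hyperplane {u : Space m} (hu : u ≠ 0) (a : ℝ) :
    volume {x : Space m | inner ℝ u x = a} = 0 := by
  by_cases h : ∃ x₀ : Space m, inner ℝ u x₀ = a
  · obtain ⟨x₀, hx₀⟩ := h
    let K : Submodule ℝ (Space m) := LinearMap.ker (innerSL ℝ u).toLinearMap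
    have hK : K ≠ ⊤ := by
      intro h
      have : u ∈ K := h ▸ Submodule.mem_top
      simp [K, hu] at this
    have h1 : {x : Space m | inner ℝ u x = a} = (fun x => x + (-x₀)) ⁻¹' (K : Set (Space m)) := by
      ext x
      simp only [K, ← hx₀, ← sub_eq_add_neg, Set.mem_preimage, SetLike.mem_coe, LinearMap.mem_ker,
        Set.mem_ofPred_eq, ContinuousLinearMap.coe_coe, innerSL_apply_apply, inner_sub_right, sub_eq_zero]
    rw [h1, measure_preimage_add_right]
    exact Measure.addHaar_submodule _ K hK
  · push Not at h
    simp [h]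

variable {c g}

/-- Outside all pieces two affine functions tie for the minimum. Their gradients differ, so ties
fill only finitely many hyperplanes. -/
theorem volume_posSet_diff [Fintype F] [Nonempty F] (hg : Function.Injective g) :
    volume (posSet c g \ ⋃ k, minPiece c g k) = 0 := by
  refine measure_mono_null (t := ⋃ k, ⋃ l, ⋃ (_ : k ≠ l), {x | inner ℝ (g k - g l) x = c l - c k})
    ?_ ?_
  · intro x hx
    obtain ⟨k, -, hk⟩ := Finset.exists_min_image Finset.univ (fun k => affineFun c g k x)
      Finset.univ_nonempty
    have hk' : ¬ (x ∈ minPiece c g k) := fun h => hx.2 (Set.mem_iUnion.2 ⟨k, h⟩)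
    have : ∃ l, l ≠ k ∧ affineFun c g l x ≤ affineFun c g k x := by
      by_contra h
      push Not at h
      exact hk' ⟨hx.1 k, h⟩
    obtain ⟨l, hl, hle⟩ := this
    have heq := le_antisymm hle (hk l (Finset.mem_univ l))
    simp only [Set.mem_iUnion]
    refine ⟨k, l, hl.symm, ?_⟩
    simp only [affineFun] at heq
    show inner ℝ (g k - g l) x = c l - c k
    rw [inner_sub_left]
    linarith
  · refine measure_iUnion_null fun k => measure_iUnion_null fun l => measure_iUnion_null fun hkl => ?_
    exact volume_hyperplane (sub_ne_zero.2 (hg.ne hkl)) _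

variable [Fintype F] [Nonempty F]

theorem minFun_eq {k : F} {x : Space m} (hx : x ∈ minPiece c g k) :
    minFun c g x = affineFun c g k x := by
  have h : (Finset.univ.inf' Finset.univ_nonempty fun k => affineFun c g k x) =
      affineFun c g k x := by
    refine le_antisymm (Finset.inf'_le _ (Finset.mem_univ k)) (Finset.le_inf' _ _ fun l _ => ?_)
    by_cases hl : l = k
    · rw [hl]
    · exact (hx.2 l hl).le
  rw [minFun, h]
  exact max_eq_right hx.1.le

theorem minFun_eq_zero {x : Space m} (hx : x ∉ posSet c g) : minFun c g x = 0 := by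
  simp only [posSet, Set.mem_ofPred_eq, not_forall, not_lt] at hx
  obtain ⟨k, hk⟩ := hx
  exact max_eq_left ((Finset.inf'_le _ (Finset.mem_univ k)).trans hk)

theorem minFun_nonneg (x : Space m) : 0 ≤ minFun c g x := le_max_left _ _

theorem minFun_le {x : Space m} (hx : x ∈ posSet c g) (k : F) :
    minFun c g x ≤ affineFun c g k x :=
  max_le (hx k).le (Finset.inf'_le _ (Finset.mem_univ k))

theorem lipschitzWith_minFun : LipschitzWith (∑ k, ‖g k‖₊) (minFun c g) := by
  refine LipschitzWith.of_le_add_mul _ fun x y => ?_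
  have hC : ((∑ k, ‖g k‖₊ : ℝ≥0) : ℝ) = ∑ k, ‖g k‖ := by simp
  rw [hC]
  have hk : ∀ k, affineFun c g k x ≤ affineFun c g k y + (∑ k, ‖g k‖) * dist x y := by
    intro k
    have h1 : affineFun c g k x - affineFun c g k y = inner ℝ (g k) (x - y) := by
      rw [affineFun, affineFun, inner_sub_right]
      ring
    have h2 := real_inner_le_norm (g k) (x - y)
    have h3 : ‖g k‖ ≤ ∑ k, ‖g k‖ :=
      Finset.single_le_sum (f := fun k => ‖g k‖) (fun _ _ => norm_nonneg _) (Finset.mem_univ k)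
    have h4 := mul_le_mul_of_nonneg_right h3 (norm_nonneg (x - y))
    rw [dist_eq_norm]
    linarith
  have hnn : 0 ≤ (∑ k, ‖g k‖) * dist x y := by positivity
  refine max_le (by linarith [minFun_nonneg (c := c) (g := g) y]) ?_
  obtain ⟨k, -, hk'⟩ := Finset.exists_mem_eq_inf' Finset.univ_nonempty
    (fun k => affineFun c g k y)
  calc _ ≤ affineFun c g k x := Finset.inf'_le _ (Finset.mem_univ k)
    _ ≤ affineFun c g k y + (∑ k, ‖g k‖) * dist x y := hk k
    _ ≤ _ := by
        rw [← hk']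
        gcongr
        exact le_max_right _ _

theorem hasCompactSupport_minFun (hb : Bornology.IsBounded (posSet c g)) :
    HasCompactSupport (minFun c g) :=
  HasCompactSupport.of_support_subset_isCompact hb.isCompact_closure fun x hx => by
    by_contra h
    exact hx (minFun_eq_zero fun h' => h (subset_closure h'))

/-- Almost every point lies in an open piece, where the function is affine nearby, or outside the
closure of the positivity set, where it vanishes nearby: ties are null, and so is the frontier of a
convex set. -/
theorem ae_lineDeriv_minFun (hg : Function.Injective g) (v : Space m) :
    ∀ᵐ x, lineDeriv ℝ (minFun c g) x v =
      ∑ k, (minPiece c g k).indicator (fun _ => inner ℝ (g k) v) x := by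
  have h1 := volume_posSet_diff (c := c) hg
  have h2 := (convex_posSet c g).addHaar_frontier volume
  rw [measure_eq_zero_iff_ae_notMem] at h1 h2
  filter_upwards [h1, h2] with x hx1 hx2
  by_cases hx : ∃ k, x ∈ minPiece c g k
  · obtain ⟨k, hk⟩ := hx
    rw [Finset.sum_eq_single k]
    · rw [Set.indicator_of_mem hk]
      have he : minFun c g =ᶠ[𝓝 x] affineFun c g k := by
        filter_upwards [(isOpen_minPiece c g k).mem_nhds hk] with y hy using minFun_eq hy
      have hd : HasFDerivAt (affineFun c g k) (innerSL ℝ (g k)) x :=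
        (innerSL ℝ (g k)).hasFDerivAt.const_add (c k)
      rw [he.lineDeriv_eq, hd.differentiableAt.lineDeriv_eq_fderiv, hd.fderiv]
      rfl
    · intro l _ hl
      exact Set.indicator_of_notMem
        (fun h => Set.disjoint_left.1 (disjoint_minPiece c g hl) h hk) _
    · simp
  · push Not at hx
    rw [Finset.sum_eq_zero fun k _ => Set.indicator_of_notMem (hx k) _]
    have hxP : x ∉ posSet c g := fun h => hx1 ⟨h, fun h' => by
      obtain ⟨k, hk⟩ := Set.mem_iUnion.1 h'
      exact hx k hk⟩
    have hxc : x ∉ closure (posSet c g) := fun h => hx2 (by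
      rw [(isOpen_posSet c g).frontier_eq]
      exact ⟨h, hxP⟩)
    have he : minFun c g =ᶠ[𝓝 x] fun _ => 0 := by
      filter_upwards [isClosed_closure.isOpen_compl.mem_nhds hxc] with y hy
      exact minFun_eq_zero fun h => hy (subset_closure h)
    rw [he.lineDeriv_eq]
    simp [lineDeriv]

/-- Integration by parts turns each choice of f and v into a linear relation between integrals over
the pieces. All information on their volumes comes from here, without computing any polytope. -/
theorem integral_lineDeriv_mul_minFun (hg : Function.Injective g)
    (hb : Bornology.IsBounded (posSet c g)) {f : Space m → ℝ} {D : ℝ≥0} (hf : LipschitzWith D f)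
    (v : Space m) :
    ∫ x, lineDeriv ℝ f x v * minFun c g x =
      -∑ k, inner ℝ (g k) v * ∫ x in minPiece c g k, f x := by
  have hInt : ∀ k, IntegrableOn f (minPiece c g k) := fun k =>
    (hf.continuous.continuousOn.integrableOn_compact hb.isCompact_closure).mono_set
      ((minPiece_subset c g k).trans subset_closure)
  have hind : ∀ k x, (minPiece c g k).indicator (fun _ => inner ℝ (g k) (-v)) x * f x =
      (minPiece c g k).indicator (fun x => inner ℝ (g k) (-v) * f x) x := fun k x => by
    by_cases hx : x ∈ minPiece c g k <;> simp [hx]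
  rw [LipschitzWith.integral_lineDeriv_mul_eq hf lipschitzWith_minFun (hasCompactSupport_minFun hb),
    ← Finset.sum_neg_distrib]
  calc _ = ∫ x, ∑ k, (minPiece c g k).indicator (fun x => inner ℝ (g k) (-v) * f x) x := by
        refine integral_congr_ae ?_
        filter_upwards [ae_lineDeriv_minFun (c := c) hg (-v)] with x hx
        rw [hx, Finset.sum_mul]
        exact Finset.sum_congr rfl fun k _ => hind k x
    _ = ∑ k, ∫ x, (minPiece c g k).indicator (fun x => inner ℝ (g k) (-v) * f x) x :=
        integral_finsetSum _ fun k _ =>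
          IntegrableOn.integrable_indicator (Integrable.const_mul (hInt k) _) (isOpen_minPiece c g k).measurableSet
    _ = _ := by
        refine Finset.sum_congr rfl fun k _ => ?_
        rw [integral_indicator (isOpen_minPiece c g k).measurableSet, integral_const_mul,
          inner_neg_right]
        ring

/-- The partition of the positivity set by the unique minimizers, with labels `L`. -/
def minPartition (c : F → ℝ) (g : F → Space m) (L : F → Label d m) :
    Set (Set (Space m) × Label d m) :=
  (fun k => (minPiece c g k, L k)) '' {k | (minPiece c g k).Nonempty}

theorem isPartition_minPartition (hg : Function.Injective g)
    (hb : Bornology.IsBounded (posSet c g)) (L : F → Label d m) :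
    IsPartition (posSet c g) (minPartition c g L) where
  countable := (Set.to_countable _).image _
  disjoint := by
    rintro _ ⟨k, hk, rfl⟩ _ ⟨l, hl, rfl⟩ hkl
    exact disjoint_minPiece c g fun h => hkl (by rw [h])
  regular := by
    rintro _ ⟨k, hk, rfl⟩
    exact IsRegularDomain.of_convex (isOpen_minPiece c g k) (hb.subset (minPiece_subset c g k))
      (convex_minPiece c g k) hk
  subset := by
    rintro _ ⟨k, hk, rfl⟩
    exact minPiece_subset c g k
  cover := by
    refine measure_mono_null (Set.sdiff_subset_sdiff_right ?_) (volume_posSet_diff hg)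
    intro x hx
    obtain ⟨k, hk⟩ := Set.mem_iUnion.1 hx
    exact Set.mem_iUnion₂.2 ⟨_, Set.mem_image_of_mem _ (⟨x, hk⟩ : (minPiece c g k).Nonempty), hk⟩

theorem tsum_minPartition (L : F → Label d m) (f : Set (Space m) × Label d m → ℝ≥0∞)
    (hf : ∀ s, f (∅, s) = 0) :
    ∑' v : minPartition c g L, f v = ∑ k, f (minPiece c g k, L k) := by
  have hinj : Set.InjOn (fun k => (minPiece c g k, L k)) {k | (minPiece c g k).Nonempty} := by
    intro k hk l _ hkl
    by_contra hne
    have h1 : Disjoint (minPiece c g k) (minPiece c g l) := disjoint_minPiece c g hne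
    simp only [Prod.mk.injEq] at hkl
    rw [hkl.1, disjoint_self] at h1
    obtain ⟨x, hx⟩ := (hk : (minPiece c g k).Nonempty)
    rw [hkl.1, h1] at hx
    exact hx
  rw [minPartition, tsum_image f hinj, ← tsum_fintype (L := .unconditional _)]
  refine tsum_subtype_eq_of_support_subset (f := fun k => f (minPiece c g k, L k)) fun k hk => ?_
  by_contra h
  have h' : minPiece c g k = ∅ := Set.not_nonempty_iff_eq_empty.1 h
  simp [h', hf] at hk

/-- At distance at most 1 the Lipschitz bound is the stronger one, beyond it twice the sup bound
suffices. -/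
theorem holderBound_of_lipschitz {X Y : Type*} [PseudoMetricSpace X] [NormedAddCommGroup Y]
    {w : X → Y} {K : ℝ≥0} {B α : ℝ} (hα' : α ≤ 1) (hα : 0 ≤ α) (hw : LipschitzWith K w)
    (hB : ∀ x, ‖w x‖ ≤ B) : HolderBound α (K + 2 * B) w := by
  refine ⟨fun x => ?_, fun x y => ?_⟩
  · linarith [hB x, norm_nonneg (w x), K.coe_nonneg]
  · have hB0 := (norm_nonneg _).trans (hB x)
    have h1 := hw.dist_le_mul x y
    rw [dist_eq_norm] at h1
    rcases le_total (dist x y) 1 with h | h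
    · have h2 : dist x y ≤ dist x y ^ α := by
        rcases (dist_nonneg (x := x) (y := y)).eq_or_lt with h0 | h0
        · rw [← h0]
          exact Real.rpow_nonneg le_rfl α
        · conv_lhs => rw [← Real.rpow_one (dist x y)]
          exact Real.rpow_le_rpow_of_exponent_ge h0 h hα'
      have h3 := mul_le_mul_of_nonneg_left h2 K.coe_nonneg
      have h4 : 0 ≤ 2 * B * dist x y ^ α := by positivity
      linarith
    · have h2 : 1 ≤ dist x y ^ α := Real.one_le_rpow h hα
      have h3 : ‖w x - w y‖ ≤ 2 * B := by
        linarith [norm_sub_le (w x) (w y), hB x, hB y]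
      have h4 : (K + 2 * B) * 1 ≤ (K + 2 * B) * dist x y ^ α :=
        mul_le_mul_of_nonneg_left h2 (by positivity)
      linarith [K.coe_nonneg]

/-- A scalar profile times a fixed vector a has gradient a ⊗ ∇φ, so it changes C only in rank-one
directions a ⊗ g k. -/
theorem isRealization_minFun (hg : Function.Injective g) (hb : Bornology.IsBounded (posSet c g))
    (hne : (posSet c g).Nonempty) (a : Space d) (C : Mat d m) {L : F → Label d m}
    (hL : ∀ k, (L k).1 = C + Matrix.vecMulVec a (g k)) :
    IsRealization (posSet c g) C (minPartition c g L) (fun x => minFun c g x • a) := by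
  have hpart := isPartition_minPartition hg hb L
  have hreg : IsRegularDomain (posSet c g) :=
    IsRegularDomain.of_convex (isOpen_posSet c g) hb (convex_posSet c g) hne
  obtain ⟨p, hp⟩ := hpart.exists_hasDist hreg
  have hLm : moment p ≠ ⊤ := by
    have h1 := hp.tsum_mul fun s => ‖s.1‖ₑ
    rw [tsum_minPartition L (fun v => volume v.1 * ‖v.2.1‖ₑ) (by simp)] at h1
    intro h
    have h2 : volume (posSet c g) * moment p = ⊤ := by
      rw [h, ENNReal.mul_top hreg.volume_ne_zero]
    rw [moment, ← h1] at h2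
    refine absurd h2 (ENNReal.sum_lt_top.2 fun k _ => ENNReal.mul_lt_top ?_ enorm_lt_top).ne
    exact (hb.subset (minPiece_subset c g k)).measure_lt_top
  refine ⟨hpart, ?_, ?_, ?_, ?_⟩
  · rintro _ ⟨k, hk, rfl⟩
    refine ⟨c k • a, fun x hx => ?_⟩
    rw [minFun_eq hx]
    ext i
    simp only [hL, add_sub_cancel_left, affineMap, affineFun, PiLp.add_apply, PiLp.smul_apply,
      smul_eq_mul, Matrix.toLpLin_apply, Matrix.mulVec, dotProduct, Matrix.vecMulVec_apply,
      PiLp.inner_apply, RCLike.inner_apply, conj_trivial]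
    simp only [mul_assoc, ← Finset.mul_sum]
    simp only [mul_comm (x _)]
    ring
  · exact (lipschitzWith_minFun (c := c) (g := g)).continuous.smul continuous_const
  · intro x hx
    rw [minFun_eq_zero hx, zero_smul]
  · intro i j
    have hlip : LipschitzWith (‖a i‖₊ * ∑ k, ‖g k‖₊) fun x => (minFun c g x • a) i := by
      refine LipschitzWith.of_dist_le_mul fun x y => ?_
      have := (lipschitzWith_minFun (c := c) (g := g)).dist_le_mul x y
      rw [Real.dist_eq] at this ⊢
      simp only [PiLp.smul_apply, smul_eq_mul]
      rw [← sub_mul, abs_mul, mul_comm]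
      push_cast
      push_cast at this
      rw [mul_assoc]
      exact mul_le_mul_of_nonneg_left this (abs_nonneg _)
    refine HasWeakDeriv.of_lipschitz hlip (hpart.integrable_pieceGrad hreg hp hLm C i j) ?_
    filter_upwards [ae_lineDeriv_minFun (c := c) hg (EuclideanSpace.single j 1), hpart.ae_mem,
      (lipschitzWith_minFun (c := c) (g := g)).ae_lineDifferentiableAt
        (μ := volume) (EuclideanSpace.single j 1)] with x hx hx' hx3
    have h1 : lineDeriv ℝ (fun x => (minFun c g x • a) i) x (EuclideanSpace.single j 1) =
        lineDeriv ℝ (minFun c g) x (EuclideanSpace.single j 1) * a i := by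
      have := hx3.hasLineDerivAt
      rw [HasLineDerivAt] at this
      have h2 := this.mul_const (a i)
      exact HasLineDerivAt.lineDeriv h2
    rw [h1, hx]
    by_cases hxP : x ∈ posSet c g
    · obtain ⟨_, ⟨k, hk, rfl⟩, hxk⟩ := hx' hxP
      rw [pieceGrad_eq hpart.disjoint (Set.mem_image_of_mem _ hk) hxk, Finset.sum_eq_single k,
        Set.indicator_of_mem hxk]
      · simp [hL, Matrix.vecMulVec_apply, mul_comm, EuclideanSpace.inner_single_right]
      · intro l _ hl
        exact Set.indicator_of_notMem
          (fun h => Set.disjoint_left.1 (disjoint_minPiece c g hl) h hxk) _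
      · simp
    · rw [pieceGrad_eq_zero fun v hv h => hxP (hpart.subset v hv h),
        Finset.sum_eq_zero fun k _ => Set.indicator_of_notMem
          (fun h => hxP (minPiece_subset c g k h)) _]
      simp

end MinAffine

/-! ### Rank-one splitting -/

section RankOne

variable {d m : ℕ}

theorem exists_vecMulVec_of_rank_eq_one {X : Mat d m} (h : X.rank = 1) :
    ∃ (a : Space d) (n : Space m), X = Matrix.vecMulVec a n := by
  rw [Matrix.rank] at h
  obtain ⟨v, -, hv⟩ := finrank_eq_one_iff'.1 h
  have h1 : ∀ j, ∃ c : ℝ, ∀ i, X i j = v.1 i * c := by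
    intro j
    obtain ⟨c, hc⟩ := hv ⟨X.mulVecLin (Pi.single j 1), LinearMap.mem_range_self _ _⟩
    refine ⟨c, fun i => ?_⟩
    have h2 := congrFun (congrArg Subtype.val hc) i
    simp only [Matrix.mulVecLin_apply, Matrix.mulVec_single_one, Matrix.col_apply,
      SetLike.val_smul, Pi.smul_apply, smul_eq_mul] at h2
    rw [← h2, mul_comm]
  choose n hn using h1
  refine ⟨WithLp.toLp 2 v.1, WithLp.toLp 2 n, ?_⟩
  ext i j
  rw [hn j i, Matrix.vecMulVec_apply]

/-- Gradients of the affine functions used for a splitting in direction `n` with weights `l` and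
`1 - l`; the small gradients `± s e_i` cut off. -/
def splitGrad (n : Space m) (j₀ : Fin m) (l s : ℝ) (k : Fin m × Bool) : Space m :=
  if k.1 = j₀ then (if k.2 then 1 - l else -l) • n
  else (if k.2 then s else -s) • EuclideanSpace.single k.1 1

/-- Values at the origin of the affine functions used for a splitting. -/
def splitConst (j₀ : Fin m) (c : ℝ) (k : Fin m × Bool) : ℝ := if k.1 = j₀ then 1 else c

theorem sum_split {M : Type*} [AddCommMonoid M] (j₀ : Fin m) (f : Fin m × Bool → M) :
    ∑ k, f k = (f (j₀, true) + f (j₀, false)) +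
      ∑ i ∈ Finset.univ.erase j₀, (f (i, true) + f (i, false)) := by
  rw [Fintype.sum_prod_type, ← Finset.add_sum_erase _ _ (Finset.mem_univ j₀)]
  simp only [Fintype.sum_bool]

variable {n : Space m} {j₀ : Fin m} {l s c : ℝ}

/-- Distinct gradients are what makes ties a null set. The component j₀ separates the two multiples
of n from the cut-off gradients, for which it vanishes. -/
theorem splitGrad_injective (hn : n j₀ ≠ 0) (hl : 0 < l) (hl' : l < 1) (hs : 0 < s) :
    Function.Injective (splitGrad n j₀ l s) := by
  have hl1 : 1 - l ≠ 0 := by linarith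
  have hne : ∀ i b b', i ≠ j₀ → splitGrad n j₀ l s (i, b) ≠ splitGrad n j₀ l s (j₀, b') := by
    intro i b b' hi h
    have h0 := congrArg (fun x : Space m => x j₀) h
    simp only [splitGrad, if_neg hi, if_true] at h0
    cases b <;> cases b' <;> simp [Ne.symm hi, hn, hl.ne', hl1] at h0
  rintro ⟨i, b⟩ ⟨i', b'⟩ h
  by_cases hi : i = j₀
  · subst hi
    by_cases hi' : i' = i
    · subst hi'
      have h0 := congrArg (fun x : Space m => x i') h
      simp only [splitGrad, if_true] at h0
      cases b <;> cases b' <;> simp at h0 ⊢ <;> exact hn (by linarith)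
    · exact absurd h.symm (hne _ _ _ hi')
  · by_cases hi' : i' = j₀
    · subst hi'
      exact absurd h (hne _ _ _ hi)
    · have h1 := congrArg (fun x : Space m => x i) h
      simp only [splitGrad, if_neg hi, if_neg hi'] at h1
      by_cases hii : i = i'
      · subst hii
        cases b <;> cases b' <;> simp at h1 ⊢ <;> linarith
      · cases b <;> cases b' <;> simp [hii, hs.ne'] at h1

theorem affineFun_split_eq (x : Space m) (b : Bool) :
    affineFun (splitConst j₀ c) (splitGrad n j₀ l s) (j₀, b) x =
      1 + (if b then 1 - l else -l) * inner ℝ n x := by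
  simp only [affineFun, splitConst, splitGrad, if_true, real_inner_smul_left]

theorem affineFun_split_ne (x : Space m) {i : Fin m} (hi : i ≠ j₀) (b : Bool) :
    affineFun (splitConst j₀ c) (splitGrad n j₀ l s) (i, b) x =
      c + (if b then s else -s) * x i := by
  simp only [affineFun, splitConst, splitGrad, if_neg hi, real_inner_smul_left,
    EuclideanSpace.inner_single_left, map_one, one_mul]

theorem zero_mem_posSet_split (hc : 0 < c) :
    (0 : Space m) ∈ posSet (splitConst j₀ c) (splitGrad n j₀ l s) := by
  intro k
  simp only [affineFun, splitConst, inner_zero_right, add_zero]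
  split_ifs
  · exact one_pos
  · exact hc

/-- The cut-offs bound the coordinates other than j₀, the two main functions bound the product with
n, and n j₀ ≠ 0 then bounds the remaining coordinate. -/
theorem isBounded_posSet_split (hn : n j₀ ≠ 0) (hl : 0 < l) (hl' : l < 1) (hs : 0 < s)
    (hc : 0 < c) : Bornology.IsBounded (posSet (splitConst j₀ c) (splitGrad n j₀ l s)) := by
  let R : ℝ := c / s + (1 / l + 1 / (1 - l) + ∑ i, |n i| * (c / s)) / |n j₀|
  refine (isBounded_openBox (fun _ => -(R + 1)) (fun _ => R + 1)).subset ?_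
  intro x hx
  have hl1 : 0 < 1 - l := by linarith
  have hcs : 0 < c / s := by positivity
  have hx1 : ∀ i, i ≠ j₀ → |x i| ≤ c / s := by
    intro i hi
    have h1 := hx (i, true)
    have h2 := hx (i, false)
    rw [affineFun_split_ne x hi] at h1 h2
    simp only [if_true, Bool.false_eq_true, if_false] at h1 h2
    rw [le_div_iff₀ hs, ← abs_of_pos hs, ← abs_mul, abs_le]
    constructor <;> linarith
  have hx2 : |inner ℝ n x| ≤ 1 / l + 1 / (1 - l) := by
    have h1 := hx (j₀, true)
    have h2 := hx (j₀, false)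
    rw [affineFun_split_eq] at h1 h2
    simp only [if_true, Bool.false_eq_true, if_false] at h1 h2
    have h3 : -(1 / (1 - l)) ≤ inner ℝ n x := by
      rw [neg_le, ← mul_le_mul_iff_of_pos_left hl1, mul_one_div_cancel hl1.ne']
      linarith
    have h4 : inner ℝ n x ≤ 1 / l := by
      rw [← mul_le_mul_iff_of_pos_left hl, mul_one_div_cancel hl.ne']
      linarith
    have h5 : 0 < 1 / l := by positivity
    have h6 : 0 < 1 / (1 - l) := by positivity
    rw [abs_le]
    constructor <;> linarith
  have hx3 : |x j₀| ≤ (1 / l + 1 / (1 - l) + ∑ i, |n i| * (c / s)) / |n j₀| := by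
    rw [le_div_iff₀ (abs_pos.2 hn), ← abs_mul]
    have h1 : inner ℝ n x = x j₀ * n j₀ + ∑ i ∈ Finset.univ.erase j₀, x i * n i := by
      rw [PiLp.inner_apply, Finset.add_sum_erase _ (fun i => x i * n i) (Finset.mem_univ j₀)]
      simp
    have h2 : |∑ i ∈ Finset.univ.erase j₀, x i * n i| ≤ ∑ i, |n i| * (c / s) := by
      refine (Finset.abs_sum_le_sum_abs _ _).trans ?_
      refine (Finset.sum_le_sum fun i hi => ?_).trans (Finset.sum_le_sum_of_subset_of_nonneg
        (Finset.subset_univ _) fun i _ _ => by positivity)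
      rw [abs_mul, mul_comm]
      exact mul_le_mul_of_nonneg_left (hx1 i (Finset.ne_of_mem_erase hi)) (abs_nonneg _)
    have h3 : x j₀ * n j₀ = inner ℝ n x - ∑ i ∈ Finset.univ.erase j₀, x i * n i := by
      linarith
    rw [h3]
    exact (abs_sub _ _).trans (add_le_add hx2 h2)
  have hnn : 0 ≤ (1 / l + 1 / (1 - l) + ∑ i, |n i| * (c / s)) / |n j₀| := (abs_nonneg _).trans hx3
  intro i
  have hxi : |x i| ≤ R := by
    by_cases hi : i = j₀
    · subst hi
      linarith
    · linarith [hx1 i hi]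
  constructor <;> linarith [abs_le.1 hxi]

/-- The first identity keeps the weights of the splitting exact, so the loss is the same relative
loss for both matrices. The second makes the cut-off pieces negligible when c is large, whatever the
slope s. -/
theorem volume_minPiece_split (hn : n j₀ ≠ 0) (hl : 0 < l) (hl' : l < 1) (hs : 0 < s)
    (hc : 1 < c) :
    (1 - l) * volume.real (minPiece (splitConst j₀ c) (splitGrad n j₀ l s) (j₀, true)) =
        l * volume.real (minPiece (splitConst j₀ c) (splitGrad n j₀ l s) (j₀, false)) ∧
      ∀ i, i ≠ j₀ →
        (c - 1) * (volume.real (minPiece (splitConst j₀ c) (splitGrad n j₀ l s) (i, true)) +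
          volume.real (minPiece (splitConst j₀ c) (splitGrad n j₀ l s) (i, false))) ≤
        volume.real (posSet (splitConst j₀ c) (splitGrad n j₀ l s)) := by
  have : Nonempty (Fin m × Bool) := ⟨(j₀, true)⟩
  have hg := splitGrad_injective hn hl hl' hs
  have hb := isBounded_posSet_split (c := c) hn hl hl' hs (by linarith)
  set C := splitConst j₀ c with hC
  set g := splitGrad n j₀ l s with hgdef
  have hVb : ∀ k, volume (minPiece C g k) ≠ ⊤ := fun k =>
    (hb.subset (minPiece_subset C g k)).measure_lt_top.ne
  refine ⟨?_, fun i hi => ?_⟩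
  -- Test with the constant 1 in direction e_{j₀}: the cut-off gradients have no component there, so
  -- only the two main pieces remain, with the common factor n j₀ ≠ 0.
  · have h1 := integral_lineDeriv_mul_minFun (c := C) hg hb (LipschitzWith.const (1 : ℝ))
      (EuclideanSpace.single j₀ 1)
    have h2 : ∀ x : Space m, lineDeriv ℝ (fun _ : Space m => (1 : ℝ)) x
      (EuclideanSpace.single j₀ 1) = 0 := fun x => by simp [lineDeriv]
    simp only [h2, zero_mul, integral_zero, setIntegral_const, smul_eq_mul, mul_one] at h1
    rw [sum_split j₀, Finset.sum_eq_zero] at h1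
    · simp only [hgdef, splitGrad, if_true, PiLp.smul_apply, smul_eq_mul,
        EuclideanSpace.inner_single_right, conj_trivial, one_mul, Bool.false_eq_true, if_false] at h1
      rw [← hgdef] at h1
      have h3 : n j₀ * ((1 - l) * volume.real (minPiece C g (j₀, true)) -
          l * volume.real (minPiece C g (j₀, false))) = 0 := by linarith
      have := (mul_eq_zero.1 h3).resolve_left hn
      linarith
    · intro i hi
      have hi := Finset.ne_of_mem_erase hi
      simp [hgdef, splitGrad, hi, EuclideanSpace.inner_single_right]
  -- The direction v is orthogonal to n and to every cut-off gradient except ±s e_i, and x_i has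
  -- derivative 1 along it. Testing with x_i thus isolates the two cut-off pieces of index i and
  -- leaves the integral of the profile.
  · let v : Space m := EuclideanSpace.single i 1 - (n i / n j₀) • EuclideanSpace.single j₀ 1
    have hlip : LipschitzWith 1 fun x : Space m => x i := by
      refine LipschitzWith.of_dist_le_mul fun x y => ?_
      rw [Real.dist_eq, dist_eq_norm, NNReal.coe_one, one_mul]
      exact PiLp.norm_apply_le (x - y) i
    have h1 := integral_lineDeriv_mul_minFun (c := C) hg hb hlip v
    have h2 : ∀ x : Space m, lineDeriv ℝ (fun x : Space m => x i) x v = 1 := fun x => by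
      have hd : HasFDerivAt (fun x : Space m => x i) (EuclideanSpace.proj (𝕜 := ℝ) i) x :=
        (EuclideanSpace.proj (𝕜 := ℝ) i).hasFDerivAt
      rw [hd.differentiableAt.lineDeriv_eq_fderiv, hd.fderiv]
      simp [v, hi]
    simp only [h2, one_mul] at h1
    have hnv : inner ℝ n v = 0 := by
      simp only [v, inner_sub_right, real_inner_smul_right, EuclideanSpace.inner_single_right,
        conj_trivial, one_mul]
      field_simp
      simp
    have hev : ∀ i', i' ≠ j₀ → inner ℝ (EuclideanSpace.single i' (1 : ℝ)) v =
        if i' = i then 1 else 0 := by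
      intro i' hi'
      simp [v, EuclideanSpace.inner_single_left, hi']
    have hgv : ∀ b, inner ℝ (g (i, b)) v = if b then s else -s := by
      intro b
      simp only [hgdef, splitGrad, if_neg hi, real_inner_smul_left, hev i hi, if_true, mul_one]
    have hsum : ∑ k, inner ℝ (g k) v * ∫ x in minPiece C g k, x i =
        s * (∫ x in minPiece C g (i, true), x i) - s * ∫ x in minPiece C g (i, false), x i := by
      rw [sum_split j₀, Finset.sum_eq_single i]
      · simp only [hgv]
        simp only [hgdef, splitGrad, if_true, real_inner_smul_left, hnv]
        simp
        ring
      · intro i' hi' hne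
        have hi' := Finset.ne_of_mem_erase hi'
        simp [hgdef, splitGrad, hi', real_inner_smul_left, hev i' hi', hne]
      · intro h
        exact absurd (Finset.mem_erase.2 ⟨hi, Finset.mem_univ i⟩) h
    rw [hsum] at h1
    -- The slopes 1 - l and -l have opposite signs, so one of the two main functions is at most 1 at
    -- every point.
    have hle1 : ∀ x ∈ posSet C g, ∃ b, affineFun C g (j₀, b) x ≤ 1 := by
      intro x _
      rcases le_total 0 (inner ℝ n x) with h | h
      · refine ⟨false, ?_⟩
        rw [hC, hgdef, affineFun_split_eq]
        simp only [Bool.false_eq_true, if_false]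
        nlinarith
      · refine ⟨true, ?_⟩
        rw [hC, hgdef, affineFun_split_eq]
        simp only [if_true]
        nlinarith
    have hphi : ∫ x, minFun C g x ≤ volume.real (posSet C g) := by
      rw [← integral_indicator_one (isOpen_posSet C g).measurableSet]
      refine integral_mono_of_nonneg (Eventually.of_forall fun x => minFun_nonneg x)
        ((integrable_indicator_iff (isOpen_posSet C g).measurableSet).2
          (integrableOn_const hb.measure_lt_top.ne)) (Eventually.of_forall fun x => ?_)
      by_cases hx : x ∈ posSet C g
      · obtain ⟨b, hb⟩ := hle1 x hx
        simp only [Set.indicator_of_mem hx, Pi.one_apply]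
        exact (minFun_le hx _).trans hb
      · simp only [Set.indicator_of_notMem hx, minFun_eq_zero hx, le_refl]
    -- On a cut-off piece c ± s x_i is the minimum and hence at most 1. There ∓ s x_i ≥ c - 1, and
    -- integrating this bounds the volume.
    have hpiece : ∀ b, ∀ x ∈ minPiece C g (i, b), c + (if b then s else -s) * x i ≤ 1 := by
      intro b x hx
      obtain ⟨b', hb'⟩ := hle1 x (minPiece_subset C g _ hx)
      have h3 := hx.2 (j₀, b') fun h => hi (congrArg Prod.fst h).symm
      rw [hC, hgdef, affineFun_split_ne x hi] at h3
      rw [hC, hgdef] at hb'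
      linarith
    have hInt : ∀ b, IntegrableOn (fun x : Space m => x i) (minPiece C g (i, b)) := fun b =>
      (hlip.continuous.continuousOn.integrableOn_compact hb.isCompact_closure).mono_set
        ((minPiece_subset C g _).trans subset_closure)
    have hT : (c - 1) * volume.real (minPiece C g (i, true)) ≤
        -(s * ∫ x in minPiece C g (i, true), x i) := by
      rw [← integral_const_mul, ← integral_neg, mul_comm, ← smul_eq_mul, ← setIntegral_const]
      refine setIntegral_mono_on (integrableOn_const (hVb _)) ((hInt true).const_mul s).neg
        (isOpen_minPiece C g _).measurableSet fun x hx => ?_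
      have := hpiece true x hx
      simp only [if_true] at this
      linarith
    have hF : (c - 1) * volume.real (minPiece C g (i, false)) ≤
        s * ∫ x in minPiece C g (i, false), x i := by
      rw [← integral_const_mul, mul_comm, ← smul_eq_mul, ← setIntegral_const]
      refine setIntegral_mono_on (integrableOn_const (hVb _)) ((hInt false).const_mul s)
        (isOpen_minPiece C g _).measurableSet fun x hx => ?_
      have := hpiece false x hx
      simp only [Bool.false_eq_true, if_false] at this
      linarith
    linarith

theorem norm_vecMulVec_single_le (a : Space d) (i : Fin m) (s : ℝ) :
    ‖Matrix.vecMulVec a (s • EuclideanSpace.single i (1 : ℝ) : Space m)‖ ≤ |s| *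
      ‖Matrix.vecMulVec a (EuclideanSpace.single i (1 : ℝ) : Space m)‖ := by
  rw [← Real.norm_eq_abs, ← norm_smul]
  refine le_of_eq (congrArg norm ?_)
  ext i j
  simp only [Matrix.vecMulVec_apply, Matrix.smul_apply, PiLp.smul_apply, smul_eq_mul]
  ring

/-- A rank-one splitting can be realized up to an error of small volume with gradients close to the
barycenter; the two volume fractions keep their exact ratio. -/
theorem exists_realizable_rankOne {α : ℝ} (hα : 0 < α) (hα' : α < 1) {B B' C : Mat d m}
    (hl : 0 < l) (hl' : l < 1) (hC : C = l • B + (1 - l) • B') (hr : (B' - B).rank = 1) {η : ℝ}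
    (hη : 0 < η) :
    ∃ (P : PMF (Label d m)) (q : ℝ), 0 ≤ q ∧ q ≤ η ∧ Realizable α C P ∧
      P (B, 0) = ENNReal.ofReal (l * (1 - q)) ∧ P (B', 0) = ENNReal.ofReal ((1 - l) * (1 - q)) ∧
      (∀ t, P t ≠ 0 → t = (B, 0) ∨ t = (B', 0) ∨ (t.2 = 1 ∧ ‖t.1 - C‖ ≤ η)) ∧
      expect P (fun t => if t.2 = 1 then 1 else 0) = ENNReal.ofReal q := by
  obtain ⟨a₀, n, han⟩ := exists_vecMulVec_of_rank_eq_one hr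
  let a : Space d := -a₀
  have hBB : B - B' = Matrix.vecMulVec a n := by
    rw [← neg_sub, han]
    ext i j
    simp [a, Matrix.vecMulVec_apply]
  have hne : B ≠ B' := by
    rintro rfl
    simp at hr
  obtain ⟨j₀, hn⟩ : ∃ j, n j ≠ 0 := by
    by_contra h
    push Not at h
    apply hne
    rw [← sub_eq_zero, hBB]
    ext i j
    simp [Matrix.vecMulVec_apply, h]
  have hm : 0 < m := j₀.pos
  have hne' : Nonempty (Fin m × Bool) := ⟨(j₀, true)⟩
  -- With c - 1 = m/η each pair of cut-off pieces takes at most the fraction η/m, and there are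
  -- fewer than m pairs.
  let c : ℝ := 1 + m / η
  have hmη : 0 < m / η := by positivity
  have hc : 1 < c := by simp only [c]; linarith
  let N : ℝ := 1 + ∑ i : Fin m, ‖Matrix.vecMulVec a (EuclideanSpace.single i (1 : ℝ) : Space m)‖
  have hN : 0 < N := by positivity
  -- N dominates the norms of all a ⊗ e_i, so the cut-off gradients stay within η of C.
  let s : ℝ := η / N
  have hs : 0 < s := by positivity
  have hg := splitGrad_injective hn hl hl' hs
  have hb := isBounded_posSet_split (c := c) hn hl hl' hs (by linarith)
  obtain ⟨hv1, hv2⟩ := volume_minPiece_split (c := c) hn hl hl' hs hc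
  set D := splitConst j₀ c
  set g := splitGrad n j₀ l s with hgdef
  -- The cut-off pieces are the errors and get tag 1, even if such a gradient happens to equal B or
  -- B'.
  let L : Fin m × Bool → Label d m := fun k =>
    (C + Matrix.vecMulVec a (g k), if k.1 = j₀ then 0 else 1)
  have hB : C + Matrix.vecMulVec a (g (j₀, true)) = B := by
    have h1 : Matrix.vecMulVec a (g (j₀, true)) = (1 - l) • (B - B') := by
      rw [hBB]
      ext i j
      simp [hgdef, splitGrad, Matrix.vecMulVec_apply]
      ring
    rw [h1, hC]
    module
  have hB' : C + Matrix.vecMulVec a (g (j₀, false)) = B' := by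
    have h1 : Matrix.vecMulVec a (g (j₀, false)) = (-l) • (B - B') := by
      rw [hBB]
      ext i j
      simp [hgdef, splitGrad, Matrix.vecMulVec_apply]
      ring
    rw [h1, hC]
    module
  have hLt : L (j₀, true) = (B, 0) := by simp [L, hB]
  have hLf : L (j₀, false) = (B', 0) := by simp [L, hB']
  have hLi : ∀ i b, i ≠ j₀ → (L (i, b)).2 = 1 := fun i b hi => by simp [L, hi]
  have hne0 : (posSet D g).Nonempty := ⟨0, zero_mem_posSet_split (by linarith)⟩
  have hreg : IsRegularDomain (posSet D g) :=
    IsRegularDomain.of_convex (isOpen_posSet D g) hb (convex_posSet D g) hne0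
  have hpart := isPartition_minPartition (c := D) hg hb L
  have hreal := isRealization_minFun (c := D) hg hb hne0 a C (L := L) fun _ => rfl
  obtain ⟨P, hP⟩ := hpart.exists_hasDist hreg
  have hfin : ∀ k, volume (minPiece D g k) ≠ ⊤ := fun k =>
    (hb.subset (minPiece_subset D g k)).measure_lt_top.ne
  have hexp : ∀ f, volume (posSet D g) * expect P f = ∑ k, volume (minPiece D g k) * f (L k) := by
    intro f
    rw [← hP.tsum_mul f]
    exact tsum_minPartition L (fun v => volume v.1 * f v.2) (by simp)
  have hPt : ∀ t, P t * volume (posSet D g) =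
      ∑ k, ({t} : Set (Label d m)).indicator (fun _ => volume (minPiece D g k)) (L k) := by
    intro t
    rw [← hP t]
    exact tsum_minPartition L (fun v => ({t} : Set (Label d m)).indicator (fun _ => volume v.1) v.2)
      (by simp)
  have hmom : moment P ≠ ⊤ := by
    intro h
    have h2 : volume (posSet D g) * moment P = ⊤ := by
      rw [h, ENNReal.mul_top hreg.volume_ne_zero]
    rw [moment, hexp] at h2
    exact absurd h2 (ENNReal.sum_lt_top.2 fun k _ =>
      ENNReal.mul_lt_top (hfin k).lt_top enorm_lt_top).ne
  have hholder : ∃ K, HolderBound α K (fun x => minFun D g x • a) := by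
    have h1 : LipschitzWith (‖a‖₊ * ∑ k, ‖g k‖₊) (fun x => minFun D g x • a) := by
      refine LipschitzWith.of_dist_le_mul fun x y => ?_
      have := (lipschitzWith_minFun (c := D) (g := g)).dist_le_mul x y
      rw [Real.dist_eq] at this
      rw [dist_eq_norm, ← sub_smul, norm_smul, mul_comm, NNReal.coe_mul, mul_assoc]
      exact mul_le_mul_of_nonneg_left this (norm_nonneg _)
    obtain ⟨K, hK⟩ := (hasCompactSupport_minFun hb).exists_bound_of_continuous
      (lipschitzWith_minFun (c := D) (g := g)).continuous
    refine ⟨_, holderBound_of_lipschitz hα'.le hα.le h1 (B := K * ‖a‖) fun x => ?_⟩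
    rw [norm_smul]
    exact mul_le_mul_of_nonneg_right (hK x) (norm_nonneg _)
  obtain ⟨K, hK⟩ := hholder
  let τ : ℝ := volume.real (posSet D g)
  have hτ : 0 < τ := ENNReal.toReal_pos hreg.volume_ne_zero hreg.volume_ne_top
  have hτe : volume (posSet D g) = ENNReal.ofReal τ :=
    (ENNReal.ofReal_toReal hreg.volume_ne_top).symm
  let e : ℝ := ∑ i ∈ Finset.univ.erase j₀,
    (volume.real (minPiece D g (i, true)) + volume.real (minPiece D g (i, false)))
  have hμe : ∀ k, volume (minPiece D g k) = ENNReal.ofReal (volume.real (minPiece D g k)) :=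
    fun k => (ENNReal.ofReal_toReal (hfin k)).symm
  have he0 : 0 ≤ e := Finset.sum_nonneg fun i _ => by positivity
  have heτ : e ≤ η * τ := by
    have h1 : ∀ i ∈ Finset.univ.erase j₀, volume.real (minPiece D g (i, true)) +
        volume.real (minPiece D g (i, false)) ≤ η * τ / m := by
      intro i hi
      have h2 := hv2 i (Finset.ne_of_mem_erase hi)
      have h3 : c - 1 = m / η := by simp [c]
      rw [h3] at h2
      have hm' : (0 : ℝ) < m := by exact_mod_cast hm
      rw [le_div_iff₀ hm', ← div_le_iff₀' hη]
      calc _ = m / η * (volume.real (minPiece D g (i, true)) +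
        volume.real (minPiece D g (i, false))) := by ring
        _ ≤ _ := h2
    have hm' : (0 : ℝ) < m := by exact_mod_cast hm
    calc e ≤ ∑ _i ∈ Finset.univ.erase j₀, η * τ / m := Finset.sum_le_sum h1
      _ ≤ ∑ _i : Fin m, η * τ / m := Finset.sum_le_sum_of_subset_of_nonneg (Finset.subset_univ _)
          fun i _ _ => by positivity
      _ = η * τ := by
          rw [Finset.sum_const, Finset.card_univ, Fintype.card_fin, nsmul_eq_mul]
          field_simp
  have htot : volume.real (minPiece D g (j₀, true)) + volume.real (minPiece D g (j₀, false)) + e =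
      τ := by
    have h1 := hexp fun _ => 1
    rw [expect_const, mul_one] at h1
    simp only [mul_one] at h1
    have h2 : τ = ∑ k, volume.real (minPiece D g k) := by
      simp only [τ, measureReal_def]
      rw [h1, ENNReal.toReal_sum fun k _ => hfin k]
    rw [h2, sum_split j₀]
  have hq : ∀ x y : ℝ, 0 ≤ x → y * τ = x → ∀ z : ℝ≥0∞, z * volume (posSet D g) = ENNReal.ofReal x →
      z = ENNReal.ofReal y := by
    intro x y hx hxy z hz
    have hy : 0 ≤ y := by
      by_contra h
      push Not at h
      nlinarith
    rw [← hxy, ENNReal.ofReal_mul hy, ← hτe] at hz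
    exact (ENNReal.mul_left_inj hreg.volume_ne_zero hreg.volume_ne_top).1 hz
  have h0e : ∀ i b, i ≠ j₀ → ∀ X : Mat d m, L (i, b) ≠ (X, 0) := fun i b hi X h => by
    have := hLi i b hi
    rw [h] at this
    simp at this
  -- q is the volume fraction of the cut-off pieces. The exact ratio and the total volume determine
  -- the other two: l(τ - e) and (1 - l)(τ - e).
  refine ⟨P, e / τ, by positivity, (div_le_iff₀ hτ).2 heτ,
    hreal.realizable hα hα' hreg hP hmom hK, ?_, ?_, ?_, ?_⟩
  · refine hq (volume.real (minPiece D g (j₀, true))) _ measureReal_nonneg ?_ _ ?_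
    · field_simp
      linear_combination (-l) * htot - hv1
    · rw [hPt, sum_split j₀, Finset.sum_eq_zero, hLt, hLf, ← hμe]
      · simp [hne.symm]
      · intro i hi
        have hi := Finset.ne_of_mem_erase hi
        simp [h0e i true hi, h0e i false hi]
  · refine hq (volume.real (minPiece D g (j₀, false))) _ measureReal_nonneg ?_ _ ?_
    · field_simp
      linear_combination (-(1 - l)) * htot + hv1
    · rw [hPt, sum_split j₀, Finset.sum_eq_zero, hLt, hLf, ← hμe]
      · simp [hne]
      · intro i hi
        have hi := Finset.ne_of_mem_erase hi
        simp [h0e i true hi, h0e i false hi]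
  · intro t ht
    have h1 : ∃ k, L k = t := by
      by_contra h
      push Not at h
      have h2 := hPt t
      rw [Finset.sum_eq_zero fun k _ => Set.indicator_of_notMem
        (Set.mem_singleton_iff.not.2 (h k)) _] at h2
      exact (mul_ne_zero ht hreg.volume_ne_zero) h2
    obtain ⟨⟨i, b⟩, rfl⟩ := h1
    by_cases hi : i = j₀
    · subst hi
      cases b
      · exact Or.inr (Or.inl hLf)
      · exact Or.inl hLt
    · refine Or.inr (Or.inr ⟨hLi i b hi, ?_⟩)
      simp only [L, add_sub_cancel_left, hgdef, splitGrad, if_neg hi]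
      refine (norm_vecMulVec_single_le a i _).trans ?_
      have h2 : |if b = true then s else -s| = s := by
        cases b <;> simp [abs_of_pos hs]
      rw [h2]
      have h3 : ‖Matrix.vecMulVec a (EuclideanSpace.single i (1 : ℝ) : Space m)‖ ≤ N := by
        have := Finset.single_le_sum (f := fun i => ‖Matrix.vecMulVec a
          (EuclideanSpace.single i (1 : ℝ) : Space m)‖) (fun _ _ => norm_nonneg _)
          (Finset.mem_univ i)
        simp only [N]
        linarith
      calc _ ≤ s * N := mul_le_mul_of_nonneg_left h3 hs.le
        _ = η := div_mul_cancel₀ _ hN.ne'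
  · refine hq e _ he0 (div_mul_cancel₀ _ hτ.ne') _ ?_
    rw [mul_comm, hexp, sum_split j₀, hLt, hLf]
    simp only [zero_ne_one, if_false, mul_zero, add_zero, zero_add]
    rw [ENNReal.ofReal_sum_of_nonneg fun i _ => by positivity]
    refine Finset.sum_congr rfl fun i hi => ?_
    have hi := Finset.ne_of_mem_erase hi
    rw [hLi i _ hi, ENNReal.ofReal_add measureReal_nonneg measureReal_nonneg,
      ← hμe, ← hμe]
    simp

end RankOne

/-! ### Infinitely many refinements -/

theorem measurable_enorm_mat {d m : ℕ} : Measurable fun X : Mat d m => ‖X‖ₑ := by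
  have h : Continuous fun X : Mat d m => ‖X‖ := continuous_norm
  simpa only [ofReal_norm] using h.measurable.ennreal_ofReal

theorem exists_seq_of_step {X : Type*} {Inv : ℕ → X → Prop} {Rel : ℕ → X → X → Prop} {x₀ : X}
    (h₀ : Inv 0 x₀) (hs : ∀ n x, Inv n x → ∃ y, Inv (n + 1) y ∧ Rel n x y) :
    ∃ f : ℕ → X, f 0 = x₀ ∧ (∀ n, Inv n (f n)) ∧ ∀ n, Rel n (f n) (f (n + 1)) := by
  have : Nonempty X := ⟨x₀⟩
  choose! g hg using hs
  let f : ℕ → X := fun n => Nat.rec x₀ (fun n x => g n x) n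
  have hf : ∀ n, Inv n (f n) := fun n => by
    induction n with
    | zero => exact h₀
    | succ n ih => exact (hg n (f n) ih).1
  exact ⟨f, rfl, hf, fun n => (hg n (f n) (hf n)).2⟩

section Limit

variable {d m : ℕ} {Ω : Set (Space m)} {S : Set (Set (Space m) × Label d m)} {A : Mat d m}
  {w : Space m → Space d} {α : ℝ}

/-- `f` on active labels, `0` on the others. -/
def onActive (f : Label d m → ℝ≥0∞) (s : Label d m) : ℝ≥0∞ := if s.2 = 2 then f s else 0

/-- Pieces that are not active survive as the same sets with the same values of the map. Iterating
thus gives an increasing family of finished pieces, out of which the limit is built. -/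
theorem IsRealization.exists_refine_active {p : PMF (Label d m)}
    {κ : Label d m → PMF (Label d m)} (hΩ : IsRegularDomain Ω) (hα : 0 < α)
    (hS : IsRealization Ω A S w)
    (hp : HasDist Ω S p) (hm : moment p ≠ ⊤) (hm' : moment (p.bind κ) ≠ ⊤)
    (hdone : ∀ s, s.2 ≠ 2 → κ s = PMF.pure s)
    (hκ : ∀ s, p s ≠ 0 → s.2 = 2 → Realizable α s.1 (κ s)) {δ : ℝ} (hδ : 0 < δ) :
    ∃ S' w', IsRealization Ω A S' w' ∧ HasDist Ω S' (p.bind κ) ∧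
      HolderBound α δ (fun x => w' x - w x) ∧
      ∀ v ∈ S, v.2.2 ≠ 2 → v ∈ S' ∧ ∀ x ∈ v.1, w' x = w x := by
  have hex : ∀ v : Set (Space m) × Label d m, ∃ Sf wf, v ∈ S → IsRealization v.1 v.2.1 Sf wf ∧
      HasDist v.1 Sf (κ v.2) ∧ HolderBound α (δ / 2) wf ∧ (v.2.2 ≠ 2 → v ∈ Sf ∧ ∀ x, wf x = 0) := by
    intro v
    by_cases hv : v ∈ S
    · by_cases hv2 : v.2.2 = 2
      · obtain ⟨Sf, wf, h1, h2, h3⟩ := hκ v.2 (hp.apply_ne_zero hv (hS.regular v hv)) hv2 v.1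
          (hS.regular v hv) (δ / 2) (by positivity)
        exact ⟨Sf, wf, fun _ => ⟨h1, h2, h3, fun h => absurd hv2 h⟩⟩
      · refine ⟨{v}, fun _ => 0, fun _ => ⟨isRealization_singleton (hS.regular v hv) v.2, ?_,
          HolderBound.zero (by positivity), fun _ => ⟨rfl, fun _ => rfl⟩⟩⟩
        rw [hdone v.2 hv2]
        exact hasDist_singleton v.2
    · exact ⟨∅, 0, fun h => absurd h hv⟩
  choose Sf wf hf using hex
  obtain ⟨h1, h2⟩ := hS.refine hΩ hα hp hm hm' (fun v hv => (hf v hv).1)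
    (fun v hv => (hf v hv).2.1) (by positivity) fun v hv => (hf v hv).2.2.1
  refine ⟨_, _, h1, HasDist.refine hS.toIsPartition (fun v hv => (hf v hv).1.toIsPartition) hp
    fun v hv => (hf v hv).2.1, ?_, fun v hv hv2 => ⟨?_, fun x hx => ?_⟩⟩
  · simpa using h2.mono (by linarith : 2 * (δ / 2) ≤ δ)
  · exact Set.mem_iUnion₂.2 ⟨v, hv, ((hf v hv).2.2.2 hv2).1⟩
  · rw [tsum_eq_of_disjoint (pairwise_disjoint_coe hS.disjoint) (f := fun (u : S) x => wf u x)
      (fun u x hx => (hf u.1 u.2).1.eq_zero x hx) (i := ⟨v, hv⟩) hx,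
      ((hf v hv).2.2.2 hv2).2 x, add_zero]

/-- The part of a labelled family that is not active. -/
def donePart (S : Set (Set (Space m) × Label d m)) : Set (Set (Space m) × Label d m) :=
  {v ∈ S | v.2.2 ≠ 2}

theorem lintegral_pieceGrad_active_le {p : PMF (Label d m)} (hS : IsPartition Ω S)
    (hp : HasDist Ω S p) (A : Mat d m) :
    ∫⁻ x in Ω \ ⋃ v ∈ donePart S, v.1, ‖pieceGrad S A x‖ₑ ≤
      volume Ω * expect p (onActive fun s => ‖s.1 - A‖ₑ) := by
  let T := {v ∈ S | v.2.2 = 2}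
  have hT : T ⊆ S := fun v hv => hv.1
  have hmeas : MeasurableSet (⋃ v ∈ donePart S, v.1) :=
    MeasurableSet.biUnion (hS.countable.mono fun v hv => hv.1)
      fun v hv => (hS.regular v hv.1).isOpen.measurableSet
  have hle : ∫⁻ x in Ω \ ⋃ v ∈ donePart S, v.1, ‖pieceGrad S A x‖ₑ ≤
      ∫⁻ x, ‖pieceGrad T A x‖ₑ := by
    calc _ ≤ ∫⁻ x in (⋃ v ∈ donePart S, v.1)ᶜ, ‖pieceGrad S A x‖ₑ :=
          lintegral_mono_set fun x hx => hx.2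
      _ = ∫⁻ x, ((⋃ v ∈ donePart S, v.1)ᶜ).indicator (fun x => ‖pieceGrad S A x‖ₑ) x :=
          (lintegral_indicator hmeas.compl _).symm
      _ ≤ _ := by
          refine lintegral_mono fun x => ?_
          by_cases hx : x ∈ ⋃ v ∈ donePart S, v.1
          · rw [Set.indicator_of_notMem (by simpa using hx)]
            exact zero_le
          · rw [Set.indicator_of_mem hx]
            by_cases h : ∃ v ∈ S, x ∈ v.1
            · obtain ⟨v, hv, hxv⟩ := h
              have hv2 : v.2.2 = 2 := by
                by_contra h2
                exact hx (Set.mem_iUnion₂.2 ⟨v, ⟨hv, h2⟩, hxv⟩)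
              rw [pieceGrad_eq hS.disjoint hv hxv,
                pieceGrad_eq (hS.disjoint.subset hT) (⟨hv, hv2⟩ : v ∈ T) hxv]
            · push Not at h
              rw [pieceGrad_eq_zero h, pieceGrad_eq_zero fun v hv => h v (hT hv)]
  refine hle.trans (le_of_eq ?_)
  rw [lintegral_pieceGrad (hS.countable.mono hT) (hS.disjoint.subset hT)
    fun v hv => (hS.regular v (hT hv)).isOpen, ← hp.tsum_mul,
    tsum_subtype T fun v => volume v.1 * ‖v.2.1 - A‖ₑ,
    tsum_subtype S fun v => volume v.1 * onActive (fun s => ‖s.1 - A‖ₑ) v.2]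
  refine tsum_congr fun v => ?_
  by_cases hv : v ∈ S
  · by_cases hv2 : v.2.2 = 2
    · have hvT : v ∈ T := ⟨hv, hv2⟩
      rw [Set.indicator_of_mem hvT, Set.indicator_of_mem hv, onActive, if_pos hv2]
    · rw [Set.indicator_of_notMem fun h : v ∈ T => hv2 h.2, Set.indicator_of_mem hv, onActive,
        if_neg hv2, mul_zero]
  · rw [Set.indicator_of_notMem fun h : v ∈ T => hv h.1, Set.indicator_of_notMem hv]

theorem volume_diff_donePart_le {p : PMF (Label d m)} (hS : IsPartition Ω S)
    (hp : HasDist Ω S p) :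
    volume (Ω \ ⋃ v ∈ donePart S, v.1) ≤ volume Ω * expect p (onActive fun _ => 1) := by
  let T := {v ∈ S | v.2.2 = 2}
  have hT : T ⊆ S := fun v hv => hv.1
  calc _ ≤ volume (⋃ v ∈ T, v.1) := by
        refine measure_mono_ae ?_
        filter_upwards [hS.ae_mem] with x hx hx2
        obtain ⟨v, hv, hxv⟩ := hx hx2.1
        refine Set.mem_iUnion₂.2 ⟨v, ⟨hv, ?_⟩, hxv⟩
        by_contra h2
        exact hx2.2 (Set.mem_iUnion₂.2 ⟨v, ⟨hv, h2⟩, hxv⟩)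
    _ ≤ ∑' v : T, volume v.1.1 := measure_biUnion_le _ (hS.countable.mono hT) _
    _ = _ := by
        rw [← hp.tsum_mul, tsum_subtype T fun v => volume v.1,
          tsum_subtype S fun v => volume v.1 * onActive (fun _ => 1) v.2]
        refine tsum_congr fun v => ?_
        by_cases hv : v ∈ S
        · by_cases hv2 : v.2.2 = 2
          · have hvT : v ∈ T := ⟨hv, hv2⟩
            rw [Set.indicator_of_mem hvT, Set.indicator_of_mem hv, onActive, if_pos hv2, mul_one]
          · rw [Set.indicator_of_notMem fun h : v ∈ T => hv2 h.2, Set.indicator_of_mem hv,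
              onActive, if_neg hv2, mul_zero]
        · rw [Set.indicator_of_notMem fun h : v ∈ T => hv h.1, Set.indicator_of_notMem hv]

/-- A Markov chain on labels in which only active labels (tag `2`) move. -/
structure IsChain (A : Mat d m) (p : ℕ → PMF (Label d m))
    (κ : ℕ → Label d m → PMF (Label d m)) : Prop where
  zero : p 0 = PMF.pure (A, 2)
  succ : ∀ n, p (n + 1) = (p n).bind (κ n)
  done : ∀ n s, s.2 ≠ 2 → κ n s = PMF.pure s

/-- `q` is the distribution of the label at which the chain comes to rest. -/
structure IsLimitDist (p : ℕ → PMF (Label d m)) (q : PMF (Label d m)) : Prop where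
  done : ∀ s, s.2 ≠ 2 → q s = ⨆ n, p n s
  active : ∀ s, s.2 = 2 → q s = 0

variable {p : ℕ → PMF (Label d m)} {κ : ℕ → Label d m → PMF (Label d m)} {q : PMF (Label d m)}

theorem IsChain.monotone (h : IsChain A p κ) {s : Label d m} (hs : s.2 ≠ 2) :
    Monotone fun n => p n s :=
  monotone_nat_of_le_succ fun n => by
    rw [h.succ, PMF.bind_apply]
    calc p n s = p n s * κ n s s := by rw [h.done n s hs, PMF.pure_apply_self, mul_one]
      _ ≤ _ := ENNReal.le_tsum s

/-- The weight whose decay makes a chain come to rest. -/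
def activeMoment (p : PMF (Label d m)) : ℝ≥0∞ := expect p (onActive fun s => 1 + ‖s.1‖ₑ)

theorem expect_onActive_one_le (p : PMF (Label d m)) :
    expect p (onActive fun _ => 1) ≤ activeMoment p :=
  expect_mono fun s _ => by
    unfold onActive
    split_ifs
    · exact le_self_add
    · exact le_rfl

theorem expect_onActive_norm_sub_le (p : PMF (Label d m)) (A : Mat d m) :
    expect p (onActive fun s => ‖s.1 - A‖ₑ) ≤ activeMoment p * (1 + ‖A‖ₑ) := by
  rw [activeMoment, ← expect_mul_const]
  refine expect_mono fun s _ => ?_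
  unfold onActive
  split_ifs
  · calc ‖s.1 - A‖ₑ ≤ ‖s.1‖ₑ + ‖A‖ₑ := enorm_sub_le
      _ ≤ (1 + ‖s.1‖ₑ) + (1 + ‖s.1‖ₑ) * ‖A‖ₑ := by
          gcongr
          · exact le_add_self
          · exact le_mul_of_one_le_left' le_self_add
      _ = _ := by ring
  · exact zero_le

/-- `f` on labels that are not active, `0` on the others. -/
def onDone (f : Label d m → ℝ≥0∞) (s : Label d m) : ℝ≥0∞ := if s.2 = 2 then 0 else f s

theorem onActive_add_onDone (f : Label d m → ℝ≥0∞) (s : Label d m) :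
    onActive f s + onDone f s = f s := by
  unfold onActive onDone
  split_ifs <;> simp

theorem IsChain.mul_onDone_monotone (h : IsChain A p κ) (f : Label d m → ℝ≥0∞) :
    Monotone fun n s => p n s * onDone f s := by
  intro k n hkn s
  by_cases hs : s.2 = 2
  · simp [onDone, hs]
  · dsimp only
    gcongr
    exact h.monotone hs hkn

theorem IsChain.expect_onDone_monotone (h : IsChain A p κ) (f : Label d m → ℝ≥0∞) :
    Monotone fun n => expect (p n) (onDone f) :=
  fun _ _ hkn => ENNReal.tsum_le_tsum (h.mul_onDone_monotone f hkn)

/-- Mass at rest never moves again, so it increases with n and monotone convergence applies. -/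
theorem IsChain.expect_limit (h : IsChain A p κ) (hq : IsLimitDist p q) (f : Label d m → ℝ≥0∞) :
    expect q f = ⨆ n, expect (p n) (onDone f) := by
  unfold expect
  rw [← tsum_iSup_of_monotone (h.mul_onDone_monotone f)]
  refine tsum_congr fun s => ?_
  by_cases hs : s.2 = 2
  · simp [onDone, hs, hq.active s hs]
  · simp only [onDone, hs, if_false]
    rw [hq.done s hs, ENNReal.iSup_mul]

theorem IsChain.moment_le (h : IsChain A p κ) (hq : IsLimitDist p q) (n : ℕ) :
    moment (p n) ≤ activeMoment (p n) + moment q := by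
  rw [moment, moment, h.expect_limit hq, activeMoment]
  calc (expect (p n) fun s => ‖s.1‖ₑ) =
        expect (p n) (onActive fun s => ‖s.1‖ₑ) + expect (p n) (onDone fun s => ‖s.1‖ₑ) := by
        rw [← expect_add]
        simp only [onActive_add_onDone]
    _ ≤ _ := by
        gcongr
        · refine expect_mono fun s _ => ?_
          unfold onActive
          split_ifs
          · exact le_add_self
          · exact le_rfl
        · exact le_iSup (fun n => expect (p n) (onDone fun s => ‖s.1‖ₑ)) n

/-- The active mass tends to 0, so the increasing masses at rest have total 1 in the limit. -/
theorem IsChain.exists_limit (h : IsChain A p κ)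
    (hact : Tendsto (fun n => activeMoment (p n)) atTop (𝓝 0)) : ∃ q, IsLimitDist p q := by
  have h1 : Tendsto (fun n => expect (p n) (onActive fun _ => 1)) atTop (𝓝 0) :=
    tendsto_of_tendsto_of_tendsto_of_le_of_le tendsto_const_nhds hact (fun _ => zero_le)
      fun n => expect_onActive_one_le (p n)
  have h2 : ∀ n, expect (p n) (onActive fun _ => 1) + expect (p n) (onDone fun _ => 1) = 1 := by
    intro n
    rw [← expect_add]
    simp only [onActive_add_onDone, expect_const]
  have h3 := tendsto_atTop_iSup (h.expect_onDone_monotone fun _ => 1)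
  have h4 : ⨆ n, expect (p n) (onDone fun _ => 1) = 1 := by
    have h5 := h1.add h3
    simp only [h2, zero_add] at h5
    exact (tendsto_nhds_unique tendsto_const_nhds h5).symm
  have h6 : ∑' s, ⨆ n, p n s * onDone (fun _ => 1) s = 1 := by
    rw [tsum_iSup_of_monotone (h.mul_onDone_monotone _)]
    exact h4
  refine ⟨⟨fun s => ⨆ n, p n s * onDone (fun _ => 1) s, ?_⟩, fun s hs => ?_, fun s hs => ?_⟩
  · have h7 := (ENNReal.summable (f := fun s => ⨆ n, p n s * onDone (fun _ => 1) s)).hasSum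
    rwa [h6] at h7
  · change (⨆ n, p n s * onDone (fun _ => 1) s) = _
    simp [onDone, hs]
  · change (⨆ n, p n s * onDone (fun _ => 1) s) = _
    simp [onDone, hs]

/-- The finished pieces of all stages form the limit partition, which covers Ω up to a null set
because the active volume tends to 0. The maps converge in the Hölder norm by the choice of summable
perturbations, and their gradients converge in L¹ because the active first moment tends to 0. -/
theorem IsChain.realizable_limit (hα : 0 < α) (h : IsChain A p κ)
    (hκ : ∀ n s, p n s ≠ 0 → s.2 = 2 → Realizable α s.1 (κ n s))
    (hmom : ∀ n, moment (p n) ≠ ⊤) (hact : Tendsto (fun n => activeMoment (p n)) atTop (𝓝 0))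
    (hq : IsLimitDist p q) (hqm : moment q ≠ ⊤) : Realizable α A q := by
  intro Ω hΩ δ hδ
  obtain ⟨f, hf0, hfI, hfR⟩ := exists_seq_of_step
    (X := Set (Set (Space m) × Label d m) × (Space m → Space d))
    (Inv := fun n x => IsRealization Ω A x.1 x.2 ∧ HasDist Ω x.1 (p n))
    (Rel := fun n x y => HolderBound α (δ / 2 ^ (n + 1)) (fun z => y.2 z - x.2 z) ∧
      ∀ v ∈ x.1, v.2.2 ≠ 2 → v ∈ y.1 ∧ ∀ z ∈ v.1, y.2 z = x.2 z)
    (x₀ := ({(Ω, (A, 2))}, fun _ => 0))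
    (by
      rw [h.zero]
      exact ⟨isRealization_singleton hΩ (A, 2), hasDist_singleton _⟩)
    (fun n x hx => by
      have h1 := hmom (n + 1)
      rw [h.succ] at h1
      obtain ⟨S', w', h2, h3, h4, h5⟩ := hx.1.exists_refine_active hΩ hα hx.2 (hmom n) h1
        (h.done n) (hκ n) (δ := δ / 2 ^ (n + 1)) (by positivity)
      refine ⟨(S', w'), ⟨h2, ?_⟩, h4, h5⟩
      rw [h.succ]
      exact h3)
  let S : ℕ → Set (Set (Space m) × Label d m) := fun n => (f n).1
  let w : ℕ → Space m → Space d := fun n => (f n).2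
  have hS : ∀ n, IsRealization Ω A (S n) (w n) := fun n => (hfI n).1
  have hp : ∀ n, HasDist Ω (S n) (p n) := fun n => (hfI n).2
  have hmono : Monotone fun n => donePart (S n) := monotone_nat_of_le_succ fun n v hv =>
    ⟨((hfR n).2 v hv.1 hv.2).1, hv.2⟩
  obtain ⟨w', hw'⟩ := HolderBound.exists_limit (α := α) (δ := δ) (w := w) fun n => (hfR n).1
  have hw0 : ∀ x, w 0 x = 0 := fun x => by simp [w, hf0]
  have hw'δ : HolderBound α δ w' := by
    have := hw' 0
    simpa [hw0] using this
  have hlim : ∀ n, ∀ v ∈ donePart (S n), ∀ x ∈ v.1, w' x = w n x := by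
    intro n v hv x hx
    have h1 : ∀ k, w (n + k) x = w n x := fun k => by
      induction k with
      | zero => rfl
      | succ k ih =>
        have hvk : v ∈ donePart (S (n + k)) := hmono (Nat.le_add_right n k) hv
        rw [← ih]
        exact ((hfR (n + k)).2 v hvk.1 hvk.2).2 x hx
    have h2 : Tendsto (fun k => ‖w' x - w (n + k) x‖) atTop (𝓝 0) := by
      refine squeeze_zero (fun _ => norm_nonneg _) (fun k => (hw' (n + k)).norm_le x) ?_
      have h3 : Tendsto (fun k : ℕ => δ / 2 ^ k) atTop (𝓝 0) := by
        have := (tendsto_pow_atTop_nhds_zero_of_lt_one (r := (1 / 2 : ℝ)) (by norm_num)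
          (by norm_num)).const_mul δ
        simpa [div_eq_mul_inv] using this
      exact h3.comp (tendsto_add_atTop_nat n |>.congr fun k => by rw [add_comm])
    simp only [h1] at h2
    have h4 := tendsto_nhds_unique h2 tendsto_const_nhds
    exact sub_eq_zero.1 (norm_eq_zero.1 h4.symm)
  -- Finished pieces only accumulate, so any two members of T already belong to a common stage,
  -- where they are disjoint.
  let T : Set (Set (Space m) × Label d m) := ⋃ n, donePart (S n)
  have hT : ∀ n, donePart (S n) ⊆ T := fun n => Set.subset_iUnion (fun n => donePart (S n)) n
  have hvol : Tendsto (fun n => volume (Ω \ ⋃ v ∈ donePart (S n), v.1)) atTop (𝓝 0) := by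
    refine tendsto_of_tendsto_of_tendsto_of_le_of_le tendsto_const_nhds
      (h := fun n => volume Ω * activeMoment (p n)) ?_ (fun _ => zero_le) fun n => ?_
    · simpa using ENNReal.Tendsto.const_mul hact (Or.inr hΩ.volume_ne_top)
    · exact (volume_diff_donePart_le (hS n).toIsPartition (hp n)).trans
        (mul_le_mul_right (expect_onActive_one_le _) _)
  have hpart : IsPartition Ω T := by
    refine ⟨Set.countable_iUnion fun n => (hS n).countable.mono fun v hv => hv.1, ?_, ?_, ?_, ?_⟩
    · intro u hu v hv huv
      obtain ⟨k, hk⟩ := Set.mem_iUnion.1 hu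
      obtain ⟨l, hl⟩ := Set.mem_iUnion.1 hv
      exact (hS (max k l)).disjoint (hmono (le_max_left k l) hk).1
        (hmono (le_max_right k l) hl).1 huv
    · intro v hv
      obtain ⟨k, hk⟩ := Set.mem_iUnion.1 hv
      exact (hS k).regular v hk.1
    · intro v hv
      obtain ⟨k, hk⟩ := Set.mem_iUnion.1 hv
      exact (hS k).subset v hk.1
    · refine le_antisymm (ge_of_tendsto' hvol fun n => measure_mono ?_) zero_le
      exact Set.sdiff_subset_sdiff_right (Set.biUnion_subset_biUnion_left (hT n))
  have hdist : HasDist Ω T q := by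
    intro t
    rw [tsum_subtype T fun v => ({t} : Set (Label d m)).indicator (fun _ => volume v.1) v.2]
    by_cases ht : t.2 = 2
    · rw [hq.active t ht, zero_mul, ENNReal.tsum_eq_zero]
      intro v
      by_cases hv : v ∈ T
      · obtain ⟨k, hk⟩ := Set.mem_iUnion.1 hv
        rw [Set.indicator_of_mem hv, Set.indicator_of_notMem]
        rintro rfl
        exact hk.2 ht
      · exact Set.indicator_of_notMem hv _
    · rw [hq.done t ht, ENNReal.iSup_mul]
      have h1 : ∀ v, T.indicator (fun v => ({t} : Set (Label d m)).indicator
          (fun _ => volume v.1) v.2) v = ⨆ n, (donePart (S n)).indicator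
            (fun v => ({t} : Set (Label d m)).indicator (fun _ => volume v.1) v.2) v := by
        intro v
        by_cases hv : v ∈ T
        · obtain ⟨k, hk⟩ := Set.mem_iUnion.1 hv
          refine le_antisymm ?_ (iSup_le fun n => ?_)
          · refine le_iSup_of_le k ?_
            rw [Set.indicator_of_mem hv, Set.indicator_of_mem hk]
          · exact Set.indicator_le_indicator_of_subset (hT n) (fun _ => zero_le) v
        · rw [Set.indicator_of_notMem hv]
          symm
          rw [ENNReal.iSup_eq_zero]
          exact fun n => Set.indicator_of_notMem (fun h => hv (hT n h)) _
      simp_rw [h1]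
      rw [tsum_iSup_of_monotone fun k l hkl v => Set.indicator_le_indicator_of_subset (hmono hkl)
        (fun _ => zero_le) v]
      congr 1
      ext n
      rw [← hp n t,
        tsum_subtype (S n) fun v => ({t} : Set (Label d m)).indicator (fun _ => volume v.1) v.2]
      refine tsum_congr fun v => ?_
      by_cases hv : v ∈ S n
      · by_cases hv2 : v.2 = t
        · have hvD : v ∈ donePart (S n) := ⟨hv, hv2 ▸ ht⟩
          rw [Set.indicator_of_mem hv, Set.indicator_of_mem hvD]
        · rw [Set.indicator_of_mem hv]
          have : ({t} : Set (Label d m)).indicator (fun _ => volume v.1) v.2 = 0 :=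
            Set.indicator_of_notMem (Set.mem_singleton_iff.not.2 hv2) _
          rw [this]
          exact Set.indicator_apply_eq_zero.2 fun _ => this
      · rw [Set.indicator_of_notMem hv, Set.indicator_of_notMem fun h : v ∈ donePart (S n) => hv h.1]
  refine ⟨T, w', ⟨hpart, ?_, hw'δ.continuous hα, ?_, ?_⟩, hdist, hw'δ⟩
  · intro v hv
    obtain ⟨k, hk⟩ := Set.mem_iUnion.1 hv
    obtain ⟨b, hb⟩ := (hS k).affine v hk.1
    exact ⟨b, fun x hx => by rw [hlim k v hk x hx, hb x hx]⟩
  · intro x hx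
    have h2 : Tendsto (fun k => ‖w' x - w k x‖) atTop (𝓝 0) := by
      refine squeeze_zero (fun _ => norm_nonneg _) (fun k => (hw' k).norm_le x) ?_
      have := (tendsto_pow_atTop_nhds_zero_of_lt_one (r := (1 / 2 : ℝ)) (by norm_num)
          (by norm_num)).const_mul δ
      simpa [div_eq_mul_inv] using this
    simp only [fun k => (hS k).eq_zero x hx, sub_zero] at h2
    exact norm_eq_zero.1 (tendsto_nhds_unique h2 tendsto_const_nhds).symm
  · intro i j
    have hε : Tendsto (fun k : ℕ => δ / 2 ^ k) atTop (𝓝 0) := by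
      have := (tendsto_pow_atTop_nhds_zero_of_lt_one (r := (1 / 2 : ℝ)) (by norm_num)
          (by norm_num)).const_mul δ
      simpa [div_eq_mul_inv] using this
    have hci : Continuous fun y : Space d => y i := (EuclideanSpace.proj (𝕜 := ℝ) i).continuous
    refine HasWeakDeriv.of_tendsto (fun n => (hS n).weak i j) (fun n => hci.comp (hS n).continuous)
      (hci.comp (hw'δ.continuous hα)) hε (fun n x => ?_)
      (hpart.integrable_pieceGrad hΩ hdist hqm A i j) ?_
    · have h1 := (PiLp.norm_apply_le (w' x - w n x) i).trans ((hw' n).norm_le x)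
      rw [PiLp.sub_apply, Real.norm_eq_abs, abs_sub_comm] at h1
      exact h1
    · have hfin : ∫⁻ x, ‖pieceGrad T A x‖ₑ ≠ ⊤ := by
        rw [hpart.lintegral_pieceGrad hdist]
        exact ENNReal.mul_ne_top hΩ.volume_ne_top (ne_top_of_le_ne_top
          (ENNReal.add_ne_top.2 ⟨hqm, enorm_ne_top⟩) (expect_norm_sub_le q A))
      have t1 := tendsto_setLIntegral_zero hfin hvol
      have t2 : Tendsto (fun n => volume Ω * (activeMoment (p n) * (1 + ‖A‖ₑ))) atTop (𝓝 0) := by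
        have hA : (1 : ℝ≥0∞) + ‖A‖ₑ ≠ ⊤ := ENNReal.add_ne_top.2 ⟨ENNReal.one_ne_top, enorm_ne_top⟩
        have := ENNReal.Tendsto.const_mul (a := volume Ω)
          (ENNReal.Tendsto.mul_const hact (Or.inr hA)) (Or.inr hΩ.volume_ne_top)
        simpa using this
      refine tendsto_of_tendsto_of_tendsto_of_le_of_le tendsto_const_nhds
        (by simpa using t2.add t1) (fun _ => zero_le) fun n => ?_
      have hmeas : MeasurableSet (Ω \ ⋃ v ∈ donePart (S n), v.1) :=
        hΩ.isOpen.measurableSet.diff (MeasurableSet.biUnion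
          ((hS n).countable.mono fun v hv => hv.1)
          fun v hv => ((hS n).regular v hv.1).isOpen.measurableSet)
      have hM := measurable_pieceGrad (A := A) (hS n).countable (hS n).disjoint
        fun v hv => ((hS n).regular v hv).isOpen
      -- The two fields agree on the finished pieces. On the rest the stage n gradient is controlled
      -- by the active moment, and the limit gradient by absolute continuity of its integral.
      calc ∫⁻ x, ‖pieceGrad (S n) A x i j - pieceGrad T A x i j‖ₑ
          ≤ ∫⁻ x, (Ω \ ⋃ v ∈ donePart (S n), v.1).indicator
              (fun x => ‖pieceGrad (S n) A x‖ₑ + ‖pieceGrad T A x‖ₑ) x := by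
            refine lintegral_mono fun x => ?_
            by_cases hx : x ∈ Ω
            · by_cases hxU : ∃ v ∈ donePart (S n), x ∈ v.1
              · obtain ⟨v, hv, hxv⟩ := hxU
                rw [pieceGrad_eq (hS n).disjoint hv.1 hxv, pieceGrad_eq hpart.disjoint (hT n hv) hxv]
                simp
              · have hxD : x ∈ Ω \ ⋃ v ∈ donePart (S n), v.1 := by
                  refine ⟨hx, fun h => hxU ?_⟩
                  obtain ⟨v, hv, hxv⟩ := Set.mem_iUnion₂.1 h
                  exact ⟨v, hv, hxv⟩
                rw [Set.indicator_of_mem hxD]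
                refine enorm_sub_le.trans ?_
                exact add_le_add (enorm_entry_le _ i j) (enorm_entry_le _ i j)
            · rw [pieceGrad_eq_zero fun v hv h => hx ((hS n).subset v hv h),
                pieceGrad_eq_zero fun v hv h => hx (hpart.subset v hv h)]
              simp
        _ = (∫⁻ x in Ω \ ⋃ v ∈ donePart (S n), v.1, ‖pieceGrad (S n) A x‖ₑ) +
            ∫⁻ x in Ω \ ⋃ v ∈ donePart (S n), v.1, ‖pieceGrad T A x‖ₑ := by
            rw [lintegral_indicator hmeas]
            exact lintegral_add_left (measurable_enorm_mat.comp hM) _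
        _ ≤ _ := by
            gcongr
            refine (lintegral_pieceGrad_active_le (hS n).toIsPartition (hp n) A).trans ?_
            gcongr
            exact expect_onActive_norm_sub_le _ _

end Limit

/-! ### Approximate realizations -/

section Approx

variable {d m : ℕ} {c : Mat d m → ℝ≥0∞} {η η₁ η₂ : ℝ≥0∞} {P p q : PMF (Label d m)} {A : Mat d m}
  {α : ℝ}

/-- The weight `c` on error labels (tag `1`), `0` on the others. -/
def onError (c : Mat d m → ℝ≥0∞) (s : Label d m) : ℝ≥0∞ := if s.2 = 1 then c s.1 else 0

/-- `P` agrees with `p` up to a relative error `η`, and the error labels of `P` have weight at most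
`η`. -/
structure Approx (c : Mat d m → ℝ≥0∞) (η : ℝ≥0∞) (P p : PMF (Label d m)) : Prop where
  le : ∀ s, s.2 ≠ 1 → P s ≤ p s
  ge : ∀ s, s.2 ≠ 1 → p s ≤ P s + η * p s
  error_le : expect P (onError c) ≤ η
  error_eq_zero : ∀ s, s.2 = 1 → p s = 0

theorem Approx.mono (h : Approx c η₁ P p) (hη : η₁ ≤ η₂) : Approx c η₂ P p where
  le := h.le
  ge s hs := (h.ge s hs).trans (by gcongr)
  error_le := h.error_le.trans hη
  error_eq_zero := h.error_eq_zero

theorem Approx.refl (hp : ∀ s, s.2 = 1 → p s = 0) : Approx c η p p where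
  le _ _ := le_rfl
  ge _ _ := le_self_add
  error_le := by
    refine le_of_eq_of_le ?_ zero_le
    refine ENNReal.tsum_eq_zero.2 fun s => ?_
    by_cases hs : s.2 = 1
    · simp [hp s hs]
    · simp [onError, hs]
  error_eq_zero := hp

theorem Approx.expect_le (h : Approx c η P p) (f : Label d m → ℝ≥0∞) :
    expect P f ≤ expect p f + expect P fun s => if s.2 = 1 then f s else 0 := by
  unfold expect
  rw [← ENNReal.tsum_add]
  refine ENNReal.tsum_le_tsum fun s => ?_
  by_cases hs : s.2 = 1
  · simp [hs]
  · simp only [hs, if_false, mul_zero, add_zero]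
    gcongr
    exact h.le s hs

/-- The weight dominates the norm, so the errors add at most η to the first moment. -/
theorem Approx.moment_le (h : Approx c η P p) (hc : ∀ X, 1 + ‖X‖ₑ ≤ c X) :
    moment P ≤ moment p + η := by
  refine (h.expect_le _).trans (add_le_add le_rfl (le_trans (expect_mono fun s _ => ?_) h.error_le))
  unfold onError
  split_ifs
  · exact le_add_self.trans (hc s.1)
  · exact le_rfl

/-- Errors of the first step stay where they are and keep their weight, and the second step adds at
most η₂ of new weight. The relative losses add up because a mass lost in the first step is not lost
again. -/
theorem Approx.bind {κ k : Label d m → PMF (Label d m)} (h : Approx c η₁ P p)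
    (hκ : ∀ s, s.2 = 1 → κ s = PMF.pure s)
    (hk : ∀ s, p s ≠ 0 → Approx c η₂ (κ s) (k s)) :
    Approx c (η₁ + η₂) (P.bind κ) (p.bind k) where
  le t ht := by
    simp only [PMF.bind_apply]
    refine ENNReal.tsum_le_tsum fun s => ?_
    by_cases hs : s.2 = 1
    · have hts : t ≠ s := fun h => ht (h ▸ hs)
      simp [hκ s hs, PMF.pure_apply_of_ne _ _ hts]
    · by_cases hps : p s = 0
      · have := h.le s hs
        rw [hps] at this
        simp [le_zero_iff.1 this]
      · exact mul_le_mul' (h.le s hs) ((hk s hps).le t ht)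
  ge t ht := by
    simp only [PMF.bind_apply]
    rw [← ENNReal.tsum_mul_left, ← ENNReal.tsum_add]
    refine ENNReal.tsum_le_tsum fun s => ?_
    by_cases hps : p s = 0
    · simp [hps]
    · have hs : s.2 ≠ 1 := fun hs => hps (h.error_eq_zero s hs)
      calc p s * k s t ≤ (P s + η₁ * p s) * k s t := by gcongr; exact h.ge s hs
        _ = P s * k s t + η₁ * p s * k s t := add_mul _ _ _
        _ ≤ P s * (κ s t + η₂ * k s t) + η₁ * p s * k s t := by
            gcongr
            exact (hk s hps).ge t ht
        _ = P s * κ s t + (P s * (η₂ * k s t) + η₁ * p s * k s t) := by ring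
        _ ≤ P s * κ s t + (p s * (η₂ * k s t) + η₁ * p s * k s t) := by
            gcongr
            exact h.le s hs
        _ = _ := by ring
  error_le := by
    rw [expect_bind]
    calc _ ≤ expect P fun s => onError c s + η₂ := by
          refine expect_mono fun s hPs => ?_
          by_cases hs : s.2 = 1
          · rw [hκ s hs, expect_pure]
            exact le_self_add
          · have hps : p s ≠ 0 := fun h0 => hPs (le_zero_iff.1 (h0 ▸ h.le s hs))
            exact (hk s hps).error_le.trans le_add_self
      _ ≤ _ := by
          rw [expect_add, expect_const]
          gcongr
          exact h.error_le
  error_eq_zero t ht := by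
    rw [PMF.bind_apply]
    refine ENNReal.tsum_eq_zero.2 fun s => ?_
    by_cases hps : p s = 0
    · simp [hps]
    · simp [(hk s hps).error_eq_zero t ht]

/-- `p` can be approximated arbitrarily well by realizable distributions. -/
def ApproxRealizable (α : ℝ) (c : Mat d m → ℝ≥0∞) (A : Mat d m) (p : PMF (Label d m)) : Prop :=
  ∀ η : ℝ≥0∞, η ≠ 0 → ∃ P, Realizable α A P ∧ Approx c η P p

theorem Realizable.approx (h : Realizable α A p) (hp : ∀ s, s.2 = 1 → p s = 0) :
    ApproxRealizable α c A p :=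
  fun _ _ => ⟨p, h, Approx.refl hp⟩

theorem pure_error_eq_zero {s : Label d m} (hs : s.2 ≠ 1) (t : Label d m) (ht : t.2 = 1) :
    PMF.pure s t = 0 :=
  PMF.pure_apply_of_ne _ _ fun h => hs (h ▸ ht)

theorem approxRealizable_pure {s : Label d m} (hs : s.2 ≠ 1) :
    ApproxRealizable α c s.1 (PMF.pure s) :=
  (realizable_pure α s).approx (pure_error_eq_zero hs)

/-- Half of the error is spent on the first law and half on all the kernels; the bound on the
kernels is uniform, so averaging over the first law preserves it. -/
theorem ApproxRealizable.bind {k : Label d m → PMF (Label d m)} (hα : 0 < α)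
    (hc : ∀ X, 1 + ‖X‖ₑ ≤ c X) (h : ApproxRealizable α c A p) (hm : moment p ≠ ⊤)
    (hm' : moment (p.bind k) ≠ ⊤) (hk : ∀ s, p s ≠ 0 → ApproxRealizable α c s.1 (k s)) :
    ApproxRealizable α c A (p.bind k) := by
  intro η hη
  -- Truncation at 1 keeps ε finite, so that the perturbed laws still have finite first moment.
  let ε := min η 1 / 2
  have hε : ε ≠ 0 := by simp [ε, hη]
  have hε1 : ε ≠ ⊤ := ENNReal.div_ne_top (by simp) (by simp)
  have hεη : ε + ε ≤ η := by
    rw [ENNReal.add_halves]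
    exact min_le_left _ _
  obtain ⟨P, hP, hPp⟩ := h ε hε
  -- Where p has no mass, in particular on the error labels, the kernel does nothing.
  have hex : ∀ s, ∃ R, Realizable α s.1 R ∧ (p s ≠ 0 → Approx c ε R (k s)) ∧
      (p s = 0 → R = PMF.pure s) := by
    intro s
    by_cases hs : p s = 0
    · exact ⟨PMF.pure s, realizable_pure α s, fun h => absurd hs h, fun _ => rfl⟩
    · obtain ⟨R, hR, hRk⟩ := hk s hs ε hε
      exact ⟨R, hR, fun _ => hRk, fun h => absurd h hs⟩
  choose κ hκ1 hκ2 hκ3 using hex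
  have hA := hPp.bind (κ := κ) (k := k) (fun s hs => hκ3 s (hPp.error_eq_zero s hs)) hκ2
  refine ⟨P.bind κ, hP.bind hα ?_ ?_ fun s _ => hκ1 s, hA.mono hεη⟩
  · exact ne_top_of_le_ne_top (ENNReal.add_ne_top.2 ⟨hm, hε1⟩) (hPp.moment_le hc)
  · exact ne_top_of_le_ne_top (ENNReal.add_ne_top.2 ⟨hm', ENNReal.add_ne_top.2 ⟨hε1, hε1⟩⟩)
      (hA.moment_le hc)

/-- A weight is locally bounded. -/
def LocallyBounded (c : Mat d m → ℝ≥0∞) : Prop :=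
  ∀ X, ∃ r > 0, ∃ C : ℝ≥0, ∀ Y, ‖Y - X‖ ≤ r → c Y ≤ C

/-- The error gradients lie close to C, where the weight is bounded by a constant D, so errors of
volume fraction ε have weight at most Dε. -/
theorem approxRealizable_rankOne (hα : 0 < α) (hα' : α < 1) (hc : LocallyBounded c) {l : ℝ}
    (hl : 0 < l) (hl' : l < 1) {C B B' : Mat d m} (hC : C = l • B + (1 - l) • B')
    (hr : (B' - B).rank = 1) (hB : p (B, 0) = ENNReal.ofReal l)
    (hB' : p (B', 0) = ENNReal.ofReal (1 - l))
    (hp : ∀ t, t ≠ (B, 0) → t ≠ (B', 0) → p t = 0) : ApproxRealizable α c C p := by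
  intro η hη
  obtain ⟨r, hr0, D, hD⟩ := hc C
  -- ε ≤ r keeps the errors where the weight is bounded, ε ≤ 1 keeps 1 - q nonnegative, ε ≤ η bounds
  -- the relative loss and Dε ≤ η the error weight.
  have hex : ∃ ε : ℝ, 0 < ε ∧ ε ≤ r ∧ ε ≤ 1 ∧ ENNReal.ofReal ε ≤ η ∧
      (D : ℝ≥0∞) * ENNReal.ofReal ε ≤ η := by
    let η' : ℝ := (min η 1).toReal
    have hη'0 : 0 < η' := ENNReal.toReal_pos (by simp [hη]) (by simp)
    have hη' : ENNReal.ofReal η' ≤ η := by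
      rw [ENNReal.ofReal_toReal (by simp)]
      exact min_le_left _ _
    have hD0 : (0 : ℝ) < D + 1 := by positivity
    have hle : min (η' / (D + 1)) (min r 1) ≤ η' / (D + 1) := min_le_left _ _
    refine ⟨min (η' / (D + 1)) (min r 1), by positivity, ?_, ?_, ?_, ?_⟩
    · exact (min_le_right _ _).trans (min_le_left _ _)
    · exact (min_le_right _ _).trans (min_le_right _ _)
    · refine (ENNReal.ofReal_le_ofReal (hle.trans ?_)).trans hη'
      exact div_le_self hη'0.le (by simp)
    · rw [← ENNReal.ofReal_coe_nnreal, ← ENNReal.ofReal_mul D.coe_nonneg]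
      refine (ENNReal.ofReal_le_ofReal ?_).trans hη'
      calc (D : ℝ) * min (η' / (D + 1)) (min r 1) ≤ (D + 1) * (η' / (D + 1)) := by
            gcongr
            linarith
        _ = η' := by field_simp
  obtain ⟨ε, hε0, hεr, hε1, hεη, hεD⟩ := hex
  obtain ⟨P, q, hq0, hqε, hP, hPB, hPB', hPs, hPe⟩ :=
    exists_realizable_rankOne hα hα' hl hl' hC hr hε0
  have key : ∀ x : ℝ, 0 ≤ x → ENNReal.ofReal x ≤
      ENNReal.ofReal (x * (1 - q)) + η * ENNReal.ofReal x := by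
    intro x hx
    calc ENNReal.ofReal x = ENNReal.ofReal (x * (1 - q) + q * x) := by congr 1; ring
      _ = ENNReal.ofReal (x * (1 - q)) + ENNReal.ofReal q * ENNReal.ofReal x := by
          rw [ENNReal.ofReal_add (mul_nonneg hx (by linarith)) (by positivity),
            ENNReal.ofReal_mul hq0]
      _ ≤ _ := by
          gcongr
          exact (ENNReal.ofReal_le_ofReal hqε).trans hεη
  refine ⟨P, hP, fun s hs => ?_, fun s hs => ?_, ?_, fun s hs => ?_⟩
  · by_cases hPs0 : P s = 0
    · simp [hPs0]
    · rcases hPs s hPs0 with rfl | rfl | h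
      · rw [hPB, hB]
        exact ENNReal.ofReal_le_ofReal (by nlinarith)
      · rw [hPB', hB']
        exact ENNReal.ofReal_le_ofReal (by nlinarith)
      · exact absurd h.1 hs
  · by_cases h1 : s = (B, 0)
    · rw [h1, hPB, hB]
      exact key l hl.le
    · by_cases h2 : s = (B', 0)
      · rw [h2, hPB', hB']
        exact key (1 - l) (by linarith)
      · simp [hp s h1 h2]
  · calc expect P (onError c) ≤ expect P fun t => (if t.2 = 1 then 1 else 0) * (D : ℝ≥0∞) := by
          refine expect_mono fun s hs0 => ?_
          unfold onError
          split_ifs with hs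
          · rw [one_mul]
            rcases hPs s hs0 with rfl | rfl | h
            · simp at hs
            · simp at hs
            · exact hD s.1 (h.2.trans hεr)
          · exact zero_le
      _ ≤ _ := by
          rw [expect_mul_const, hPe, mul_comm]
          refine le_trans ?_ hεD
          gcongr
  · refine hp s ?_ ?_ <;> rintro rfl <;> simp at hs

theorem moment_eq_of_map_fst_eq {p p' : PMF (Label d m)} (h : p.map Prod.fst = p'.map Prod.fst) :
    moment p = moment p' := by
  have h1 : ∀ q : PMF (Label d m), moment q = expect (q.map Prod.fst) fun X => ‖X‖ₑ :=
    fun q => (expect_map q Prod.fst _).symm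
  rw [h1, h1, h]

theorem map_fst_apply (p : PMF (Label d m)) (X : Mat d m) :
    p.map Prod.fst X = ∑' n, p (X, n) := by
  classical
  rw [PMF.map_apply, ENNReal.tsum_prod', tsum_eq_single X]
  · simp
  · intro Y hY
    simp [Ne.symm hY]

/-- Only the distribution of the gradients matters, not the tags. -/
theorem ApproxRealizable.of_map_fst_eq (hα : 0 < α) (hα' : α < 1) (hm0 : 0 < m)
    (hc : ∀ X, 1 + ‖X‖ₑ ≤ c X) (h : ApproxRealizable α c A p) (hm : moment p ≠ ⊤)
    {p' : PMF (Label d m)} (hp' : ∀ s, s.2 = 1 → p' s = 0)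
    (heq : p.map Prod.fst = p'.map Prod.fst) : ApproxRealizable α c A p' := by
  -- π is the conditional law under p' of the tag given the gradient X. Each piece is cut according
  -- to it without changing the map, which replaces the old tags by new ones.
  have hex : ∀ X : Mat d m, ∃ π : PMF ℕ, (∀ n, p.map Prod.fst X * π n = p' (X, n)) ∧ π 1 = 0 := by
    intro X
    by_cases hX : p'.map Prod.fst X = 0
    · refine ⟨PMF.pure 0, fun n => ?_, PMF.pure_apply_of_ne _ _ one_ne_zero⟩
      rw [heq, hX, zero_mul]
      rw [map_fst_apply, ENNReal.tsum_eq_zero] at hX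
      exact (hX n).symm
    · have hX' : p'.map Prod.fst X ≠ ⊤ := PMF.apply_ne_top _ _
      refine ⟨PMF.normalize (fun n => p' (X, n)) ?_ ?_, fun n => ?_, ?_⟩
      · rwa [← map_fst_apply]
      · rwa [← map_fst_apply]
      · rw [PMF.normalize_apply, ← map_fst_apply, heq, mul_left_comm,
          ENNReal.mul_inv_cancel hX hX', mul_one]
      · rw [PMF.normalize_apply, hp' (X, 1) rfl, zero_mul]
  choose π hπ hπ1 using hex
  let k : Label d m → PMF (Label d m) := fun s => (π s.1).map fun n => (s.1, n)
  have hk : ∀ s t, k s t = if t.1 = s.1 then π s.1 t.2 else 0 := by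
    classical
    rintro s ⟨Y, n⟩
    rw [PMF.map_apply]
    by_cases hY : Y = s.1
    · subst hY
      simp
    · simp [hY]
  have hbind : p.bind k = p' := by
    classical
    ext t
    rw [PMF.bind_apply, ← hπ t.1 t.2, PMF.map_apply, ← ENNReal.tsum_mul_right]
    refine tsum_congr fun s => ?_
    rw [hk]
    split_ifs with h1
    · rw [h1]
    · simp
  rw [← hbind]
  refine h.bind hα hc hm ?_ fun s _ => ?_
  · rw [hbind, ← moment_eq_of_map_fst_eq heq]
    exact hm
  · refine (realizable_tags hα hα' hm0 s.1 (π s.1)).approx fun t ht => ?_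
    rw [show (π s.1).map (fun n => (s.1, n)) = k s from rfl, hk, ht, hπ1]
    simp

theorem activeMoment_le_of_le {P p : PMF (Label d m)} (h : ∀ s, s.2 ≠ 1 → P s ≤ p s) :
    activeMoment P ≤ activeMoment p := by
  refine ENNReal.tsum_le_tsum fun s => ?_
  unfold onActive
  split_ifs with hs
  · gcongr
    exact h s (by omega)
  · simp

/-- Every kernel is replaced by a realizable one with its own error. Error labels are not active, so
they stay at rest and the perturbed laws again form a chain with no more active mass; the estimates
against the original chain pass to the supremum. -/
theorem IsChain.approxRealizable_limit {p : ℕ → PMF (Label d m)}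
    {k : ℕ → Label d m → PMF (Label d m)} (hα : 0 < α) (hc : ∀ X, 1 + ‖X‖ₑ ≤ c X)
    (h : IsChain A p k) (hk : ∀ n s, p n s ≠ 0 → s.2 = 2 → ApproxRealizable α c s.1 (k n s))
    (hmom : ∀ n, moment (p n) ≠ ⊤) (hact : Tendsto (fun n => activeMoment (p n)) atTop (𝓝 0))
    (hq : IsLimitDist p q) (hqm : moment q ≠ ⊤) : ApproxRealizable α c A q := by
  intro η' hη'
  let η := min η' 1
  have hη : η ≠ 0 := by simp [η, hη']
  have hη1 : η ≠ ⊤ := by simp [η]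
  -- The errors of all steps add up to η.
  let ε : ℕ → ℝ≥0∞ := fun n => η * 2⁻¹ ^ (n + 1)
  have hε : ∀ n, ε n ≠ 0 := fun n => mul_ne_zero hη (pow_ne_zero _ (by simp))
  have hex : ∀ n s, ∃ R, (s.2 = 2 → Realizable α s.1 R) ∧
      (p n s ≠ 0 → s.2 = 2 → Approx c (ε n) R (k n s)) ∧ (s.2 ≠ 2 → R = PMF.pure s) := by
    intro n s
    by_cases hs : p n s ≠ 0 ∧ s.2 = 2
    · obtain ⟨R, hR, hRk⟩ := hk n s hs.1 hs.2 (ε n) (hε n)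
      exact ⟨R, fun _ => hR, fun _ _ => hRk, fun h => absurd hs.2 h⟩
    · exact ⟨PMF.pure s, fun _ => realizable_pure α s, fun h1 h2 => absurd ⟨h1, h2⟩ hs,
        fun _ => rfl⟩
  choose κ hκ1 hκ2 hκ3 using hex
  let P : ℕ → PMF (Label d m) := fun n => Nat.rec (PMF.pure (A, 2)) (fun n R => R.bind (κ n)) n
  have hP : IsChain A P κ := ⟨rfl, fun _ => rfl, hκ3⟩
  have happ : ∀ n, Approx c (∑ j ∈ Finset.range n, ε j) (P n) (p n) := by
    intro n
    induction n with
    | zero =>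
      rw [hP.zero, h.zero]
      exact Approx.refl (pure_error_eq_zero (s := (A, 2)) (by simp))
    | succ n ih =>
      rw [hP.succ, h.succ, Finset.sum_range_succ]
      refine ih.bind (fun s hs => hκ3 n s (by omega)) fun s hs => ?_
      by_cases hs2 : s.2 = 2
      · exact hκ2 n s hs hs2
      · rw [hκ3 n s hs2, h.done n s hs2]
        exact Approx.refl (pure_error_eq_zero fun h1 => hs (ih.error_eq_zero s h1))
  have hsum : ∀ n, ∑ j ∈ Finset.range n, ε j ≤ η := by
    intro n
    calc ∑ j ∈ Finset.range n, ε j ≤ ∑' j, ε j := ENNReal.sum_le_tsum _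
      _ = η := by
        rw [ENNReal.tsum_mul_left, ENNReal.tsum_geometric_add_one, ENNReal.one_sub_inv_two,
          inv_inv, ENNReal.inv_mul_cancel (by simp) (by simp), mul_one]
  have happ' : ∀ n, Approx c η (P n) (p n) := fun n => (happ n).mono (hsum n)
  have hactP : Tendsto (fun n => activeMoment (P n)) atTop (𝓝 0) :=
    tendsto_of_tendsto_of_tendsto_of_le_of_le tendsto_const_nhds hact (fun _ => zero_le)
      fun n => activeMoment_le_of_le (happ' n).le
  obtain ⟨Q, hQ⟩ := hP.exists_limit hactP
  have hQq : Approx c η Q q := by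
    refine ⟨fun s hs => ?_, fun s hs => ?_, ?_, fun s hs => ?_⟩
    · by_cases hs2 : s.2 = 2
      · simp [hQ.active s hs2]
      · rw [hQ.done s hs2, hq.done s hs2]
        exact iSup_mono fun n => (happ' n).le s hs
    · by_cases hs2 : s.2 = 2
      · simp [hq.active s hs2]
      · rw [hQ.done s hs2, hq.done s hs2]
        refine iSup_le fun n => ((happ' n).ge s hs).trans ?_
        gcongr
        · exact le_iSup (fun n => P n s) n
        · exact le_iSup (fun n => p n s) n
    · rw [hP.expect_limit hQ]
      refine iSup_le fun n => le_trans (expect_mono fun s _ => ?_) (happ' n).error_le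
      unfold onDone
      split_ifs
      · exact zero_le
      · exact le_rfl
    · rw [hq.done s (by omega), ENNReal.iSup_eq_zero]
      exact fun n => (happ' n).error_eq_zero s hs
  refine ⟨Q, ?_, hQq.mono (min_le_left _ _)⟩
  refine hP.realizable_limit hα (fun n s _ hs => hκ1 n s hs) (fun n => ?_) hactP hQ ?_
  · exact ne_top_of_le_ne_top (ENNReal.add_ne_top.2 ⟨hmom n, hη1⟩) ((happ' n).moment_le hc)
  · exact ne_top_of_le_ne_top (ENNReal.add_ne_top.2 ⟨hqm, hη1⟩) (hQq.moment_le hc)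

end Approx

/-! ### Discrete measures and probability mass functions -/

section Measures

variable {d m : ℕ}

theorem toMeasure_eq_sum (p : PMF (Mat d m)) :
    p.toMeasure = Measure.sum fun X => p X • Measure.dirac X := by
  ext E hE
  rw [PMF.toMeasure_apply _ hE, Measure.sum_apply _ hE]
  refine tsum_congr fun X => ?_
  rw [Measure.smul_apply, Measure.dirac_apply' _ hE, smul_eq_mul]
  by_cases hX : X ∈ E <;> simp [hX]

theorem expect_eq_lintegral (p : PMF (Mat d m)) {f : Mat d m → ℝ≥0∞} (hf : Measurable f) :
    expect p f = ∫⁻ X, f X ∂p.toMeasure := by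
  rw [toMeasure_eq_sum, lintegral_sum_measure]
  refine tsum_congr fun X => ?_
  rw [lintegral_smul_measure, lintegral_dirac' _ hf, smul_eq_mul]

/-- The remainder in an elementary splitting is an arbitrary measure, but it is dominated by a
discrete law and is therefore concentrated on a countable set. -/
theorem exists_toMeasure_eq {ν : Measure (Mat d m)} [IsProbabilityMeasure ν] {p : PMF (Mat d m)}
    {a : ℝ≥0∞} (ha : a ≠ 0) (h : a • ν ≤ p.toMeasure) : ∃ p' : PMF (Mat d m), p'.toMeasure = ν := by
  have hE : p.support.Countable := p.support_countable
  have hE0 : ν p.supportᶜ = 0 := by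
    have h1 : p.toMeasure p.supportᶜ = 0 := by
      rw [PMF.toMeasure_apply_eq_zero_iff _ hE.measurableSet.compl]
      exact disjoint_compl_right
    have h2 := (h p.supportᶜ).trans_eq h1
    rw [Measure.smul_apply, smul_eq_mul, le_zero_iff, mul_eq_zero] at h2
    exact h2.resolve_left ha
  have hF : ∀ F : Set (Mat d m), MeasurableSet F →
      ∑' X, F.indicator (fun X => ν {X}) X = ν F := by
    intro F hF
    have h0 : ∀ X, F.indicator (fun X => ν {X}) X = (F ∩ p.support).indicator (fun X => ν {X}) X := by
      intro X
      by_cases hX : X ∈ p.support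
      · by_cases hXF : X ∈ F
        · have hXi : X ∈ F ∩ p.support := ⟨hXF, hX⟩
          rw [Set.indicator_of_mem hXF, Set.indicator_of_mem hXi]
        · rw [Set.indicator_of_notMem hXF, Set.indicator_of_notMem fun h => hXF h.1]
      · rw [Set.indicator_of_notMem (s := F ∩ p.support) fun h => hX h.2,
          Set.indicator_apply_eq_zero]
        exact fun _ => measure_mono_null (Set.singleton_subset_iff.2 hX) hE0
    simp_rw [h0]
    rw [← tsum_subtype, ← measure_biUnion (hE.mono Set.inter_subset_right)
      (fun X _ Y _ hXY => by simpa using hXY) fun X _ => measurableSet_singleton X,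
      Set.biUnion_of_singleton]
    exact measure_inter_conull hE0
  have h1 : ∑' X, ν {X} = 1 := by
    simpa using hF Set.univ MeasurableSet.univ
  let p' : PMF (Mat d m) := ⟨fun X => ν {X}, h1 ▸ ENNReal.summable.hasSum⟩
  refine ⟨p', ?_⟩
  ext F hFm
  rw [PMF.toMeasure_apply _ hFm]
  exact hF F hFm

theorem HasBarycenter.unique {ν : Measure (Mat d m)} {A B : Mat d m} (hA : HasBarycenter ν A)
    (hB : HasBarycenter ν B) : A = B := by
  ext i j
  rw [← (hA i j).2, (hB i j).2]

theorem continuous_entry (i : Fin d) (j : Fin m) : Continuous fun X : Mat d m => X i j :=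
  continuous_id.matrix_elem i j

theorem enorm_le_sum_enorm (X : Mat d m) : ‖X‖ₑ ≤ ∑ i, ∑ j, ‖X i j‖ₑ := by
  have h1 : ‖X‖ ≤ ∑ i, ∑ j, ‖X i j‖ := by
    have h0 : 0 ≤ ∑ i, ∑ j, ‖X i j‖ :=
      Finset.sum_nonneg fun i _ => Finset.sum_nonneg fun j _ => norm_nonneg _
    rw [Matrix.frobenius_norm_def, ← Real.sqrt_eq_rpow]
    refine Real.sqrt_le_iff.2 ⟨h0, ?_⟩
    simp only [Real.rpow_two]
    calc ∑ i, ∑ j, ‖X i j‖ ^ 2 ≤ ∑ i, (∑ j, ‖X i j‖) ^ 2 := Finset.sum_le_sum fun i _ =>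
          Finset.sum_sq_le_sq_sum_of_nonneg fun j _ => norm_nonneg _
      _ ≤ _ := Finset.sum_sq_le_sq_sum_of_nonneg fun i _ =>
          Finset.sum_nonneg fun j _ => norm_nonneg _
  rw [← ofReal_norm]
  refine (ENNReal.ofReal_le_ofReal h1).trans_eq ?_
  refine (ENNReal.ofReal_sum_of_nonneg fun i _ =>
    Finset.sum_nonneg fun j _ => norm_nonneg (X i j)).trans (Finset.sum_congr rfl fun i _ => ?_)
  rw [ENNReal.ofReal_sum_of_nonneg fun j _ => norm_nonneg (X i j)]
  simp only [ofReal_norm]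

theorem HasBarycenter.lintegral_norm_ne_top {ν : Measure (Mat d m)} {A : Mat d m}
    (h : HasBarycenter ν A) : ∫⁻ X, ‖X‖ₑ ∂ν ≠ ⊤ := by
  refine ne_top_of_le_ne_top ?_ (lintegral_mono fun X => enorm_le_sum_enorm X)
  have hm : ∀ i j, Measurable fun X : Mat d m => ‖X i j‖ₑ := fun i j =>
    (continuous_entry i j).measurable.enorm
  rw [lintegral_finsetSum _ fun i _ => Finset.measurable_sum _ fun j _ => hm i j]
  refine ENNReal.sum_ne_top.2 fun i _ => ?_
  rw [lintegral_finsetSum _ fun j _ => hm i j]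
  exact ENNReal.sum_ne_top.2 fun j _ => (h i j).1.2.ne

/-- The law of the gradient. -/
def gradLaw (p : PMF (Label d m)) : Measure (Mat d m) := (p.map Prod.fst).toMeasure

theorem expect_fst_eq_lintegral (p : PMF (Label d m)) {f : Mat d m → ℝ≥0∞} (hf : Measurable f) :
    (expect p fun s => f s.1) = ∫⁻ X, f X ∂gradLaw p := by
  rw [gradLaw, ← expect_eq_lintegral _ hf, expect_map]

theorem gradLaw_apply (p : PMF (Label d m)) {E : Set (Mat d m)} (hE : MeasurableSet E) :
    gradLaw p E = expect p fun s => E.indicator (fun _ => 1) s.1 := by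
  rw [expect_fst_eq_lintegral p (measurable_const.indicator hE), lintegral_indicator_const hE,
    one_mul]

theorem moment_eq_lintegral (p : PMF (Label d m)) : moment p = ∫⁻ X, ‖X‖ₑ ∂gradLaw p :=
  expect_fst_eq_lintegral p measurable_enorm_mat

theorem moment_ne_top_of_hasBarycenter {p : PMF (Label d m)} {A : Mat d m}
    (h : HasBarycenter (gradLaw p) A) : moment p ≠ ⊤ := by
  rw [moment_eq_lintegral]
  exact h.lintegral_norm_ne_top

theorem gradLaw_map_mk (p : PMF (Mat d m)) (n : ℕ) :
    gradLaw (p.map fun X => (X, n)) = p.toMeasure := by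
  rw [gradLaw, PMF.map_comp]
  exact congrArg _ (PMF.map_id p)

theorem map_fst_eq_of_gradLaw_eq {p p' : PMF (Label d m)} (h : gradLaw p = gradLaw p') :
    p.map Prod.fst = p'.map Prod.fst :=
  PMF.toMeasure_injective h

end Measures

/-! ### Laminates of finite order -/

section Laminates

variable {d m : ℕ} {T T' : Type*}

/-- The mixture `l p + (1 - l) q`. -/
def mix (l : ℝ) (h0 : 0 ≤ l) (h1 : l ≤ 1) (p q : PMF T) : PMF T :=
  ⟨fun s => ENNReal.ofReal l * p s + ENNReal.ofReal (1 - l) * q s, by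
    have h : ∑' s, (ENNReal.ofReal l * p s + ENNReal.ofReal (1 - l) * q s) = 1 := by
      rw [ENNReal.tsum_add, ENNReal.tsum_mul_left, ENNReal.tsum_mul_left, p.tsum_coe, q.tsum_coe,
        mul_one, mul_one, ← ENNReal.ofReal_add h0 (sub_nonneg.2 h1)]
      simp
    exact h ▸ ENNReal.summable.hasSum⟩

variable {l : ℝ} {h0 : 0 ≤ l} {h1 : l ≤ 1} {p q : PMF T}

theorem mix_apply (s : T) :
    mix l h0 h1 p q s = ENNReal.ofReal l * p s + ENNReal.ofReal (1 - l) * q s := rfl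

theorem expect_mix (f : T → ℝ≥0∞) : expect (mix l h0 h1 p q) f =
    ENNReal.ofReal l * expect p f + ENNReal.ofReal (1 - l) * expect q f := by
  simp only [expect, mix_apply, add_mul, mul_assoc]
  rw [ENNReal.tsum_add, ENNReal.tsum_mul_left, ENNReal.tsum_mul_left]

theorem mix_bind (k : T → PMF T') :
    (mix l h0 h1 p q).bind k = mix l h0 h1 (p.bind k) (q.bind k) := by
  ext t
  rw [mix_apply, PMF.bind_apply, PMF.bind_apply, PMF.bind_apply]
  exact expect_mix fun s => k s t

theorem gradLaw_mix {p q : PMF (Label d m)} : gradLaw (mix l h0 h1 p q) =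
    ENNReal.ofReal l • gradLaw p + ENNReal.ofReal (1 - l) • gradLaw q := by
  ext E hE
  simp only [Measure.add_apply, Measure.smul_apply, smul_eq_mul, gradLaw_apply _ hE, expect_mix]

theorem gradLaw_pure (s : Label d m) : gradLaw (PMF.pure s) = Measure.dirac s.1 := by
  ext E hE
  rw [gradLaw_apply _ hE, expect_pure, Measure.dirac_apply' _ hE]
  rfl

theorem hasBarycenter_dirac (A : Mat d m) : HasBarycenter (Measure.dirac A) A := fun i j =>
  ⟨integrable_dirac' (continuous_entry i j).measurable.stronglyMeasurable (by simp),
    integral_dirac' _ _ (continuous_entry i j).measurable.stronglyMeasurable⟩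

theorem ElementarySplitting.hasBarycenter {ν μ : Measure (Mat d m)} (h : ElementarySplitting ν μ)
    {A : Mat d m} (hA : HasBarycenter ν A) : HasBarycenter μ A := by
  obtain ⟨l, l', C, B, B', ν', hl0, hl1, hl0', hl1', -, hC, -, rfl, rfl⟩ := h
  intro i j
  obtain ⟨h1, h2⟩ := hA i j
  have hd : ∀ X : Mat d m, Integrable (fun X => X i j) (Measure.dirac X) := fun X =>
    (hasBarycenter_dirac X i j).1
  have hd2 : ∀ X : Mat d m, ∫ Y, Y i j ∂(Measure.dirac X) = X i j := fun X =>
    (hasBarycenter_dirac X i j).2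
  have h3 := (integrable_add_measure.1 h1).2
  have h4 : Integrable (fun X : Mat d m => X i j) (ENNReal.ofReal l' • Measure.dirac B) :=
    (hd B).smul_measure ENNReal.ofReal_ne_top
  have h5 : Integrable (fun X : Mat d m => X i j) (ENNReal.ofReal (1 - l') • Measure.dirac B') :=
    (hd B').smul_measure ENNReal.ofReal_ne_top
  refine ⟨integrable_add_measure.2 ⟨(integrable_add_measure.2 ⟨h4, h5⟩).smul_measure
    ENNReal.ofReal_ne_top, h3⟩, ?_⟩
  rw [integral_add_measure ((hd C).smul_measure ENNReal.ofReal_ne_top) h3, integral_smul_measure,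
    hd2] at h2
  rw [integral_add_measure ((integrable_add_measure.2 ⟨h4, h5⟩).smul_measure
    ENNReal.ofReal_ne_top) h3, integral_smul_measure, integral_add_measure h4 h5,
    integral_smul_measure, integral_smul_measure, hd2, hd2, ENNReal.toReal_ofReal hl0'.le,
    ENNReal.toReal_ofReal (sub_nonneg.2 hl1'.le), ← h2, hC]
  rfl

variable {α : ℝ} {c : Mat d m → ℝ≥0∞}

/-- In the induction step only the part l δ_C is split, although the remainder may charge C as well.
The tags are therefore redistributed first, so that this part carries tag 2, and the kernel acts on
that tag alone. -/
theorem IsFiniteLaminate.exists_approxRealizable (hα : 0 < α) (hα' : α < 1) (hm0 : 0 < m)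
    (hc : ∀ X, 1 + ‖X‖ₑ ≤ c X) (hc' : LocallyBounded c) {ν : Measure (Mat d m)}
    (h : IsFiniteLaminate ν) :
    ∃ A p, HasBarycenter ν A ∧ gradLaw p = ν ∧ ApproxRealizable α c A p := by
  induction h with
  | dirac A => exact ⟨A, PMF.pure (A, 0), hasBarycenter_dirac A, gradLaw_pure _,
      approxRealizable_pure (s := (A, 0)) (by simp)⟩
  | split ν μ _ hνμ ih =>
    obtain ⟨A, p, hA, hp, hAR⟩ := ih
    have hbar := hνμ.hasBarycenter hA
    obtain ⟨l, l', C, B, B', ν', hl0, hl1, hl0', hl1', hν', hC, hr, hν, rfl⟩ := hνμ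
    -- For l = 1 the remainder has coefficient 0 and need not be discrete, so any law may stand in
    -- for it.
    have hex : ∃ p' : PMF (Mat d m),
        ENNReal.ofReal (1 - l) • p'.toMeasure = ENNReal.ofReal (1 - l) • ν' := by
      rcases hl1.eq_or_lt with rfl | hl
      · exact ⟨PMF.pure C, by simp⟩
      · obtain ⟨p', hp'⟩ := exists_toMeasure_eq (ν := ν') (p := p.map Prod.fst)
          (a := ENNReal.ofReal (1 - l)) (by simpa using hl) (by
            change _ ≤ gradLaw p
            rw [hp, hν]
            exact Measure.le_add_left le_rfl)
        exact ⟨p', by rw [hp']⟩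
    obtain ⟨p', hp'⟩ := hex
    let π : PMF (Label d m) := mix l hl0 hl1 (PMF.pure (C, 2)) (p'.map fun X => (X, 0))
    let τ : PMF (Label d m) := mix l' hl0'.le hl1'.le (PMF.pure (B, 0)) (PMF.pure (B', 0))
    let k : Label d m → PMF (Label d m) := fun s => if s.2 = 2 then τ else PMF.pure s
    have hmap : ∀ s : Label d m, s.2 ≠ 0 → p'.map (fun X => (X, 0)) s = 0 := by
      intro s hs
      rw [PMF.apply_eq_zero_iff, PMF.mem_support_map_iff]
      rintro ⟨X, -, rfl⟩
      exact hs rfl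
    have hπlaw : gradLaw π = ν := by
      rw [gradLaw_mix, gradLaw_pure, gradLaw_map_mk, hp', hν]
    have hπ : ∀ s, π s ≠ 0 → s = (C, 2) ∨ s.2 = 0 := by
      intro s hs
      by_contra! h
      refine hs ?_
      rw [mix_apply, PMF.pure_apply_of_ne _ _ h.1, hmap s h.2]
      simp
    have hbind : π.bind k = mix l hl0 hl1 τ (p'.map fun X => (X, 0)) := by
      rw [mix_bind, PMF.pure_bind]
      congr 1
      refine (bind_congr fun s hs => ?_).trans (PMF.bind_pure _)
      have hs0 : s.2 = 0 := by
        by_contra h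
        exact hs (hmap s h)
      simp [k, hs0]
    have hlaw : gradLaw (π.bind k) = ENNReal.ofReal l • (ENNReal.ofReal l' • Measure.dirac B +
        ENNReal.ofReal (1 - l') • Measure.dirac B') + ENNReal.ofReal (1 - l) • ν' := by
      rw [hbind, gradLaw_mix, gradLaw_map_mk, hp', gradLaw_mix, gradLaw_pure, gradLaw_pure]
    have hBB' : B ≠ B' := by
      rintro rfl
      simp at hr
    have hpm : moment p ≠ ⊤ := moment_ne_top_of_hasBarycenter (hp ▸ hA)
    have hARπ : ApproxRealizable α c A π := by
      refine hAR.of_map_fst_eq hα hα' hm0 hc hpm (fun s hs => ?_)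
        (map_fst_eq_of_gradLaw_eq (hp.trans hπlaw.symm))
      by_contra h
      rcases hπ s h with rfl | h
      · simp at hs
      · omega
    refine ⟨A, π.bind k, hbar, hlaw, hARπ.bind hα hc ?_ ?_ fun s hs => ?_⟩
    · exact moment_ne_top_of_hasBarycenter (hπlaw ▸ hA)
    · exact moment_ne_top_of_hasBarycenter (hlaw ▸ hbar)
    · rcases hπ s hs with rfl | h
      · simp only [k, if_true]
        refine approxRealizable_rankOne hα hα' hc' hl0' hl1' hC hr ?_ ?_ fun t ht ht' => ?_
        · rw [mix_apply, PMF.pure_apply_self, PMF.pure_apply_of_ne _ _ (by simpa using hBB')]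
          simp
        · rw [mix_apply, PMF.pure_apply_self, PMF.pure_apply_of_ne _ _ (by simpa using hBB'.symm)]
          simp
        · rw [mix_apply, PMF.pure_apply_of_ne _ _ ht, PMF.pure_apply_of_ne _ _ ht']
          simp
      · have : k s = PMF.pure s := by simp [k, h]
        rw [this]
        exact approxRealizable_pure (by omega)

end Laminates

/-! ### Staircase laminates -/

section Staircase

variable {d m : ℕ} {α : ℝ} {c : Mat d m → ℝ≥0∞} {K : Set (Mat d m)}

theorem apply_le_gradLaw_singleton (p : PMF (Label d m)) (s : Label d m) :
    p s ≤ gradLaw p {s.1} := by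
  rw [gradLaw_apply _ (measurableSet_singleton _)]
  calc p s = p s * ({s.1} : Set (Mat d m)).indicator (fun _ => 1) s.1 := by simp
    _ ≤ _ := ENNReal.le_tsum s

/-- As b ∉ K, the measure μ has no atom at b. The gradient alone then tells the active part from the
part that is finished in K, and the active part has mass exactly γ. -/
theorem exists_staircase_step (hα : 0 < α) (hα' : α < 1) (hm0 : 0 < m)
    (hc : ∀ X, 1 + ‖X‖ₑ ≤ c X) (hc' : LocallyBounded c) {a b : Mat d m} {μ : Measure (Mat d m)}
    {γ : ℝ} (hb : b ∉ K) (hμ : μ Kᶜ = 0)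
    (hlam : IsFiniteLaminate (ENNReal.ofReal (1 - γ) • μ + ENNReal.ofReal γ • Measure.dirac b))
    (hbar : HasBarycenter (ENNReal.ofReal (1 - γ) • μ + ENNReal.ofReal γ • Measure.dirac b) a) :
    ∃ T : PMF (Label d m), ApproxRealizable α c a T ∧
      (∀ s, T s ≠ 0 → s = (b, 2) ∨ s.2 = 0 ∧ s.1 ∈ K) ∧ T (b, 2) = ENNReal.ofReal γ ∧
      ∀ E, MeasurableSet E → expect T (onDone fun s => E.indicator (fun _ => 1) s.1) =
        ENNReal.ofReal (1 - γ) * μ E := by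
  classical
  obtain ⟨a', p, ha', hp, hAR⟩ := hlam.exists_approxRealizable hα hα' hm0 hc hc'
  obtain rfl := ha'.unique hbar
  let lab : Mat d m → Label d m := fun X => if X = b then (X, 2) else (X, 0)
  have hlab : ∀ X, (lab X).1 = X := fun X => by
    simp only [lab]
    split_ifs <;> rfl
  let T := (p.map Prod.fst).map lab
  have hTfst : p.map Prod.fst = T.map Prod.fst := by
    rw [PMF.map_comp, show Prod.fst ∘ lab = id from funext hlab, PMF.map_id]
  have hTlaw : gradLaw T = ENNReal.ofReal (1 - γ) • μ + ENNReal.ofReal γ • Measure.dirac b := by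
    rw [← hp, gradLaw, ← hTfst, gradLaw]
  have hTs : ∀ s, T s ≠ 0 → s = (b, 2) ∨ s.2 = 0 ∧ s.1 ≠ b := by
    intro s hs
    rw [← PMF.mem_support_iff, PMF.mem_support_map_iff] at hs
    obtain ⟨X, -, rfl⟩ := hs
    simp only [lab]
    split_ifs with h
    · exact Or.inl (by rw [h])
    · exact Or.inr ⟨rfl, h⟩
  have hμ0 : ∀ X, X ∉ K → μ {X} = 0 := fun X hX =>
    measure_mono_null (Set.singleton_subset_iff.2 hX) hμ
  have hTE : ∀ E, MeasurableSet E → expect T (onDone fun s => E.indicator (fun _ => 1) s.1) =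
      ENNReal.ofReal (1 - γ) * μ E := by
    intro E hE
    have hE' : MeasurableSet (E \ {b}) := hE.diff (measurableSet_singleton b)
    calc _ = gradLaw T (E \ {b}) := by
          rw [gradLaw_apply _ hE']
          refine expect_congr fun s hs => ?_
          rcases hTs s hs with rfl | ⟨h, h'⟩
          · simp [onDone]
          · by_cases hsE : s.1 ∈ E <;> simp [onDone, h, h', hsE]
      _ = ENNReal.ofReal (1 - γ) * μ (E \ {b}) := by
          rw [hTlaw, Measure.add_apply, Measure.smul_apply, Measure.smul_apply,
            Measure.dirac_apply' _ hE']
          simp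
      _ = _ := by rw [measure_sdiff_null (hμ0 b hb)]
  refine ⟨T, hAR.of_map_fst_eq hα hα' hm0 hc ?_ (fun s hs => ?_) hTfst, fun s hs => ?_, ?_, hTE⟩
  · exact moment_ne_top_of_hasBarycenter (hp ▸ ha')
  · by_contra h
    rcases hTs s h with rfl | ⟨h, -⟩
    · simp at hs
    · omega
  · refine (hTs s hs).imp_right fun h => ⟨h.1, ?_⟩
    by_contra hsK
    have h2 := apply_le_gradLaw_singleton T s
    rw [hTlaw, Measure.add_apply, Measure.smul_apply, Measure.smul_apply, hμ0 s.1 hsK,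
      Measure.dirac_apply' _ (measurableSet_singleton _),
      Set.indicator_of_notMem (Set.mem_singleton_iff.not.2 h.2.symm)] at h2
    exact hs (by simpa using h2)
  · have h1 : T.map Prod.fst b = gradLaw T {b} := by
      rw [gradLaw, PMF.toMeasure_apply_singleton _ _ (measurableSet_singleton b)]
    rw [map_fst_apply, tsum_eq_single 2, hTlaw, Measure.add_apply, Measure.smul_apply,
      Measure.smul_apply, hμ0 b hb] at h1
    · simpa using h1
    · intro n hn
      by_contra h
      rcases hTs _ h with h | ⟨-, h⟩
      · exact hn (by simpa using h)
      · exact h rfl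

theorem stairMass_succ (γ : ℕ → ℝ) (n : ℕ) : stairMass γ (n + 1) = stairMass γ n * γ n :=
  Finset.prod_range_succ _ _

theorem stairMass_nonneg {γ : ℕ → ℝ} (hγ : ∀ n, 0 < γ n ∧ γ n < 1) (n : ℕ) : 0 ≤ stairMass γ n :=
  Finset.prod_nonneg fun k _ => (hγ k).1.le

/-- The Dirac term in ν^N has mass at most β_N, which tends to 0, so the setwise limit is the sum of
the masses deposited in K. -/
theorem eq_sum_of_tendsto_stairMeasure {a : ℕ → Mat d m} {μ : ℕ → Measure (Mat d m)} {γ : ℕ → ℝ}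
    {ν : Measure (Mat d m)} (hβ : Tendsto (stairMass γ) atTop (𝓝 0))
    (hlim : ∀ E, MeasurableSet E → Tendsto (fun N => stairMeasure a μ γ N E) atTop (𝓝 (ν E))) :
    ν = Measure.sum fun n => ENNReal.ofReal (stairMass γ n * (1 - γ n)) • μ n := by
  ext E hE
  rw [Measure.sum_apply _ hE]
  refine tendsto_nhds_unique (hlim E hE) ?_
  have h1 := (ENNReal.summable (f := fun n =>
    (ENNReal.ofReal (stairMass γ n * (1 - γ n)) • μ n) E)).hasSum.tendsto_sum_nat
  have h2 : Tendsto (fun N => ENNReal.ofReal (stairMass γ N) * Measure.dirac (a N) E) atTop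
      (𝓝 0) := by
    have h3 := ENNReal.tendsto_ofReal hβ
    rw [ENNReal.ofReal_zero] at h3
    refine tendsto_of_tendsto_of_tendsto_of_le_of_le tendsto_const_nhds h3 (fun _ => zero_le)
      fun N => ?_
    exact mul_le_of_le_one_right' prob_le_one
  have h3 := h1.add h2
  rw [add_zero] at h3
  refine h3.congr fun N => ?_
  rw [stairMeasure, Measure.add_apply, Measure.finsetSum_apply, Measure.smul_apply, smul_eq_mul]

/-- The barycenters of the steps telescope: the first n deposits have first moment a 0 - β_n a_n.
Since the limit is integrable with barycenter a 0, these partial sums converge to a 0, and so β_n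
a_n tends to 0 entry by entry. -/
theorem tendsto_stairMass_mul_norm {a : ℕ → Mat d m} {μ : ℕ → Measure (Mat d m)} {γ : ℕ → ℝ}
    {ν : Measure (Mat d m)} (hγ : ∀ n, 0 < γ n ∧ γ n < 1)
    (hbar : ∀ n, HasBarycenter (ENNReal.ofReal (1 - γ n) • μ n +
      ENNReal.ofReal (γ n) • Measure.dirac (a (n + 1))) (a n))
    (hν : ν = Measure.sum fun n => ENNReal.ofReal (stairMass γ n * (1 - γ n)) • μ n)
    (hνbar : HasBarycenter ν (a 0)) :
    Tendsto (fun n => ENNReal.ofReal (stairMass γ n) * ‖a n‖ₑ) atTop (𝓝 0) := by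
  have hβ0 := stairMass_nonneg hγ
  have hij : ∀ i j, Tendsto (fun n => stairMass γ n * a n i j) atTop (𝓝 0) := by
    intro i j
    have hstep : ∀ n, (1 - γ n) * ∫ X, X i j ∂μ n + γ n * a (n + 1) i j = a n i j := by
      intro n
      obtain ⟨h1, h2⟩ := hbar n i j
      obtain ⟨h3, h4⟩ := integrable_add_measure.1 h1
      rw [integral_add_measure h3 h4, integral_smul_measure, integral_smul_measure,
        (hasBarycenter_dirac (a (n + 1)) i j).2, ENNReal.toReal_ofReal (hγ n).1.le,
        ENNReal.toReal_ofReal (sub_nonneg.2 (hγ n).2.le)] at h2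
      exact h2
    have htel : ∀ n, ∑ k ∈ Finset.range n, (stairMass γ k * (1 - γ k)) * ∫ X, X i j ∂μ k =
        a 0 i j - stairMass γ n * a n i j := by
      intro n
      induction n with
      | zero => simp [stairMass]
      | succ n ih =>
        rw [Finset.sum_range_succ, ih, stairMass_succ]
        linear_combination stairMass γ n * hstep n
    obtain ⟨h1, h2⟩ := hνbar i j
    rw [hν] at h1 h2
    have h3 := (hasSum_integral_measure h1).tendsto_sum_nat
    rw [h2] at h3
    have h4 : ∀ n, ∫ X, X i j ∂(ENNReal.ofReal (stairMass γ n * (1 - γ n)) • μ n) =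
        (stairMass γ n * (1 - γ n)) * ∫ X, X i j ∂μ n := fun n => by
      rw [integral_smul_measure, ENNReal.toReal_ofReal
        (mul_nonneg (hβ0 n) (sub_nonneg.2 (hγ n).2.le)), smul_eq_mul]
    simp only [h4, htel] at h3
    have h5 := h3.const_sub (a 0 i j)
    simpa using h5
  have hsum : Tendsto (fun n => ∑ i, ∑ j, ENNReal.ofReal ‖stairMass γ n * a n i j‖) atTop
      (𝓝 (∑ _i : Fin d, ∑ _j : Fin m, ENNReal.ofReal 0)) :=
    tendsto_finsetSum _ fun i _ => tendsto_finsetSum _ fun j _ =>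
      ENNReal.tendsto_ofReal (by simpa using (hij i j).norm)
  simp only [ENNReal.ofReal_zero, Finset.sum_const_zero] at hsum
  refine tendsto_of_tendsto_of_tendsto_of_le_of_le tendsto_const_nhds hsum (fun _ => zero_le)
    fun n => ?_
  calc ENNReal.ofReal (stairMass γ n) * ‖a n‖ₑ
      ≤ ENNReal.ofReal (stairMass γ n) * ∑ i, ∑ j, ‖a n i j‖ₑ := by
        gcongr
        exact enorm_le_sum_enorm _
    _ = _ := by
        simp only [Finset.mul_sum]
        refine Finset.sum_congr rfl fun i _ => Finset.sum_congr rfl fun j _ => ?_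
        rw [norm_mul, Real.norm_of_nonneg (hβ0 n), ENNReal.ofReal_mul (hβ0 n), ofReal_norm]

/-- The staircase is the chain that applies one finite laminate per stage to the single active
gradient a n, of mass β_n. Both β_n and β_n|a n| tend to 0, which is what the limit theorem for
chains requires. -/
theorem IsStaircaseLaminate.exists_approxRealizable (hα : 0 < α) (hα' : α < 1) (hm0 : 0 < m)
    (hc : ∀ X, 1 + ‖X‖ₑ ≤ c X) (hc' : LocallyBounded c) {A : Mat d m} {ν : Measure (Mat d m)}
    (h : IsStaircaseLaminate K A ν) :
    ∃ q, gradLaw q = ν ∧ (∀ s, q s ≠ 0 → s.2 = 0 ∧ s.1 ∈ K) ∧ ApproxRealizable α c A q := by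
  obtain ⟨a, μ, γ, rfl, haK, hμ, hγ, hlam, -, -, hβ, hlim, hbar⟩ := h
  have hν := eq_sum_of_tendsto_stairMeasure hβ hlim
  have hβa := tendsto_stairMass_mul_norm hγ (fun n => (hlam n).2) hν hbar
  have hβ0 := stairMass_nonneg hγ
  choose T hTAR hTs hTb hTE using fun n => exists_staircase_step hα hα' hm0 hc hc' (haK (n + 1))
    (hμ n).2 (hlam n).1 (hlam n).2
  let k : ℕ → Label d m → PMF (Label d m) := fun n s => if s.2 = 2 then T n else PMF.pure s
  let P : ℕ → PMF (Label d m) := fun n => Nat.rec (PMF.pure (a 0, 2)) (fun n R => R.bind (k n)) n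
  have hP : IsChain (a 0) P k := ⟨rfl, fun _ => rfl, fun n s hs => by simp [k, hs]⟩
  have hPs : ∀ n s, P n s ≠ 0 → s = (a n, 2) ∨ s.2 = 0 ∧ s.1 ∈ K := by
    intro n
    induction n with
    | zero =>
      intro s hs
      by_contra h
      rw [hP.zero] at hs
      exact hs (PMF.pure_apply_of_ne _ _ fun h' => h (Or.inl h'))
    | succ n ih =>
      intro t ht
      rw [hP.succ, ← PMF.mem_support_iff, PMF.mem_support_bind_iff] at ht
      obtain ⟨s, hs, hst⟩ := ht
      rcases ih s hs with rfl | h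
      · exact hTs n t (by simpa [k] using hst)
      · simp only [k, h.1, OfNat.zero_ne_ofNat, if_false, PMF.mem_support_pure_iff] at hst
        exact Or.inr (hst ▸ h)
  have hPact : ∀ n f, expect (P n) (onActive f) = P n (a n, 2) * f (a n, 2) := by
    intro n f
    unfold expect
    rw [tsum_eq_single (a n, 2)]
    · simp [onActive]
    · intro s hs
      by_cases h0 : P n s = 0
      · simp [h0]
      · rcases hPs n s h0 with h | h
        · exact absurd h hs
        · simp [onActive, h.1]
  have hPsucc : ∀ n f, expect (P (n + 1)) f =
      expect (P n) (onDone f) + P n (a n, 2) * expect (T n) f := by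
    intro n f
    rw [hP.succ, expect_bind, ← hPact n fun _ => expect (T n) f, ← expect_add]
    refine expect_congr fun s _ => ?_
    by_cases hs : s.2 = 2
    · simp [k, onDone, onActive, hs]
    · simp [k, onDone, onActive, hs, expect_pure]
  have hPa : ∀ n, P n (a n, 2) = ENNReal.ofReal (stairMass γ n) := by
    intro n
    induction n with
    | zero => rw [hP.zero]; simp [stairMass]
    | succ n ih =>
      have h1 : ∀ (q : PMF (Label d m)) t, q t = expect q (({t} : Set (Label d m)).indicator 1) := by
        intro q t
        unfold expect
        rw [tsum_eq_single t]
        · simp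
        · intro s hs
          simp [hs]
      rw [h1, hPsucc, ← h1, ih, hTb, stairMass_succ, ENNReal.ofReal_mul (hβ0 n)]
      convert zero_add _
      refine ENNReal.tsum_eq_zero.2 fun s => ?_
      by_cases hs : s.2 = 2
      · simp [onDone, hs]
      · have : s ≠ (a (n + 1), 2) := fun h => hs (by rw [h])
        simp [onDone, this]
  have hPE : ∀ n E, MeasurableSet E →
      expect (P n) (onDone fun s => E.indicator (fun _ => 1) s.1) =
        ∑ j ∈ Finset.range n, (ENNReal.ofReal (stairMass γ j * (1 - γ j)) • μ j) E := by
    intro n E hE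
    have hidem : ∀ f : Label d m → ℝ≥0∞, onDone (onDone f) = onDone f := fun f => by
      ext s
      simp only [onDone]
      split_ifs <;> rfl
    induction n with
    | zero => rw [hP.zero, expect_pure]; simp [onDone]
    | succ n ih =>
      rw [hPsucc, hidem, ih, hTE n E hE, hPa, Finset.sum_range_succ, Measure.smul_apply, smul_eq_mul,
        ENNReal.ofReal_mul (hβ0 n), mul_assoc]
  have hPm : ∀ n, activeMoment (P n) = ENNReal.ofReal (stairMass γ n) * (1 + ‖a n‖ₑ) := fun n => by
    rw [activeMoment, hPact, hPa]
  have hact : Tendsto (fun n => activeMoment (P n)) atTop (𝓝 0) := by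
    have h1 := (ENNReal.tendsto_ofReal hβ).add hβa
    rw [ENNReal.ofReal_zero, add_zero] at h1
    refine h1.congr fun n => ?_
    rw [hPm, mul_add, mul_one]
  obtain ⟨q, hq⟩ := hP.exists_limit hact
  have hqlaw : gradLaw q = ν := by
    ext E hE
    rw [gradLaw_apply _ hE, hP.expect_limit hq, hν, Measure.sum_apply _ hE,
      ENNReal.tsum_eq_iSup_nat]
    exact iSup_congr fun n => hPE n E hE
  have hqm : moment q ≠ ⊤ := moment_ne_top_of_hasBarycenter (hqlaw ▸ hbar)
  refine ⟨q, hqlaw, fun s hs => ?_, hP.approxRealizable_limit hα hc (fun n s h1 h2 => ?_)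
    (fun n => ?_) hact hq hqm⟩
  · have hs2 : s.2 ≠ 2 := fun h => hs (hq.active s h)
    rw [hq.done s hs2] at hs
    obtain ⟨n, hn⟩ : ∃ n, P n s ≠ 0 := by
      by_contra! h
      exact hs (by simp [h])
    rcases hPs n s hn with rfl | h
    · exact absurd rfl hs2
    · exact h
  · rcases hPs n s h1 with rfl | h
    · simp only [k, if_true]
      exact hTAR n
    · omega
  · refine ne_top_of_le_ne_top (ENNReal.add_ne_top.2 ⟨?_, hqm⟩) (hP.moment_le hq n)
    rw [hPm]
    exact ENNReal.mul_ne_top ENNReal.ofReal_ne_top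
      (ENNReal.add_ne_top.2 ⟨ENNReal.one_ne_top, enorm_ne_top⟩)

end Staircase

/-! ### Extended staircase laminates -/

section Extended

variable {d m : ℕ} {α : ℝ} {c : Mat d m → ℝ≥0∞} {K : Set (Mat d m)}

/-- The finite laminate is composed with a Dirac mass or a staircase at each of its atoms. -/
theorem IsExtendedStaircase.exists_approxRealizable (hα : 0 < α) (hα' : α < 1) (hm0 : 0 < m)
    (hc : ∀ X, 1 + ‖X‖ₑ ≤ c X) (hc' : LocallyBounded c) {A : Mat d m} {ν : Measure (Mat d m)}
    (h : IsExtendedStaircase K A ν) :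
    ∃ q, gradLaw q = ν ∧ (∀ s, q s ≠ 0 → s.2 = 0 ∧ s.1 ∈ K) ∧ moment q ≠ ⊤ ∧
      ApproxRealizable α c A q := by
  obtain ⟨J', J, l, B, σ, hJ, -, hlam, hbar, hBK, hσ, rfl⟩ := h
  obtain ⟨A', p, hA', hp, hAR⟩ := hlam.exists_approxRealizable hα hα' hm0 hc hc'
  obtain rfl := hA'.unique hbar
  have hmass : ∑ j ∈ Finset.range J, ENNReal.ofReal (l j) = 1 := by
    have h1 : gradLaw p Set.univ = 1 := by
      rw [gradLaw_apply _ MeasurableSet.univ]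
      simp [expect_const]
    rw [hp, Measure.finsetSum_apply] at h1
    simpa using h1
  let w : PMF ℕ := PMF.ofFinset (fun j => if j < J then ENNReal.ofReal (l j) else 0)
    (Finset.range J) (by
      rw [← hmass]
      exact Finset.sum_congr rfl fun j hj => if_pos (Finset.mem_range.1 hj))
    fun j hj => if_neg fun h => hj (Finset.mem_range.2 h)
  have hw : ∀ f : ℕ → ℝ≥0∞, expect w f = ∑ j ∈ Finset.range J, ENNReal.ofReal (l j) * f j := by
    intro f
    unfold expect
    rw [tsum_eq_sum (s := Finset.range J)]
    · refine Finset.sum_congr rfl fun j hj => ?_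
      rw [PMF.ofFinset_apply, if_pos (Finset.mem_range.1 hj)]
    · intro j hj
      rw [PMF.ofFinset_apply, if_neg fun h => hj (Finset.mem_range.2 h), zero_mul]
  have hwJ : ∀ j, w j ≠ 0 → j < J := fun j hj => by
    by_contra h
    exact hj (by rw [PMF.ofFinset_apply, if_neg h])
  have hex : ∀ j, ∃ Q : PMF (Label d m), j < J →
      gradLaw Q = (if j < J' then Measure.dirac (B j) else σ j) ∧
      (∀ s, Q s ≠ 0 → s.2 = 0 ∧ s.1 ∈ K) ∧ moment Q ≠ ⊤ ∧ ApproxRealizable α c (B j) Q := by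
    intro j
    by_cases hj' : j < J'
    · refine ⟨PMF.pure (B j, 0), fun _ => ⟨?_, fun s hs => ?_, ?_,
        approxRealizable_pure (s := (B j, 0)) (by simp)⟩⟩
      · rw [gradLaw_pure, if_pos hj']
      · rw [← PMF.mem_support_iff, PMF.mem_support_pure_iff] at hs
        rw [hs]
        exact ⟨rfl, hBK j hj'⟩
      · rw [moment_pure]
        exact enorm_ne_top
    · by_cases hj : j < J
      · have hs := hσ j (not_lt.1 hj') hj
        obtain ⟨Q, h1, h2, h3⟩ := hs.exists_approxRealizable hα hα' hm0 hc hc'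
        refine ⟨Q, fun _ => ⟨by rw [h1, if_neg hj'], h2, ?_, h3⟩⟩
        obtain ⟨-, -, -, -, -, -, -, -, -, -, -, -, hb⟩ := hs
        exact moment_ne_top_of_hasBarycenter (h1 ▸ hb)
      · exact ⟨PMF.pure (B j, 0), fun h => absurd h hj⟩
  choose Q hQ using hex
  -- Several B j may coincide and still be continued by different measures, so the tag records the
  -- index; the shift by 2 avoids the error tag 1.
  let π : PMF (Label d m) := w.map fun j => (B j, j + 2)
  let k : Label d m → PMF (Label d m) := fun s => Q (s.2 - 2)
  have hbind : π.bind k = w.bind Q := by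
    rw [PMF.bind_map]
    rfl
  have hπlaw : gradLaw π = ∑ j ∈ Finset.range J, ENNReal.ofReal (l j) • Measure.dirac (B j) := by
    ext E hE
    rw [gradLaw_apply _ hE, expect_map, hw, Measure.finsetSum_apply]
    refine Finset.sum_congr rfl fun j _ => ?_
    rw [Measure.smul_apply, Measure.dirac_apply' _ hE]
    rfl
  have hπs : ∀ s, π s ≠ 0 → ∃ j < J, s = (B j, j + 2) := by
    intro s hs
    rw [← PMF.mem_support_iff, PMF.mem_support_map_iff] at hs
    obtain ⟨j, hj, rfl⟩ := hs
    exact ⟨j, hwJ j hj, rfl⟩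
  have hmom : moment (w.bind Q) ≠ ⊤ := by
    rw [moment, expect_bind, hw]
    exact ENNReal.sum_ne_top.2 fun j hj =>
      ENNReal.mul_ne_top ENNReal.ofReal_ne_top (hQ j (Finset.mem_range.1 hj)).2.2.1
  refine ⟨w.bind Q, ?_, fun s hs => ?_, hmom, ?_⟩
  · ext E hE
    rw [gradLaw_apply _ hE, expect_bind, hw, Measure.add_apply, Measure.finsetSum_apply,
      Measure.finsetSum_apply, ← Finset.sum_range_add_sum_Ico _ hJ]
    congr 1
    · refine Finset.sum_congr rfl fun j hj => ?_
      have hj' := Finset.mem_range.1 hj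
      rw [← gradLaw_apply _ hE, (hQ j (hj'.trans_le hJ)).1, if_pos hj', Measure.smul_apply,
        smul_eq_mul]
    · refine Finset.sum_congr rfl fun j hj => ?_
      have hj' := Finset.mem_Ico.1 hj
      rw [← gradLaw_apply _ hE, (hQ j hj'.2).1, if_neg (not_lt.2 hj'.1), Measure.smul_apply,
        smul_eq_mul]
  · rw [← PMF.mem_support_iff, PMF.mem_support_bind_iff] at hs
    obtain ⟨j, hj, hs⟩ := hs
    exact (hQ j (hwJ j hj)).2.1 s hs
  · rw [← hbind]
    refine ApproxRealizable.bind hα hc (hAR.of_map_fst_eq hα hα' hm0 hc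
      (moment_ne_top_of_hasBarycenter (hp ▸ hA')) (fun s hs => ?_)
      (map_fst_eq_of_gradLaw_eq (hp.trans hπlaw.symm)))
      (moment_ne_top_of_hasBarycenter (hπlaw ▸ hA')) (hbind ▸ hmom) fun s hs => ?_
    · by_contra h
      obtain ⟨j, -, rfl⟩ := hπs s h
      simp at hs
    · obtain ⟨j, hj, rfl⟩ := hπs s hs
      exact (hQ j hj).2.2.2

/-! ### Turning errors into pieces that are still to be modified -/

/-- Error labels become active labels. -/
def reactivate (s : Label d m) : Label d m := if s.2 = 1 then (s.1, 2) else s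

theorem reactivate_fst (s : Label d m) : (reactivate s).1 = s.1 := by
  unfold reactivate
  split_ifs <;> rfl

theorem Realizable.map_reactivate {A : Mat d m} {P : PMF (Label d m)} (hα : 0 < α)
    (h : Realizable α A P) (hm : moment P ≠ ⊤) : Realizable α A (P.map reactivate) := by
  have hm' : moment (P.map reactivate) ≠ ⊤ := by
    rw [moment, expect_map]
    simpa only [reactivate_fst, moment] using hm
  rw [← PMF.bind_pure_comp] at hm' ⊢
  refine h.bind hα hm hm' fun s _ => ?_
  have := realizable_pure α (reactivate s)
  rwa [reactivate_fst] at this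

/-- One round of the construction: a distribution `q` on good labels is realized up to a relative
error `η`, and the remaining pieces are active and have weight at most `η`. -/
theorem ApproxRealizable.exists_round {A : Mat d m} {q : PMF (Label d m)} {η : ℝ≥0∞} (hα : 0 < α)
    (hc : ∀ X, 1 + ‖X‖ₑ ≤ c X) (h : ApproxRealizable α c A q)
    (hq : ∀ s, q s ≠ 0 → s.2 = 0 ∧ s.1 ∈ K) (hqm : moment q ≠ ⊤) (hη : η ≠ 0) (hη' : η ≠ ⊤) :
    ∃ R : PMF (Label d m), Realizable α A R ∧ moment R ≠ ⊤ ∧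
      (∀ s, R s ≠ 0 → s.2 = 2 ∨ s.2 = 0 ∧ s.1 ∈ K) ∧
      expect R (onActive fun s => c s.1) ≤ η ∧
      ∀ f : Mat d m → ℝ≥0∞, expect R (onDone fun s => f s.1) ≤ expect q (fun s => f s.1) ∧
        expect q (fun s => f s.1) ≤
          expect R (onDone fun s => f s.1) + η * expect q fun s => f s.1 := by
  obtain ⟨P, hP, hPq⟩ := h η hη
  have hPm : moment P ≠ ⊤ :=
    ne_top_of_le_ne_top (ENNReal.add_ne_top.2 ⟨hqm, hη'⟩) (hPq.moment_le hc)
  have hPs : ∀ s, P s ≠ 0 → s.2 = 1 ∨ s.2 = 0 ∧ s.1 ∈ K := fun s hs => by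
    by_cases h1 : s.2 = 1
    · exact Or.inl h1
    · refine Or.inr (hq s fun h0 => hs ?_)
      exact le_zero_iff.1 (h0 ▸ hPq.le s h1)
  have hdone : ∀ f : Mat d m → ℝ≥0∞, expect (P.map reactivate) (onDone fun s => f s.1) =
      expect P fun s => if s.2 = 1 then 0 else f s.1 := by
    intro f
    rw [expect_map]
    refine expect_congr fun s hs => ?_
    rcases hPs s hs with h | ⟨h, -⟩
    · simp [reactivate, onDone, h]
    · simp [reactivate, onDone, h]
  refine ⟨P.map reactivate, hP.map_reactivate hα hPm, ?_, fun s hs => ?_, ?_, fun f => ⟨?_, ?_⟩⟩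
  · rw [moment, expect_map]
    simpa only [reactivate_fst, moment] using hPm
  · rw [← PMF.mem_support_iff, PMF.mem_support_map_iff] at hs
    obtain ⟨t, ht, rfl⟩ := hs
    rcases hPs t ht with h | h
    · left
      simp [reactivate, h]
    · right
      simpa [reactivate, h.1] using h.2
  · rw [expect_map]
    refine le_trans (expect_mono fun s hs => ?_) hPq.error_le
    rcases hPs s hs with h | ⟨h, -⟩
    · simp [reactivate, onActive, onError, h]
    · simp [reactivate, onActive, h]
  · rw [hdone]
    refine ENNReal.tsum_le_tsum fun s => ?_
    dsimp only
    split_ifs with h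
    · simp
    · gcongr
      exact hPq.le s h
  · rw [hdone]
    unfold expect
    rw [← ENNReal.tsum_mul_left, ← ENNReal.tsum_add]
    refine ENNReal.tsum_le_tsum fun s => ?_
    dsimp only
    split_ifs with h
    · simp [hPq.error_eq_zero s h]
    · rw [← mul_assoc, ← add_mul]
      gcongr
      exact hPq.ge s h

end Extended

/-! ### Infinitely many rounds -/

section Rounds

variable {d m : ℕ} {α : ℝ} {c : Mat d m → ℝ≥0∞} {K : Set (Mat d m)}

/-- The matrices of norm larger than `t`. -/
def tailSet (d m : ℕ) (t : ℝ) : Set (Mat d m) := {X | t < ‖X‖}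

theorem measurableSet_tailSet (t : ℝ) : MeasurableSet (tailSet d m t) := by
  have h : Continuous fun X : Mat d m => ‖X‖ := continuous_norm
  exact measurableSet_lt measurable_const h.measurable

instance isProbabilityMeasure_gradLaw (q : PMF (Label d m)) : IsProbabilityMeasure (gradLaw q) :=
  PMF.toMeasure.isProbabilityMeasure _

/-- The layer-cake formula: a tail of order t^{-p} is integrable at infinity because p > 1. -/
theorem moment_ne_top_of_tail_le {q : PMF (Label d m)} {C : ℝ≥0∞} {p : ℝ} (hC : C ≠ ⊤) (hp : 1 < p)
    (h : ∀ t : ℝ, 0 < t → gradLaw q (tailSet d m t) ≤ C * ENNReal.ofReal (t ^ (-p))) :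
    moment q ≠ ⊤ := by
  have hn : Continuous fun X : Mat d m => ‖X‖ := continuous_norm
  have h1 : moment q = ∫⁻ t in Set.Ioi (0 : ℝ), gradLaw q (tailSet d m t) := by
    rw [moment_eq_lintegral]
    simp only [← ofReal_norm]
    exact lintegral_eq_lintegral_meas_lt _ (Eventually.of_forall fun X => norm_nonneg X)
      hn.measurable.aemeasurable
  have h2 : ∫⁻ t in Set.Ioi (1 : ℝ), ENNReal.ofReal (t ^ (-p)) < ⊤ :=
    (integrableOn_Ioi_rpow_of_lt (by linarith : -p < -1) one_pos).lintegral_lt_top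
  rw [h1, ← Set.Ioc_union_Ioi_eq_Ioi (zero_le_one' ℝ)]
  refine ne_top_of_le_ne_top ?_ (lintegral_union_le _ _ _)
  refine ENNReal.add_ne_top.2 ⟨?_, ?_⟩
  · refine ne_top_of_le_ne_top ?_ (lintegral_mono fun t => prob_le_one)
    simp
  · refine ne_top_of_le_ne_top ?_ (setLIntegral_mono' measurableSet_Ioi fun t ht =>
      h t (zero_lt_one.trans ht))
    rw [lintegral_const_mul' _ _ hC]
    exact ENNReal.mul_ne_top hC h2.ne

/-- Errors are restarted with the law `Q X` of their own gradient, round after round. The weight c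
both bounds the tail of `Q X` and measures the errors, so a small error weight means a small
contribution to the tail, uniformly in t. -/
theorem exists_realizable_of_tail_le {Q : Mat d m → PMF (Label d m)} {p : ℝ} (hα : 0 < α)
    (hc : ∀ X, 1 + ‖X‖ₑ ≤ c X) (hc' : ∀ X, c X ≠ ⊤) (hp : 1 < p)
    (hQ : ∀ X, ApproxRealizable α c X (Q X)) (hQs : ∀ X s, Q X s ≠ 0 → s.2 = 0 ∧ s.1 ∈ K)
    (hQm : ∀ X, moment (Q X) ≠ ⊤)
    (htail : ∀ X (t : ℝ), 0 < t →
      gradLaw (Q X) (tailSet d m t) ≤ c X * ENNReal.ofReal (t ^ (-p))) (A : Mat d m) :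
    ∃ q, Realizable α A q ∧ moment q ≠ ⊤ ∧ (∀ s, q s ≠ 0 → s.1 ∈ K) ∧ ∀ t : ℝ, 0 < t →
      gradLaw (Q A) (tailSet d m t) ≤
        gradLaw q (tailSet d m t) + 2⁻¹ * gradLaw (Q A) (tailSet d m t) ∧
      gradLaw q (tailSet d m t) ≤
        gradLaw (Q A) (tailSet d m t) + ENNReal.ofReal (t ^ (-p)) := by
  choose R hR hRm hRs hRc hRf using fun X => (hQ X).exists_round hα hc (hQs X) (hQm X)
    (η := 2⁻¹) (by simp) (by simp)
  let κ : ℕ → Label d m → PMF (Label d m) := fun _ s => if s.2 = 2 then R s.1 else PMF.pure s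
  let P : ℕ → PMF (Label d m) := fun n => Nat.rec (PMF.pure (A, 2)) (fun n R => R.bind (κ n)) n
  have hP : IsChain A P κ := ⟨rfl, fun _ => rfl, fun n s hs => by simp [κ, hs]⟩
  have hP1 : P 1 = R A := by
    rw [show P 1 = (P 0).bind (κ 0) from hP.succ 0, hP.zero, PMF.pure_bind]
    simp [κ]
  have hPs : ∀ n s, P n s ≠ 0 → s.2 = 2 ∨ s.2 = 0 ∧ s.1 ∈ K := by
    intro n
    induction n with
    | zero =>
      intro s hs
      rw [hP.zero, ← PMF.mem_support_iff, PMF.mem_support_pure_iff] at hs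
      rw [hs]
      exact Or.inl rfl
    | succ n ih =>
      intro t ht
      rw [hP.succ, ← PMF.mem_support_iff, PMF.mem_support_bind_iff] at ht
      obtain ⟨s, hs, hst⟩ := ht
      by_cases hs2 : s.2 = 2
      · simp only [κ, hs2, if_true] at hst
        exact hRs s.1 t hst
      · simp only [κ, hs2, if_false, PMF.mem_support_pure_iff] at hst
        exact hst ▸ ih s hs
  have hstep : ∀ n F, expect (P (n + 1)) (onDone F) = expect (P n) (onDone F) +
      expect (P n) (onActive fun s => expect (R s.1) (onDone F)) := by
    intro n F
    rw [hP.succ, expect_bind, ← expect_add]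
    refine expect_congr fun s _ => ?_
    by_cases hs : s.2 = 2
    · simp [κ, onDone, onActive, hs]
    · simp [κ, onDone, onActive, hs, expect_pure]
  let e : ℕ → ℝ≥0∞ := fun n => expect (P n) (onActive fun s => c s.1)
  have hc1 : ∀ X, 1 ≤ c X := fun X => le_self_add.trans (hc X)
  -- The initial weight c A may be large, but a round leaves an error of at most 1/2 whatever its
  -- starting gradient. From then on the weight halves, because c ≥ 1 bounds the active mass by the
  -- active weight.
  have he : ∀ n, e (n + 1) ≤ 2⁻¹ ^ (n + 1) := by
    intro n
    induction n with
    | zero =>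
      simp only [e, zero_add, hP1, pow_one]
      exact hRc A
    | succ n ih =>
      calc e (n + 1 + 1) = expect (P (n + 1)) fun s => expect (κ (n + 1) s)
            (onActive fun s => c s.1) := by
            simp only [e]
            rw [hP.succ (n + 1), expect_bind]
        _ ≤ expect (P (n + 1)) fun s => onActive (fun s => c s.1) s * 2⁻¹ := by
            refine expect_mono fun s _ => ?_
            by_cases hs : s.2 = 2
            · simp only [κ, onActive, hs, if_true]
              exact (hRc s.1).trans (le_mul_of_one_le_left' (hc1 s.1))
            · simp [κ, onActive, hs, expect_pure]
        _ = e (n + 1) * 2⁻¹ := expect_mul_const _ _ _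
        _ ≤ _ := by
            rw [pow_succ _ (n + 1)]
            gcongr
  have he0 : e 0 = c A := by
    simp only [e]
    rw [hP.zero, expect_pure]
    simp [onActive]
  have hefin : ∀ n, e n ≠ ⊤ := by
    intro n
    cases n with
    | zero => rw [he0]; exact hc' A
    | succ n => exact ne_top_of_le_ne_top (ENNReal.pow_ne_top (by simp)) (he n)
  have hae : ∀ n, activeMoment (P n) ≤ e n := fun n => expect_mono fun s _ => by
    unfold onActive
    split_ifs
    · exact hc s.1
    · exact le_rfl
  have hact : Tendsto (fun n => activeMoment (P n)) atTop (𝓝 0) := by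
    rw [← tendsto_add_atTop_iff_nat 1]
    have h1 := (tendsto_add_atTop_iff_nat 1).2
      (ENNReal.tendsto_pow_atTop_nhds_zero_of_lt_one (r := 2⁻¹) (by simp))
    exact tendsto_of_tendsto_of_tendsto_of_le_of_le tendsto_const_nhds h1 (fun _ => zero_le)
      fun n => (hae (n + 1)).trans (he n)
  obtain ⟨q, hq⟩ := hP.exists_limit hact
  let F : ℝ → Label d m → ℝ≥0∞ := fun t s => (tailSet d m t).indicator (fun _ => 1) s.1
  have hlaw : ∀ (p : PMF (Label d m)) t, gradLaw p (tailSet d m t) = expect p (F t) := fun p t =>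
    gradLaw_apply p (measurableSet_tailSet t)
  -- Restarting an active X adds at most the tail of `Q X`, that is c(X) t^{-p}; averaging over the
  -- active labels gives e n · t^{-p}.
  have hincr : ∀ t, 0 < t → ∀ n, expect (P (n + 1)) (onDone (F t)) ≤
      expect (P n) (onDone (F t)) + e n * ENNReal.ofReal (t ^ (-p)) := by
    intro t ht n
    rw [hstep]
    gcongr
    simp only [e]
    rw [← expect_mul_const]
    refine expect_mono fun s _ => ?_
    unfold onActive
    split_ifs
    · refine ((hRf s.1 _).1.trans_eq ?_).trans (htail s.1 t ht)
      exact (hlaw _ t).symm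
    · exact zero_le
  have hupper : ∀ t, 0 < t → gradLaw q (tailSet d m t) ≤
      gradLaw (Q A) (tailSet d m t) + ENNReal.ofReal (t ^ (-p)) := by
    intro t ht
    have h1 : ∀ n, expect (P (n + 1)) (onDone (F t)) ≤ expect (Q A) (F t) +
        (∑ j ∈ Finset.range n, 2⁻¹ ^ (j + 1)) * ENNReal.ofReal (t ^ (-p)) := by
      intro n
      induction n with
      | zero =>
        rw [zero_add, hP1]
        simpa using (hRf A _).1
      | succ n ih =>
        rw [Finset.sum_range_succ, add_mul, ← add_assoc]
        refine (hincr t ht (n + 1)).trans ?_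
        gcongr
        exact he n
    have h2 : ∀ n, ∑ j ∈ Finset.range n, (2⁻¹ : ℝ≥0∞) ^ (j + 1) ≤ 1 := fun n => by
      refine (ENNReal.sum_le_tsum _).trans_eq ?_
      rw [ENNReal.tsum_geometric_add_one, ENNReal.one_sub_inv_two, inv_inv,
        ENNReal.inv_mul_cancel (by simp) (by simp)]
    rw [hlaw, hlaw, hP.expect_limit hq]
    refine iSup_le fun n => (hP.expect_onDone_monotone (F t) (Nat.le_succ n)).trans
      ((h1 n).trans ?_)
    gcongr
    exact mul_le_of_le_one_left' (h2 n)
  have hqm : moment q ≠ ⊤ := by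
    refine moment_ne_top_of_tail_le (C := c A + 1) (by simp [hc' A]) hp fun t ht => ?_
    refine (hupper t ht).trans ?_
    rw [add_mul, one_mul]
    gcongr
    exact htail A t ht
  refine ⟨q, hP.realizable_limit hα (fun n s _ hs => ?_) (fun n => ?_) hact hq hqm, hqm,
    fun s hs => ?_, fun t ht => ⟨?_, hupper t ht⟩⟩
  · simp only [κ, hs, if_true]
    exact hR s.1
  · exact ne_top_of_le_ne_top (ENNReal.add_ne_top.2
      ⟨ne_top_of_le_ne_top (hefin n) (hae n), hqm⟩) (hP.moment_le hq n)
  · have hs2 : s.2 ≠ 2 := fun h => hs (hq.active s h)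
    rw [hq.done s hs2] at hs
    obtain ⟨n, hn⟩ : ∃ n, P n s ≠ 0 := by
      by_contra! h
      exact hs (by simp [h])
    exact ((hPs n s hn).resolve_left hs2).2
  -- The first round already realizes `Q A` up to a relative loss of 1/2, and finished mass is never
  -- removed later.
  · rw [hlaw, hlaw]
    refine (hRf A _).2.trans ?_
    gcongr
    rw [hP.expect_limit hq, ← hP1]
    exact le_iSup (fun n => expect (P n) (onDone (F t))) 1

end Rounds

/-! ### From realizations to maps on a domain -/

section Maps

variable {d m : ℕ} {α : ℝ} {K : Set (Mat d m)} {Ω : Set (Space m)}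

theorem holderNormOn_le {β : ℝ≥0} {f : Space m → Space d} {s C : ℝ}
    (hs : ∀ x ∈ closure Ω, ‖f x‖ ≤ s) (hC0 : 0 ≤ C)
    (hC : ∀ x ∈ closure Ω, ∀ y ∈ closure Ω, ‖f x - f y‖ ≤ C * dist x y ^ (β : ℝ)) :
    holderNormOn β Ω f ≤ ENNReal.ofReal s + ENNReal.ofReal C := by
  unfold holderNormOn
  gcongr
  · refine iSup₂_le fun x hx => ?_
    rw [← ofReal_norm]
    exact ENNReal.ofReal_le_ofReal (hs x hx)
  · have : HolderWith (Real.toNNReal C) β ((closure Ω).domRestrict f) := by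
      intro x y
      rw [edist_dist, edist_dist, ENNReal.ofReal_rpow_of_nonneg dist_nonneg β.coe_nonneg,
        show ((Real.toNNReal C : ℝ≥0) : ℝ≥0∞) = ENNReal.ofReal C from rfl,
        ← ENNReal.ofReal_mul hC0]
      refine ENNReal.ofReal_le_ofReal ?_
      rw [dist_eq_norm]
      exact hC x x.2 y y.2
    exact this.eHolderNorm_le

theorem rpow_le_rpow_of_le {x a b : ℝ} (hx : 0 ≤ x) (hx1 : x ≤ 1) (ha : 0 ≤ a) (hab : a ≤ b) :
    x ^ b ≤ x ^ a := by
  rcases hx.eq_or_lt with rfl | hx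
  · rcases ha.eq_or_lt with rfl | ha
    · rw [Real.rpow_zero]
      exact Real.rpow_le_one le_rfl zero_le_one hab
    · rw [Real.zero_rpow ha.ne', Real.zero_rpow (ha.trans_le hab).ne']
  · exact Real.rpow_le_rpow_of_exponent_ge hx hx1 hab

/-- The smaller exponent gives the weaker bound at distance at most 1; beyond it the sup norm is
used, which costs the factor 2. -/
theorem HolderBound.norm_sub_le_of_le {β : ℝ≥0} {δ : ℝ} {w : Space m → Space d}
    (h : HolderBound α δ w) (hβ : (β : ℝ) ≤ α) (x y : Space m) :
    ‖w x - w y‖ ≤ 2 * δ * dist x y ^ (β : ℝ) := by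
  have hδ : 0 ≤ δ := (norm_nonneg _).trans (h.norm_le 0)
  rcases le_total (dist x y) 1 with h1 | h1
  · refine (h.norm_sub_le x y).trans ?_
    exact mul_le_mul (by linarith) (rpow_le_rpow_of_le dist_nonneg h1 β.coe_nonneg hβ)
      (by positivity) (by positivity)
  · calc ‖w x - w y‖ ≤ ‖w x‖ + ‖w y‖ := _root_.norm_sub_le _ _
      _ ≤ 2 * δ := by linarith [h.norm_le x, h.norm_le y]
      _ ≤ _ := le_mul_of_one_le_right (by positivity) (Real.one_le_rpow h1 β.coe_nonneg)

theorem continuous_affineMap (A : Mat d m) (b : Space d) : Continuous (affineMap A b) :=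
  (LinearMap.continuous_of_finiteDimensional _).add continuous_const

theorem affineMap_apply_eq_add (A B : Mat d m) (b b' : Space d) (x : Space m) :
    affineMap A b x + affineMap (B - A) b' x = affineMap B (b + b') x := by
  simp only [affineMap, map_sub, LinearMap.sub_apply]
  abel

theorem affineMap_holder (hΩ : Bornology.IsBounded Ω) (A : Mat d m) (b : Space d) (β : ℝ≥0)
    (hβ : (β : ℝ) ≤ 1) : ∃ C : ℝ, 0 ≤ C ∧ ∀ x ∈ closure Ω, ∀ y ∈ closure Ω,
      ‖affineMap A b x - affineMap A b y‖ ≤ C * dist x y ^ (β : ℝ) := by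
  let L := LinearMap.toContinuousLinearMap (Matrix.toEuclideanLin A)
  let D := Metric.diam (closure Ω)
  refine ⟨‖L‖ * (1 + D), mul_nonneg (norm_nonneg _) (add_nonneg zero_le_one Metric.diam_nonneg),
    fun x hx y hy => ?_⟩
  have h1 : affineMap A b x - affineMap A b y = L (x - y) := by
    simp [affineMap, L]
  have hD : dist x y ≤ D := Metric.dist_le_diam_of_mem hΩ.closure hx hy
  have hD0 : 0 ≤ D := Metric.diam_nonneg
  rw [h1, mul_assoc]
  refine (L.le_opNorm _).trans ?_
  gcongr
  rw [← dist_eq_norm]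
  rcases le_total (dist x y) 1 with h2 | h2
  · have h3 := rpow_le_rpow_of_le dist_nonneg h2 β.coe_nonneg hβ
    rw [Real.rpow_one] at h3
    refine h3.trans (le_mul_of_one_le_left (by positivity) (by linarith))
  · have h3 := Real.one_le_rpow h2 β.coe_nonneg
    nlinarith

theorem integral_affineMap_mul_fderiv (A : Mat d m) (b : Space d) {φ : Space m → ℝ}
    (hφ : ContDiff ℝ ∞ φ) (hφ' : HasCompactSupport φ) (i : Fin d) (j : Fin m) :
    ∫ x, affineMap A b x i * fderiv ℝ φ x (EuclideanSpace.single j 1) = -∫ x, A i j * φ x := by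
  let L := LinearMap.toContinuousLinearMap (Matrix.toEuclideanLin A)
  let f : Space m → ℝ := fun x => affineMap A b x i
  have hf' : ∀ x, HasFDerivAt f ((EuclideanSpace.proj (𝕜 := ℝ) i).comp L) x := by
    intro x
    have h1 : HasFDerivAt (affineMap A b) L x := L.hasFDerivAt.add_const b
    have h2 : HasFDerivAt (fun y : Space d => y i) (EuclideanSpace.proj (𝕜 := ℝ) i)
        (affineMap A b x) := (EuclideanSpace.proj (𝕜 := ℝ) i).hasFDerivAt
    exact h2.comp x h1
  have hfd : ∀ x, fderiv ℝ f x (EuclideanSpace.single j 1) = A i j := by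
    intro x
    rw [(hf' x).fderiv]
    simp [L, Matrix.toLpLin_apply, Matrix.mulVec_single]
  have hfc : Continuous f := continuous_iff_continuousAt.2 fun x => (hf' x).continuousAt
  have h1 := integral_mul_fderiv_eq_neg_fderiv_mul_of_integrable (μ := volume) (f := f) (g := φ)
    (v := EuclideanSpace.single j 1)
    (by
      simp only [hfd]
      exact (hφ.continuous.integrable_of_hasCompactSupport hφ').const_mul _)
    (integrable_mul_of_continuous hfc (continuous_fderiv_apply hφ _)
      (hasCompactSupport_fderiv_apply hφ' _))
    (integrable_mul_of_continuous hfc hφ.continuous hφ')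
    (fun x _ => (hf' x).differentiableAt) (fun x _ => (hφ.differentiable (by simp)) x)
  simpa only [hfd] using h1

theorem IsRealization.isPiecewiseAffine {A : Mat d m} {S : Set (Set (Space m) × Label d m)}
    {w : Space m → Space d} (h : IsRealization Ω A S w) (b : Space d) :
    IsPiecewiseAffine Ω fun x => affineMap A b x + w x := by
  refine ⟨Prod.fst '' S, h.countable.image _, ?_, ?_, ?_⟩
  · rintro _ ⟨u, hu, rfl⟩ _ ⟨v, hv, rfl⟩ huv
    exact h.disjoint hu hv fun h => huv (by rw [h])
  · rintro _ ⟨v, hv, rfl⟩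
    obtain ⟨b', hb'⟩ := h.affine v hv
    refine ⟨h.regular v hv, h.subset v hv, v.2.1, b + b', fun x hx => ?_⟩
    dsimp only
    rw [hb' x hx, affineMap_apply_eq_add]
  · rw [Set.sUnion_image]
    exact h.cover

theorem IsRealization.hasWeakGradient {A : Mat d m} {S : Set (Set (Space m) × Label d m)}
    {w : Space m → Space d} {q : PMF (Label d m)} (hΩ : IsRegularDomain Ω)
    (h : IsRealization Ω A S w) (hq : HasDist Ω S q) (hm : moment q ≠ ⊤) (b : Space d) :
    HasWeakGradient Ω (fun x => affineMap A b x + w x) fun x => A + pieceGrad S A x := by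
  have hci : ∀ i, Continuous fun y : Space d => y i := fun i =>
    (EuclideanSpace.proj (𝕜 := ℝ) i).continuous
  have hcomp : IsCompact (closure Ω) := hΩ.isBounded.isCompact_closure
  have hInt : ∀ i j, Integrable fun x => pieceGrad S A x i j := fun i j =>
    h.integrable_pieceGrad hΩ hq hm A i j
  refine ⟨fun i => ?_, fun i j => ?_, fun φ hφ hφ' hφΩ i j => ?_⟩
  · exact (((hci i).comp ((continuous_affineMap A b).add h.continuous)).continuousOn.integrableOn_compact
      hcomp).mono_set subset_closure
  · exact (integrableOn_const hΩ.volume_ne_top).add (hInt i j).integrableOn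
  · have h0 : ∀ x, x ∉ Ω → φ x = 0 := fun x hx =>
      image_eq_zero_of_notMem_tsupport fun h => hx (hφΩ h)
    have h1 : ∀ x, x ∉ Ω → fderiv ℝ φ x = 0 := fun x hx =>
      image_eq_zero_of_notMem_tsupport fun h => hx (hφΩ (tsupport_fderiv_subset ℝ h))
    rw [setIntegral_eq_integral_of_forall_compl_eq_zero fun x hx => by simp [h1 x hx],
      setIntegral_eq_integral_of_forall_compl_eq_zero fun x hx => by simp [h0 x hx]]
    have i1 : Integrable fun x => affineMap A b x i * fderiv ℝ φ x (EuclideanSpace.single j 1) :=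
      integrable_mul_of_continuous ((hci i).comp (continuous_affineMap A b))
        (continuous_fderiv_apply hφ _) (hasCompactSupport_fderiv_apply hφ' _)
    have i2 : Integrable fun x => w x i * fderiv ℝ φ x (EuclideanSpace.single j 1) :=
      integrable_mul_of_continuous ((hci i).comp h.continuous)
        (continuous_fderiv_apply hφ _) (hasCompactSupport_fderiv_apply hφ' _)
    have i3 : Integrable fun x => A i j * φ x :=
      (hφ.continuous.integrable_of_hasCompactSupport hφ').const_mul _
    have i4 : Integrable fun x => pieceGrad S A x i j * φ x :=
      Integrable.mul_of_hasCompactSupport (hInt i j) hφ.continuous hφ'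
    calc _ = (∫ x, affineMap A b x i * fderiv ℝ φ x (EuclideanSpace.single j 1)) +
          ∫ x, w x i * fderiv ℝ φ x (EuclideanSpace.single j 1) := by
          rw [← integral_add i1 i2]
          refine integral_congr_ae (Eventually.of_forall fun x => ?_)
          simp only [PiLp.add_apply]
          ring
      _ = -((∫ x, A i j * φ x) + ∫ x, pieceGrad S A x i j * φ x) := by
          rw [integral_affineMap_mul_fderiv A b hφ hφ', (h.weak i j).integral_eq φ hφ hφ']
          ring
      _ = _ := by
          rw [← integral_add i3 i4]
          congr 1
          refine integral_congr_ae (Eventually.of_forall fun x => ?_)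
          simp only [Matrix.add_apply]
          ring

theorem IsPartition.volume_tail {A : Mat d m} {S : Set (Set (Space m) × Label d m)}
    {q : PMF (Label d m)} (h : IsPartition Ω S) (hq : HasDist Ω S q) (t : ℝ) :
    volume {x ∈ Ω | t < ‖A + pieceGrad S A x‖} = volume Ω * gradLaw q (tailSet d m t) := by
  let T := {v ∈ S | t < ‖v.2.1‖}
  have hT : T ⊆ S := fun v hv => hv.1
  have hG : ∀ v ∈ S, ∀ x ∈ v.1, A + pieceGrad S A x = v.2.1 := fun v hv x hx => by
    rw [pieceGrad_eq h.disjoint hv hx, add_sub_cancel]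
  have h1 : {x ∈ Ω | t < ‖A + pieceGrad S A x‖} =ᵐ[volume] ⋃ v ∈ T, v.1 := by
    refine eventuallyEq_set.2 ?_
    filter_upwards [h.ae_mem] with x hx
    constructor
    · rintro ⟨hxΩ, hxt⟩
      obtain ⟨v, hv, hxv⟩ := hx hxΩ
      rw [hG v hv x hxv] at hxt
      exact Set.mem_iUnion₂.2 ⟨v, ⟨hv, hxt⟩, hxv⟩
    · intro hxT
      obtain ⟨v, hv, hxv⟩ := Set.mem_iUnion₂.1 hxT
      refine ⟨h.subset v hv.1 hxv, ?_⟩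
      rw [hG v hv.1 x hxv]
      exact hv.2
  rw [measure_congr h1, measure_biUnion (h.countable.mono hT) (h.disjoint.subset hT)
    fun v hv => (h.regular v hv.1).isOpen.measurableSet,
    gradLaw_apply _ (measurableSet_tailSet t), ← hq.tsum_mul,
    tsum_subtype T fun v => volume v.1,
    tsum_subtype S fun v => volume v.1 * (tailSet d m t).indicator (fun _ => 1) v.2.1]
  refine tsum_congr fun v => ?_
  by_cases hv : v ∈ S
  · by_cases hvt : v.2.1 ∈ tailSet d m t
    · have hvT : v ∈ T := ⟨hv, hvt⟩
      rw [Set.indicator_of_mem hvT, Set.indicator_of_mem hv, Set.indicator_of_mem hvt, mul_one]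
    · rw [Set.indicator_of_notMem fun h : v ∈ T => hvt h.2, Set.indicator_of_mem hv,
        Set.indicator_of_notMem hvt, mul_zero]
  · rw [Set.indicator_of_notMem fun h : v ∈ T => hv h.1, Set.indicator_of_notMem hv]

theorem Realizable.exists_map {A : Mat d m} {q : PMF (Label d m)}
    (h : Realizable α A q) (hm : moment q ≠ ⊤) (hqK : ∀ s, q s ≠ 0 → s.1 ∈ K)
    (hΩ : IsRegularDomain Ω) (b : Space d) {δ : ℝ} (hδ : 0 < δ) {β : ℝ≥0} (hβ : (β : ℝ) ≤ α)
    (hβ1 : (β : ℝ) ≤ 1) :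
    ∃ (u : Space m → Space d) (G : Space m → Mat d m),
      IsPiecewiseAffine Ω u ∧ HasWeakGradient Ω u G ∧ MemHolderOn β Ω u ∧
      Set.EqOn u (affineMap A b) (frontier Ω) ∧ (∀ᵐ x ∂volume.restrict Ω, G x ∈ K) ∧
      holderNormOn β Ω (fun x => u x - affineMap A b x) < ENNReal.ofReal δ ∧
      ∀ t : ℝ, volume.real {x ∈ Ω | t < ‖G x‖} / volume.real Ω =
        (gradLaw q).real (tailSet d m t) := by
  -- The sup norm takes δ/4 and the seminorm for the exponent β takes 2δ/4, which leaves the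
  -- inequality strict.
  obtain ⟨S, w, hS, hq, hw⟩ := h Ω hΩ (δ / 4) (by positivity)
  have hcont : Continuous fun x => affineMap A b x + w x :=
    (continuous_affineMap A b).add hS.continuous
  refine ⟨fun x => affineMap A b x + w x, fun x => A + pieceGrad S A x, hS.isPiecewiseAffine b,
    hS.hasWeakGradient hΩ hq hm b, ⟨hcont.continuousOn, ?_⟩, fun x hx => ?_, ?_, ?_, fun t => ?_⟩
  · obtain ⟨s, hs⟩ := hΩ.isBounded.isCompact_closure.exists_bound_of_continuousOn hcont.continuousOn
    obtain ⟨C, hC0, hC⟩ := affineMap_holder hΩ.isBounded A b β hβ1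
    refine lt_of_le_of_lt (holderNormOn_le (C := C + 2 * (δ / 4)) hs (by positivity)
      fun x hx y hy => ?_) (ENNReal.add_lt_top.2 ⟨ENNReal.ofReal_lt_top, ENNReal.ofReal_lt_top⟩)
    calc _ = ‖(affineMap A b x - affineMap A b y) + (w x - w y)‖ := by congr 1; abel
      _ ≤ _ := norm_add_le _ _
      _ ≤ _ := by
          rw [add_mul]
          exact add_le_add (hC x hx y hy) (hw.norm_sub_le_of_le hβ x y)
  · have hxΩ : x ∉ Ω := fun h => by
      rw [hΩ.isOpen.frontier_eq] at hx
      exact hx.2 h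
    simp [hS.eq_zero x hxΩ]
  · rw [ae_restrict_iff' hΩ.isOpen.measurableSet]
    filter_upwards [hS.ae_mem] with x hx hxΩ
    obtain ⟨v, hv, hxv⟩ := hx hxΩ
    rw [pieceGrad_eq hS.disjoint hv hxv, add_sub_cancel]
    exact hqK _ (hq.apply_ne_zero hv (hS.regular v hv))
  · simp only [add_sub_cancel_left]
    refine lt_of_le_of_lt (holderNormOn_le (fun x _ => hw.norm_le x) (by positivity)
      fun x _ y _ => hw.norm_sub_le_of_le hβ x y) ?_
    rw [← ENNReal.ofReal_add (by positivity) (by positivity)]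
    exact (ENNReal.ofReal_lt_ofReal_iff hδ).2 (by linarith)
  · have hΩ0 : volume.real Ω ≠ 0 := by
      rw [measureReal_def]
      exact (ENNReal.toReal_pos hΩ.volume_ne_zero hΩ.volume_ne_top).ne'
    rw [measureReal_def, hS.volume_tail hq, ENNReal.toReal_mul, ← measureReal_def,
      ← measureReal_def]
    field_simp

end Maps

/-! ### The weight of the construction -/

section Weight

variable {d m : ℕ} {p r M : ℝ}

/-- Dominates the tail constants of the staircase laminates. -/
def tailWeight (p r M x : ℝ) : ℝ := (1 + x) + (1 + x) ^ p + M ^ p * (1 + x ^ r)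

theorem tailWeight_mono (hp : 0 ≤ p) (hr : 0 ≤ r) (hM : 0 ≤ M) {x y : ℝ} (hx : 0 ≤ x)
    (hxy : x ≤ y) : tailWeight p r M x ≤ tailWeight p r M y := by
  unfold tailWeight
  gcongr

theorem one_add_le_tailWeight (hM : 0 ≤ M) {x : ℝ} (hx : 0 ≤ x) : 1 + x ≤ tailWeight p r M x := by
  have h1 : 0 ≤ (1 + x) ^ p := by positivity
  have h2 : 0 ≤ M ^ p * (1 + x ^ r) := by positivity
  unfold tailWeight
  linarith

theorem locallyBounded_tailWeight (hp : 0 ≤ p) (hr : 0 ≤ r) (hM : 0 ≤ M) :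
    LocallyBounded fun X : Mat d m => ENNReal.ofReal (tailWeight p r M ‖X‖) := by
  intro X
  refine ⟨1, one_pos, Real.toNNReal (tailWeight p r M (‖X‖ + 1)), fun Y hY => ?_⟩
  refine ENNReal.ofReal_le_ofReal (tailWeight_mono hp hr hM (norm_nonneg _) ?_)
  have := norm_le_norm_add_norm_sub X Y
  rw [norm_sub_rev] at this
  linarith

/-- The hypothesis only covers t > 1 + x. Below that, the trivial bound 1 = t^p t^{-p} is at most (1
+ x)^p t^{-p}, which is the reason for this term in the weight. -/
theorem tail_le_tailWeight (hp : 0 ≤ p) (hM : 0 ≤ M) {ν : Measure (Mat d m)}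
    [IsProbabilityMeasure ν] {x : ℝ} (hx : 0 ≤ x)
    (h : ∀ t : ℝ, 1 + x < t →
      ν.real (tailSet d m t) ≤ M ^ p * (1 + x ^ r) * t ^ (-p)) {t : ℝ} (ht : 0 < t) :
    ν (tailSet d m t) ≤ ENNReal.ofReal (tailWeight p r M x) * ENNReal.ofReal (t ^ (-p)) := by
  have hw0 : 0 ≤ tailWeight p r M x := le_trans (by positivity) (one_add_le_tailWeight hM hx)
  have ht0 : 0 < t ^ (-p) := by positivity
  have h1 : 0 ≤ (1 + x) ^ p := by positivity
  have h2 : 0 ≤ M ^ p * (1 + x ^ r) := by positivity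
  rw [← ENNReal.ofReal_mul hw0, ← ofReal_measureReal (measure_ne_top ν _)]
  refine ENNReal.ofReal_le_ofReal ?_
  rcases lt_or_ge (1 + x) t with hxt | hxt
  · refine (h t hxt).trans ?_
    gcongr
    unfold tailWeight
    linarith
  · calc ν.real (tailSet d m t) ≤ 1 := measureReal_le_one
      _ = t ^ p * t ^ (-p) := by rw [← Real.rpow_add ht, add_neg_cancel, Real.rpow_zero]
      _ ≤ tailWeight p r M x * t ^ (-p) := by
          gcongr
          have := Real.rpow_le_rpow ht.le hxt hp
          unfold tailWeight
          linarith

end Weight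

end StaircaseLaminates

end

/-! ### The theorem -/

theorem theoremA3 {d m : ℕ} (K : Set (Matrix (Fin d) (Fin m) ℝ)) (p r ρ M : ℝ)
    (hp : 1 < p) (hpr : p ≤ r) (hρ : 0 ≤ ρ) (hρr : ρ ≤ r) (hM : 1 < M)
    (hK : ∀ A : Matrix (Fin d) (Fin m) ℝ, ∃ ν : Measure (Matrix (Fin d) (Fin m) ℝ),
      StaircaseLaminates.IsExtendedStaircase K A ν ∧
      ∀ t : ℝ, 1 + ‖A‖ < t →
        M ^ (-p) * (1 + ‖A‖ ^ ρ) * t ^ (-p) ≤ ν.real {X | t < ‖X‖} ∧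
        ν.real {X | t < ‖X‖} ≤ M ^ p * (1 + ‖A‖ ^ r) * t ^ (-p))
    (Ω : Set (EuclideanSpace ℝ (Fin m))) (hΩ : StaircaseLaminates.IsRegularDomain Ω)
    (A : Matrix (Fin d) (Fin m) ℝ) (b : EuclideanSpace ℝ (Fin d))
    (δ : ℝ) (hδ : 0 < δ) (α : ℝ≥0) (hα : α < 1) :
    ∃ (u : EuclideanSpace ℝ (Fin m) → EuclideanSpace ℝ (Fin d))
      (G : EuclideanSpace ℝ (Fin m) → Matrix (Fin d) (Fin m) ℝ),
      StaircaseLaminates.IsPiecewiseAffine Ω u ∧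
      StaircaseLaminates.HasWeakGradient Ω u G ∧
      StaircaseLaminates.MemHolderOn α Ω u ∧
      Set.EqOn u (StaircaseLaminates.affineMap A b) (frontier Ω) ∧
      (∀ᵐ x ∂volume.restrict Ω, G x ∈ K) ∧
      StaircaseLaminates.holderNormOn α Ω (fun x => u x - StaircaseLaminates.affineMap A b x) <
        ENNReal.ofReal δ ∧
      ∀ t : ℝ, 1 + ‖A‖ < t →
        1 / 2 * M ^ (-p) * (1 + ‖A‖ ^ ρ) * t ^ (-p) ≤
          volume.real {x ∈ Ω | t < ‖G x‖} / volume.real Ω ∧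
        volume.real {x ∈ Ω | t < ‖G x‖} / volume.real Ω ≤
          2 * M ^ p * (1 + ‖A‖ ^ r) * t ^ (-p) := by
  have hp0 : 0 ≤ p := by linarith
  have hM0 : 0 < M := by linarith
  rcases Nat.eq_zero_or_pos m with rfl | hm0
  -- For m = 0 the only matrix is 0, so the lower tail bound at t = 2 contradicts itself. The case
  -- has to be split off because tags are distributed by cutting a cube along a coordinate.
  · obtain ⟨ν, -, hν⟩ := hK 0
    have h1 := (hν 2 (by rw [norm_zero]; norm_num)).1
    have h2 : {X : Matrix (Fin d) (Fin 0) ℝ | 2 < ‖X‖} = ∅ := by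
      refine Set.eq_empty_of_forall_notMem fun X hX => ?_
      have hX0 : X = 0 := Subsingleton.elim _ _
      rw [Set.mem_ofPred_eq, hX0, norm_zero] at hX
      linarith
    rw [h2, measureReal_empty] at h1
    have h3 : 0 < M ^ (-p) * (1 + ‖(0 : Matrix (Fin d) (Fin 0) ℝ)‖ ^ ρ) * 2 ^ (-p) := by positivity
    linarith
  -- The construction needs a positive exponent, since continuity of the limits is read off the
  -- Hölder bound; α = 0 is allowed in the statement.
  · let α' : ℝ := max α (1 / 2)
    have hα'0 : 0 < α' := lt_max_of_lt_right (by norm_num)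
    have hα'1 : α' < 1 := max_lt (by exact_mod_cast hα) (by norm_num)
    let c : Matrix (Fin d) (Fin m) ℝ → ℝ≥0∞ := fun X =>
      ENNReal.ofReal (StaircaseLaminates.tailWeight p r M ‖X‖)
    have hc : ∀ X, 1 + ‖X‖ₑ ≤ c X := fun X => by
      rw [← ofReal_norm, ← ENNReal.ofReal_one, ← ENNReal.ofReal_add zero_le_one (norm_nonneg _)]
      exact ENNReal.ofReal_le_ofReal
        (StaircaseLaminates.one_add_le_tailWeight hM0.le (norm_nonneg X))
    choose ν hν hνt using hK
    choose Q hQlaw hQs hQm hQ using fun X =>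
      (hν X).exists_approxRealizable hα'0 hα'1 hm0 hc
        (StaircaseLaminates.locallyBounded_tailWeight hp0 (by linarith) hM0.le)
    have hνt' : ∀ X t, 1 + ‖X‖ < t →
        M ^ (-p) * (1 + ‖X‖ ^ ρ) * t ^ (-p) ≤
          (StaircaseLaminates.gradLaw (Q X)).real (StaircaseLaminates.tailSet d m t) ∧
        (StaircaseLaminates.gradLaw (Q X)).real (StaircaseLaminates.tailSet d m t) ≤
          M ^ p * (1 + ‖X‖ ^ r) * t ^ (-p) := by
      intro X t ht
      rw [hQlaw]
      exact hνt X t ht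
    obtain ⟨q, hq, hqm, hqK, hqt⟩ := StaircaseLaminates.exists_realizable_of_tail_le hα'0 hc
      (fun X => ENNReal.ofReal_ne_top) hp hQ hQs hQm (fun X t ht =>
        StaircaseLaminates.tail_le_tailWeight hp0 hM0.le (norm_nonneg X)
          (fun t ht => (hνt' X t ht).2) ht) A
    obtain ⟨u, G, h1, h2, h3, h4, h5, h6, h7⟩ := hq.exists_map hqm hqK hΩ b hδ
      (le_max_left (α : ℝ) (1 / 2)) (by exact_mod_cast hα.le)
    refine ⟨u, G, h1, h2, h3, h4, h5, h6, fun t ht => ?_⟩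
    rw [h7 t]
    have ht0 : 0 < t := lt_of_le_of_lt (add_nonneg zero_le_one (norm_nonneg A)) ht
    obtain ⟨hlow, hup⟩ := hqt t ht0
    obtain ⟨h8, h9⟩ := hνt' A t ht
    have htp : 0 < t ^ (-p) := by positivity
    have hlow' := ENNReal.toReal_mono (by finiteness) hlow
    rw [ENNReal.toReal_add (by finiteness) (by finiteness), ENNReal.toReal_mul] at hlow'
    have hup' := ENNReal.toReal_mono (by finiteness) hup
    rw [ENNReal.toReal_add (by finiteness) (by finiteness), ENNReal.toReal_ofReal htp.le] at hup'
    simp only [← measureReal_def, ENNReal.toReal_inv, ENNReal.toReal_ofNat] at hlow' hup'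
    refine ⟨?_, ?_⟩
    · linarith
    · have hMp : 1 ≤ M ^ p := Real.one_le_rpow hM.le hp0
      have hA : 0 ≤ ‖A‖ ^ r := by positivity
      -- The t^{-p} contributed by the later rounds is absorbed by doubling the upper bound, since
      -- M^p (1 + |A|^r) ≥ 1.
      have h10 : 1 * t ^ (-p) ≤ M ^ p * (1 + ‖A‖ ^ r) * t ^ (-p) := by
        gcongr
        nlinarith
      linarith
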